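/- Let $K\ge 2$ and $d\ge 0$ be integers and $[K]=\{1,\dots,K\}$. There is a constant $C=C(d,K)>0$ such that the following holds. Let $\mathcal X$ be a measurable space and let $\mathcal H\subset[K]^{\mathcal X}$ be a class of measurable functions with Littlestone dimension $\mathrm{Ldim}(\mathcal H)=d$. Here $\mathrm{Ldim}(\mathcal H)$ is the maximal depth of a complete binary tree, with internal nodes labelled by points of $\mathcal X$ and with the two edges descending from each internal node labelled by two distinct elements of $[K]$, that is shattered by $\mathcal H$: for every root-to-leaf path, with nodes $x_1,\dots,x_m$ and edge labels $y_1,\dots,y_m$, some $h\in\mathcal H$ satisfies $h(x_i)=y_i$ for all $i\le m$. Let $\epsilon,\delta\in(0,1)$ and $\alpha,\beta\in(0,1/2)$, and let $n$ be any integer with $$n\ \ge\ C\,\frac{\log(1/(\beta\delta))}{\alpha^2\epsilon}.$$ Then there is a randomized algorithm $\mathcal A:(\mathcal X\times[K])^n\to[K]^{\mathcal X}$ with the following two properties. 1. $\mathcal A$ is $(\epsilon,\delta)$-differentially private: $\mathbb P(\mathcal A(S)\in T)\le e^{\epsilon}\,\mathbb P(\mathcal A(S')\in T)+\delta$ for every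 set $T$ of outputs and all samples $S,S'$ of size $n$ that differ in exactly one example. 2. For every probability distribution $\mathcal D$ on $\mathcal X\times[K]$ (not assumed to be realizable by $\mathcal H$), if $S\sim\mathcal D^n$, then with probability at least $1-\beta$ over $S$ and the randomness of $\mathcal A$ the output $f=\mathcal A(S)$ satisfies $$\mathrm{loss}_{\mathcal D}(f)\ \le\ \inf_{h\in\mathcal H}\mathrm{loss}_{\mathcal D}(h)+\alpha,\qquad\text{where }\ \mathrm{loss}_{\mathcal D}(f)=\mathbb P_{(x,y)\sim\mathcal D}\big(f(x)\ne y\big).$$ Measurability convention for 2: $\mathcal D$ is such that $\mathcal H$ is separable (in Doob's sense) for the marginal $\mathcal D_{\mathcal X}$ of $\mathcal D$ on $\mathcal X$, that is, there are a countable $\mathcal H_0\subset\mathcal H$ and a $\mathcal D_{\mathcal X}$-null set $N$ such that every $h\in\mathcal H$ is the pointwise limit on $\mathcal X\setminus N$ of a sequence from $\mathcal H_0$. This is automatic if $\mathcal X$ is countable, if $\mathcal H$ is countable, or if $\mathcal D_{\mathcal X}$ is concentrated on a countable set. -/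

import Mathlib

open MeasureTheory Filter
open scoped ENNReal

/-- A complete mistake tree of depth `n` over the instance space `X` and the label set `[K]`.
Every internal node carries an instance, and its two descending edges carry distinct labels. -/
inductive MistakeTree (X : Type*) (K : ℕ) : ℕ → Type _
  | leaf : MistakeTree X K 0
  | node {n : ℕ} (x : X) (k k' : Fin K) (hk : k ≠ k')
      (left right : MistakeTree X K n) : MistakeTree X K (n + 1)

/-- The root-to-leaf paths of a mistake tree, each written as the sequence of pairs
(instance at the node, label of the edge that the path takes below that node). -/
def MistakeTree.paths {X : Type*} {K : ℕ} : {n : ℕ} → MistakeTree X K n → Set (List (X × Fin K))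
  | _, .leaf => {[]}
  | _, .node x k k' _ left right =>
      {p | (∃ q ∈ left.paths, p = (x, k) :: q) ∨ (∃ q ∈ right.paths, p = (x, k') :: q)}

/-- The tree `t` is shattered by `H`: every root-to-leaf path is realized by some `h ∈ H`. -/
def Shatters {X : Type*} {K n : ℕ} (H : Set (X → Fin K)) (t : MistakeTree X K n) : Prop :=
  ∀ p ∈ t.paths, ∃ h ∈ H, ∀ z ∈ p, h z.1 = z.2

/-- The multi-class Littlestone dimension: the maximal depth of a shattered mistake tree. -/
noncomputable def Ldim {X : Type*} {K : ℕ} (H : Set (X → Fin K)) : ℕ∞ :=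
  ⨆ (n : ℕ) (_ : ∃ t : MistakeTree X K n, Shatters H t), (n : ℕ∞)

/-- The population zero-one loss `E_{(x,y) ∼ D} 𝟙[f(x) ≠ y] = D {(x, y) | f(x) ≠ y}`.
(For a hypothesis that is not measurable this is the outer measure of the error set, so that an
upper bound on it is the strongest possible reading.) -/
noncomputable def popLoss {X : Type*} [MeasurableSpace X] {K : ℕ}
    (D : Measure (X × Fin K)) (f : X → Fin K) : ℝ≥0∞ :=
  D {z | f z.1 ≠ z.2}

/-- Two samples of size `n` are neighboring if they differ in exactly one example. -/
def Neighboring {Z : Type*} {n : ℕ} (S S' : Fin n → Z) : Prop :=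
  ∃! i, S i ≠ S' i

/-- A randomized learning algorithm on samples of size `n`: it maps a sample to the distribution
of the hypothesis that it outputs. It draws its random coins from a discrete distribution, so
that every set of outputs is measurable. -/
abbrev Learner (X : Type*) (K n : ℕ) : Type _ :=
  (Fin n → X × Fin K) → PMF (X → Fin K)

/-- `(ε, δ)`-differential privacy. -/
def IsDP {X : Type*} {K n : ℕ} (ε δ : ℝ) (A : Learner X K n) : Prop :=
  ∀ S S' : Fin n → X × Fin K, Neighboring S S' → ∀ T : Set (X → Fin K),
    (A S).toOuterMeasure T
      ≤ ENNReal.ofReal (Real.exp ε) * (A S').toOuterMeasure T + ENNReal.ofReal δ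

/-- The probability, over an i.i.d. sample `S ∼ D^n` and over the coins of `A`, that the output
`A(S)` lies in `G`. (If the integrand is not measurable, this is its lower integral, so that a
lower bound on it is the strongest possible reading.) -/
noncomputable def outputProb {X : Type*} [MeasurableSpace X] {K n : ℕ}
    (D : Measure (X × Fin K)) (A : Learner X K n) (G : Set (X → Fin K)) : ℝ≥0∞ :=
  ∫⁻ S, (A S).toOuterMeasure G ∂(Measure.pi fun _ : Fin n => D)

/-- The usual measurability condition (separability in the sense of Doob) on a class `H` of
measurable functions: outside a single null set, every member of `H` is the pointwise limit of a
sequence from a fixed countable subclass. Labels are discrete, so that convergence at a point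
means being eventually equal there. The condition holds for every `μ` if `X` or `H` is countable,
and for every `H` if `μ` is concentrated on a countable set. -/
def DoobSeparable {X : Type*} [MeasurableSpace X] {K : ℕ}
    (H : Set (X → Fin K)) (μ : Measure X) : Prop :=
  ∃ H₀ ⊆ H, H₀.Countable ∧ ∃ N : Set X, μ N = 0 ∧
    ∀ h ∈ H, ∃ g : ℕ → X → Fin K, (∀ j, g j ∈ H₀) ∧
      ∀ x, x ∉ N → ∀ᶠ j in atTop, g j x = h x

/-- The members of `V` that take the value `k` at `x`. -/
def restrictAt {X : Type*} {K : ℕ} (V : Set (X → Fin K)) (x : X) (k : Fin K) : Set (X → Fin K) :=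
  {h | h ∈ V ∧ h x = k}

/-- `LDeep n V`: some mistake tree of depth `n` is shattered by `V`, stated by recursion. -/
def LDeep {X : Type*} {K : ℕ} : ℕ → Set (X → Fin K) → Prop
  | 0, V => V.Nonempty
  | n + 1, V => ∃ x k k', k ≠ k' ∧ LDeep n (restrictAt V x k) ∧ LDeep n (restrictAt V x k')

section Depth

variable {X : Type*} {K : ℕ}

theorem restrictAt_mono {V W : Set (X → Fin K)} (h : V ⊆ W) (x : X) (k : Fin K) :
    restrictAt V x k ⊆ restrictAt W x k := fun _ hg => ⟨h hg.1, hg.2⟩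

theorem restrictAt_subset (V : Set (X → Fin K)) (x : X) (k : Fin K) :
    restrictAt V x k ⊆ V := fun _ hg => hg.1

theorem LDeep.mono {n : ℕ} : ∀ {V W : Set (X → Fin K)}, V ⊆ W → LDeep n V → LDeep n W := by
  induction n with
  | zero => intro V W h hV; exact Set.Nonempty.mono h hV
  | succ n ih =>
    rintro V W h ⟨x, k, k', hk, h1, h2⟩
    exact ⟨x, k, k', hk, ih (restrictAt_mono h x k) h1, ih (restrictAt_mono h x k') h2⟩

theorem LDeep.of_succ {n : ℕ} {V : Set (X → Fin K)} (h : LDeep (n + 1) V) : LDeep n V := by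
  obtain ⟨x, k, k', -, h1, -⟩ := h
  exact h1.mono (restrictAt_subset V x k)

theorem LDeep.of_le {m n : ℕ} (hmn : m ≤ n) {V : Set (X → Fin K)} (h : LDeep n V) : LDeep m V := by
  induction n, hmn using Nat.le_induction with
  | base => exact h
  | succ n _ ih => exact ih h.of_succ

theorem LDeep.nonempty {n : ℕ} {V : Set (X → Fin K)} (h : LDeep n V) : V.Nonempty :=
  LDeep.of_le (Nat.zero_le n) h

theorem LDeep.exists_tree {n : ℕ} : ∀ {V : Set (X → Fin K)}, LDeep n V →
    ∃ t : MistakeTree X K n, Shatters V t := by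
  induction n with
  | zero =>
    rintro V ⟨h, hh⟩
    refine ⟨.leaf, fun p hp => ⟨h, hh, ?_⟩⟩
    simp only [MistakeTree.paths, Set.mem_singleton_iff] at hp
    simp [hp]
  | succ n ih =>
    rintro V ⟨x, k, k', hk, h1, h2⟩
    obtain ⟨t1, ht1⟩ := ih h1
    obtain ⟨t2, ht2⟩ := ih h2
    refine ⟨.node x k k' hk t1 t2, ?_⟩
    rintro p (⟨q, hq, rfl⟩ | ⟨q, hq, rfl⟩)
    · obtain ⟨h, hh, hq'⟩ := ht1 q hq
      exact ⟨h, hh.1, by simpa using ⟨hh.2, fun a b hab => hq' (a, b) hab⟩⟩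
    · obtain ⟨h, hh, hq'⟩ := ht2 q hq
      exact ⟨h, hh.1, by simpa using ⟨hh.2, fun a b hab => hq' (a, b) hab⟩⟩

theorem not_lDeep_of_Ldim_eq {d : ℕ} {H : Set (X → Fin K)} (h : Ldim H = (d : ℕ∞)) :
    ¬ LDeep (d + 1) H := by
  intro hd
  have h1 : ((d + 1 : ℕ) : ℕ∞) ≤ Ldim H :=
    le_iSup₂_of_le (f := fun (n : ℕ) (_ : ∃ t : MistakeTree X K n, Shatters H t) => (n : ℕ∞))
      (d + 1) hd.exists_tree le_rfl
  rw [h, Nat.cast_le] at h1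
  omega

/-- At most one label at `x` keeps the full depth. -/
theorem eq_of_lDeep_restrictAt {n : ℕ} {V : Set (X → Fin K)} (hV : ¬ LDeep (n + 1) V) {x : X}
    {k k' : Fin K} (h : LDeep n (restrictAt V x k)) (h' : LDeep n (restrictAt V x k')) : k = k' := by
  by_contra hk
  exact hV ⟨x, k, k', hk, h, h'⟩

/-- The functions that agree with some member of `V` on any `r` points. -/
def localClosure (r : ℕ) (V : Set (X → Fin K)) : Set (X → Fin K) :=
  {f | ∀ a : Fin r → X, ∃ h ∈ V, ∀ i, h (a i) = f (a i)}

theorem subset_localClosure (r : ℕ) (V : Set (X → Fin K)) : V ⊆ localClosure r V :=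
  fun f hf _ => ⟨f, hf, fun _ => rfl⟩

theorem localClosure_mono (r : ℕ) {V W : Set (X → Fin K)} (h : V ⊆ W) :
    localClosure r V ⊆ localClosure r W := fun _ hf a =>
  let ⟨g, hg, hga⟩ := hf a
  ⟨g, h hg, hga⟩

theorem LDeep.of_localClosure {n : ℕ} : ∀ {V : Set (X → Fin K)},
    LDeep n (localClosure n V) → LDeep n V := by
  induction n with
  | zero =>
    rintro V ⟨f, hf⟩
    obtain ⟨h, hh, -⟩ := hf Fin.elim0
    exact ⟨h, hh⟩
  | succ n ih =>
    have key : ∀ (V : Set (X → Fin K)) x k,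
        restrictAt (localClosure (n + 1) V) x k ⊆ localClosure n (restrictAt V x k) := by
      rintro V x k f ⟨hf, hfx⟩ a
      obtain ⟨h, hh, ha⟩ := hf (Fin.cons x a)
      refine ⟨h, ⟨hh, ?_⟩, fun i => by simpa using ha i.succ⟩
      have := ha 0
      simp only [Fin.cons_zero] at this
      rw [this, hfx]
    rintro V ⟨x, k, k', hk, h1, h2⟩
    exact ⟨x, k, k', hk, ih (h1.mono (key V x k)), ih (h2.mono (key V x k'))⟩

/-- The label patterns of `V` on the points `a`. -/
def patterns {s : ℕ} (V : Set (X → Fin K)) (a : Fin s → X) : Set (Fin s → Fin K) :=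
  (fun h i => h (a i)) '' V

theorem ncard_patterns_succ_le {s : ℕ} (V : Set (X → Fin K)) (a : Fin (s + 1) → X) :
    (patterns V a).ncard ≤ ∑ k : Fin K, (patterns (restrictAt V (a 0) k) (Fin.tail a)).ncard := by
  have hsub : patterns V a ⊆
      ⋃ k ∈ (Finset.univ : Finset (Fin K)),
        (fun p => (Fin.cons k p : Fin (s + 1) → Fin K)) ''
        patterns (restrictAt V (a 0) k) (Fin.tail a) := by
    rintro _ ⟨h, hh, rfl⟩
    simp only [Set.mem_iUnion, Finset.mem_univ, exists_true_left]
    refine ⟨h (a 0), _, ⟨h, ⟨hh, rfl⟩, rfl⟩, ?_⟩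
    funext i
    refine Fin.cases ?_ (fun j => ?_) i <;> simp [Fin.tail]
  refine (Set.ncard_le_ncard hsub (Set.toFinite _)).trans ?_
  refine (Finset.set_ncard_biUnion_le _ _).trans (Finset.sum_le_sum fun k _ => ?_)
  exact Set.ncard_image_le (Set.toFinite _)

theorem ncard_patterns_le {s : ℕ} : ∀ {d : ℕ} {V : Set (X → Fin K)}, ¬ LDeep (d + 1) V →
    ∀ a : Fin s → X, (patterns V a).ncard ≤ (1 + K * s) ^ d := by
  induction s with
  | zero =>
    intro d V _ a
    refine (Set.ncard_le_ncard (Set.subset_univ _) (Set.toFinite _)).trans ?_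
    simp [Set.ncard_univ]
  | succ s ih =>
    intro d V hV a
    refine (ncard_patterns_succ_le V a).trans ?_
    obtain ⟨k₀, hk₀⟩ | hnone : (∃ k₀, LDeep d (restrictAt V (a 0) k₀)) ∨
        ∀ k, ¬ LDeep d (restrictAt V (a 0) k) := by
      by_cases h : ∃ k₀, LDeep d (restrictAt V (a 0) k₀)
      · exact Or.inl h
      · exact Or.inr (not_exists.mp h)
    · have hother : ∀ k, k ≠ k₀ → ¬ LDeep d (restrictAt V (a 0) k) := fun k hk h =>
        hk (eq_of_lDeep_restrictAt hV h hk₀)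
      have hfull : (patterns (restrictAt V (a 0) k₀) (Fin.tail a)).ncard ≤ (1 + K * s) ^ d :=
        ih (fun h => hV (h.mono (restrictAt_subset _ _ _))) _
      rw [← Finset.add_sum_erase _ _ (Finset.mem_univ k₀)]
      cases d with
      | zero =>
        rw [Finset.sum_eq_zero, add_zero]
        · simpa using hfull
        · intro k hk
          have h0 : restrictAt V (a 0) k = ∅ :=
            Set.not_nonempty_iff_eq_empty.mp (hother k (Finset.ne_of_mem_erase hk))
          simp [h0, patterns]
      | succ d =>
        have h2 : ∑ k ∈ Finset.univ.erase k₀,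
            (patterns (restrictAt V (a 0) k) (Fin.tail a)).ncard ≤ K * (1 + K * s) ^ d := by
          refine (Finset.sum_le_card_nsmul _ _ ((1 + K * s) ^ d) fun k hk =>
            ih (hother k (Finset.ne_of_mem_erase hk)) _).trans ?_
          rw [smul_eq_mul]
          refine Nat.mul_le_mul_right _ ((Finset.card_le_univ _).trans ?_)
          simp
        calc _ ≤ (1 + K * s) ^ (d + 1) + K * (1 + K * s) ^ d := add_le_add hfull h2
          _ = (1 + K * s) ^ d * (1 + K * (s + 1)) := by ring
          _ ≤ (1 + K * (s + 1)) ^ d * (1 + K * (s + 1)) := by gcongr; omega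
          _ = _ := by ring
    · cases d with
      | zero =>
        rw [Finset.sum_eq_zero]
        · simp
        · intro k _
          have h0 : restrictAt V (a 0) k = ∅ := Set.not_nonempty_iff_eq_empty.mp (hnone k)
          simp [h0, patterns]
      | succ d =>
        refine (Finset.sum_le_card_nsmul _ _ ((1 + K * s) ^ d) fun k _ => ih (hnone k) _).trans ?_
        simp only [Finset.card_univ, Fintype.card_fin, smul_eq_mul]
        calc K * (1 + K * s) ^ d ≤ (1 + K * (s + 1)) * (1 + K * (s + 1)) ^ d := by
              gcongr <;> nlinarith
          _ = _ := by ring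

end Depth

section CountableTypes

variable {X : Type*} {K : ℕ}

theorem lDeep_of_halfGraph {x : ℕ → X} {g : ℕ → X → Fin K} {k c : Fin K} (hkc : k ≠ c)
    (hlt : ∀ j i, j < i → g j (x i) = k) (hgt : ∀ j i, i < j → g j (x i) = c) (n : ℕ) :
    ∀ s : ℕ, LDeep n {h | ∃ j, s ≤ j ∧ j < s + (2 ^ (n + 1) - 1) ∧ h = g j} := by
  induction n with
  | zero => exact fun s => ⟨g s, s, le_rfl, by simp, rfl⟩
  | succ n ih =>
    intro s
    have h2 : 2 ^ (n + 1 + 1) = 2 * 2 ^ (n + 1) := by ring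
    have h3 : 0 < 2 ^ (n + 1) := by positivity
    refine ⟨x (s + (2 ^ (n + 1) - 1)), k, c, hkc, (ih s).mono ?_,
      (ih (s + (2 ^ (n + 1) - 1) + 1)).mono ?_⟩
    · rintro _ ⟨j, h1, h4, rfl⟩
      exact ⟨⟨j, h1, by omega, rfl⟩, hlt _ _ h4⟩
    · rintro _ ⟨j, h1, h4, rfl⟩
      exact ⟨⟨j, by omega, by omega, rfl⟩, hgt _ _ (by omega)⟩

theorem Ultrafilter.exists_eventually_eq {ι κ : Type*} [Finite κ] (U : Ultrafilter ι)
    (c : ι → κ) : ∃ k, ∀ᶠ i in U, c i = k := by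
  have h : ∀ᶠ i in U, ∃ k ∈ (Set.univ : Set κ), c i = k := by simp
  obtain ⟨k, -, hk⟩ := (Ultrafilter.eventually_exists_mem_iff Set.finite_univ).mp h
  exact ⟨k, hk⟩

/-- Ramsey's theorem for pairs of naturals and finitely many colours, with vertex colours. -/
theorem exists_strictMono_homogeneous {κ κ' : Type*} [Finite κ] [Finite κ']
    (v : ℕ → κ') (e : ℕ → ℕ → κ) :
    ∃ (φ : ℕ → ℕ) (a : κ') (c : κ), StrictMono φ ∧ (∀ i, v (φ i) = a) ∧
      ∀ i j, i < j → e (φ i) (φ j) = c := by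
  let U : Ultrafilter ℕ := hyperfilter ℕ
  choose w hw using fun i => U.exists_eventually_eq (e i)
  obtain ⟨c, hc⟩ := U.exists_eventually_eq w
  obtain ⟨a, ha⟩ := U.exists_eventually_eq v
  have hgt : ∀ i : ℕ, ∀ᶠ j in U, i < j := fun i =>
    Nat.hyperfilter_le_atTop (eventually_gt_atTop i)
  obtain ⟨φ, h1, h2⟩ := exists_seq_of_forall_finset_exists (fun i => w i = c ∧ v i = a)
    (fun i j => i < j ∧ e i j = c) (fun s hs => by
      have h : ∀ᶠ j in U, ∀ i ∈ s, i < j ∧ e i j = c := by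
        refine (eventually_all_finset s).mpr fun i hi => ?_
        filter_upwards [hgt i, hw i] with j h1 h2
        exact ⟨h1, h2.trans (hs i hi).1⟩
      obtain ⟨j, ⟨hj1, hj2⟩, hj3⟩ := ((hc.and ha).and h).exists
      exact ⟨j, ⟨hj1, hj2⟩, hj3⟩)
  exact ⟨φ, a, c, fun i j hij => (h2 i j hij).1, fun i => (h1 i).2, fun i j hij => (h2 i j hij).2⟩

theorem exists_countable_dense_points {ι : Type*} [Countable ι] (T : X → ι → Fin K) :
    ∃ X₀ : Set X, X₀.Countable ∧ ∀ (s : Finset ι) (x : X), ∃ y ∈ X₀, ∀ a ∈ s, T y a = T x a := by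
  classical
  let R : (Σ s : Finset ι, (s → Fin K)) → Set X := fun p => {x | ∀ a : p.1, T x a = p.2 a}
  refine ⟨{y | ∃ p, ∃ h : (R p).Nonempty, y = h.some}, ?_, fun s x => ?_⟩
  · have : {y | ∃ p, ∃ h : (R p).Nonempty, y = h.some} ⊆
        ⋃ p, {y | ∃ h : (R p).Nonempty, y = h.some} := by
      rintro y ⟨p, hp⟩
      exact Set.mem_iUnion.mpr ⟨p, hp⟩
    refine (Set.countable_iUnion fun p => ?_).mono this
    refine Set.Subsingleton.countable ?_
    rintro y ⟨h, rfl⟩ z ⟨h', rfl⟩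
    rfl
  · have h : (R ⟨s, fun a => T x a⟩).Nonempty := ⟨x, fun a => rfl⟩
    exact ⟨h.some, ⟨_, h, rfl⟩, fun a ha => h.some_mem ⟨a, ha⟩⟩

theorem finite_factoring {ι κ : Type*} [Finite κ] (l : ι → κ) :
    {t : ι → Fin K | ∀ a b, l a = l b → t a = t b}.Finite := by
  refine Set.Finite.subset (Set.finite_range fun (u : Set.range l → Fin K) (a : ι) =>
    u ⟨l a, a, rfl⟩) ?_
  intro t ht
  refine ⟨fun b => t b.2.choose, ?_⟩
  funext a
  exact ht _ _ (Exists.choose_spec (⟨a, rfl⟩ : ∃ y, l y = l a))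

/-- A countable class that does not shatter arbitrarily deep trees induces only countably many
types of points. -/
theorem countable_range_of_not_lDeep {ι : Type*} [Countable ι] (g : ι → X → Fin K) {d : ℕ}
    (hd : ¬ LDeep d (Set.range g)) : (Set.range fun (x : X) (i : ι) => g i x).Countable := by
  classical
  by_contra hunc
  obtain ⟨X₀, hX₀, hdense⟩ := exists_countable_dense_points fun (x : X) (i : ι) => g i x
  have : Countable X₀ := hX₀
  obtain ⟨_, ⟨x, rfl⟩, hx⟩ : ∃ t ∈ Set.range fun (x : X) (i : ι) => g i x,
      t ∉ ⋃ l : Finset X₀, {t : ι → Fin K | ∀ a b,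
        (fun y : l => g a y.1) = (fun y : l => g b y.1) → t a = t b} := by
    by_contra! h
    exact hunc ((Set.countable_iUnion fun l : Finset X₀ =>
      (finite_factoring fun (a : ι) (y : l) => g a y.1).countable).mono h)
  obtain ⟨f, hf1, hf2⟩ := exists_seq_of_forall_finset_exists
    (fun p : X₀ × ι × ι => g p.2.1 x ≠ g p.2.2 x)
    (fun p q : X₀ × ι × ι => g p.2.1 q.1 = g p.2.1 x ∧ g p.2.2 q.1 = g p.2.2 x ∧
      g q.2.1 p.1 = g q.2.2 p.1) (fun s hs => by
      obtain ⟨y, hy, hys⟩ := hdense (s.image (fun p => p.2.1) ∪ s.image (fun p => p.2.2)) x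
      simp only [Set.mem_iUnion, not_exists, Set.mem_ofPred_eq, not_forall] at hx
      obtain ⟨a, b, hab, hne⟩ := hx (s.image fun p => p.1)
      refine ⟨(⟨y, hy⟩, a, b), hne, fun p hp => ⟨?_, ?_, ?_⟩⟩
      · exact hys _ (Finset.mem_union_left _ (Finset.mem_image_of_mem _ hp))
      · exact hys _ (Finset.mem_union_right _ (Finset.mem_image_of_mem _ hp))
      · exact congrFun hab ⟨p.1, Finset.mem_image_of_mem _ hp⟩)
  obtain ⟨φ, ⟨k, k'⟩, c, hφ, hv, he⟩ := exists_strictMono_homogeneous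
    (fun n => (g (f n).2.1 x, g (f n).2.2 x)) (fun i j => g (f j).2.1 (f i).1)
  have hkk : k ≠ k' := by
    have h1 := hf1 (φ 0)
    have h2 := hv 0
    simp only [Prod.mk.injEq] at h2
    rwa [h2.1, h2.2] at h1
  simp only [Prod.mk.injEq] at hv
  have ha : ∀ j i, j < i → g (f (φ j)).2.1 (f (φ i)).1 = k := fun j i hji =>
    (hf2 _ _ (hφ hji)).1.trans (hv j).1
  have hb : ∀ j i, j < i → g (f (φ j)).2.2 (f (φ i)).1 = k' := fun j i hji =>
    (hf2 _ _ (hφ hji)).2.1.trans (hv j).2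
  have hb' : ∀ j i, i < j → g (f (φ j)).2.2 (f (φ i)).1 = c := fun j i hij =>
    (hf2 _ _ (hφ hij)).2.2.symm.trans (he i j hij)
  by_cases hkc : k = c
  · refine hd ((lDeep_of_halfGraph (x := fun i => ((f (φ i)).1 : X)) (g := fun j => g (f (φ j)).2.2)
      (hkc ▸ hkk.symm) hb hb' d 0).mono ?_)
    rintro _ ⟨j, -, -, rfl⟩
    exact ⟨_, rfl⟩
  · refine hd ((lDeep_of_halfGraph (x := fun i => ((f (φ i)).1 : X)) (g := fun j => g (f (φ j)).2.1)
      hkc ha (fun j i hij => he i j hij) d 0).mono ?_)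
    rintro _ ⟨j, -, -, rfl⟩
    exact ⟨_, rfl⟩

end CountableTypes

section Expectation

variable {α β : Type*}

/-- The expectation of a nonnegative function under a discrete distribution. -/
noncomputable def PMF.expect (p : PMF α) (φ : α → ℝ≥0∞) : ℝ≥0∞ := ∑' a, p a * φ a

theorem PMF.toOuterMeasure_eq_expect (p : PMF α) (s : Set α) :
    p.toOuterMeasure s = p.expect (s.indicator 1) := by
  rw [PMF.toOuterMeasure_apply, PMF.expect]
  refine tsum_congr fun a => ?_
  by_cases h : a ∈ s <;> simp [h]

theorem PMF.expect_pure (a : α) (φ : α → ℝ≥0∞) : (PMF.pure a).expect φ = φ a := by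
  rw [PMF.expect, tsum_eq_single a]
  · simp
  · intro b hb
    simp [PMF.pure_apply, hb]

theorem PMF.expect_bind (p : PMF α) (q : α → PMF β) (φ : β → ℝ≥0∞) :
    (p.bind q).expect φ = p.expect fun a => (q a).expect φ := by
  simp only [PMF.expect, PMF.bind_apply, ← ENNReal.tsum_mul_right, ← ENNReal.tsum_mul_left]
  rw [ENNReal.tsum_comm]
  simp only [mul_assoc]

theorem PMF.expect_map (p : PMF α) (f : α → β) (φ : β → ℝ≥0∞) :
    (p.map f).expect φ = p.expect (φ ∘ f) := by
  rw [← PMF.bind_pure_comp, PMF.expect_bind]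
  simp only [Function.comp_def, PMF.expect_pure]

theorem PMF.expect_const (p : PMF α) (c : ℝ≥0∞) : p.expect (fun _ => c) = c := by
  rw [PMF.expect, ENNReal.tsum_mul_right, p.tsum_coe, one_mul]

theorem PMF.expect_add (p : PMF α) (φ ψ : α → ℝ≥0∞) :
    p.expect (fun a => φ a + ψ a) = p.expect φ + p.expect ψ := by
  simp only [PMF.expect, mul_add, ENNReal.tsum_add]

theorem PMF.expect_mul_left (p : PMF α) (c : ℝ≥0∞) (φ : α → ℝ≥0∞) :
    p.expect (fun a => c * φ a) = c * p.expect φ := by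
  simp only [PMF.expect, ← ENNReal.tsum_mul_left]
  exact tsum_congr fun a => by ring

theorem PMF.expect_mono {p : PMF α} {φ ψ : α → ℝ≥0∞} (h : ∀ a, p a ≠ 0 → φ a ≤ ψ a) :
    p.expect φ ≤ p.expect ψ := by
  refine ENNReal.tsum_le_tsum fun a => ?_
  by_cases ha : p a = 0
  · simp [ha]
  · gcongr
    exact h a ha

theorem PMF.expect_le_of_le {p : PMF α} {φ : α → ℝ≥0∞} {c : ℝ≥0∞} (h : ∀ a, p a ≠ 0 → φ a ≤ c) :
    p.expect φ ≤ c := (PMF.expect_mono h).trans (p.expect_const c).le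

theorem PMF.le_expect_of_le {p : PMF α} {φ : α → ℝ≥0∞} {c : ℝ≥0∞} (h : ∀ a, p a ≠ 0 → c ≤ φ a) :
    c ≤ p.expect φ := (p.expect_const c).symm.le.trans (PMF.expect_mono h)

theorem PMF.apply_mul_le_expect (p : PMF α) (φ : α → ℝ≥0∞) (a : α) : p a * φ a ≤ p.expect φ :=
  ENNReal.le_tsum a

theorem PMF.apply_eq_expect (p : PMF α) (a : α) : p a = p.expect (Set.indicator {a} 1) := by
  rw [PMF.expect, tsum_eq_single a]
  · simp
  · intro b hb
    simp [hb]

theorem PMF.expect_uniformOfFintype [Fintype α] [Nonempty α] (φ : α → ℝ≥0∞) :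
    (PMF.uniformOfFintype α).expect φ = (Fintype.card α : ℝ≥0∞)⁻¹ * ∑ a, φ a := by
  rw [PMF.expect, tsum_fintype, Finset.mul_sum]
  simp

theorem PMF.mul_le_expect_bind {p : PMF α} {q : α → PMF β} {φ : β → ℝ≥0∞} {A : Set α}
    {a b : ℝ≥0∞} (ha : a ≤ p.expect (A.indicator 1))
    (hb : ∀ v ∈ A, p v ≠ 0 → b ≤ (q v).expect φ) : a * b ≤ (p.bind q).expect φ := by
  rw [PMF.expect_bind]
  calc a * b ≤ p.expect (A.indicator 1) * b := by gcongr
    _ = p.expect fun v => b * A.indicator 1 v := by rw [PMF.expect_mul_left, mul_comm]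
    _ ≤ _ := by
      refine PMF.expect_mono fun v hv => ?_
      by_cases h : v ∈ A
      · simpa [h] using hb v h hv
      · simp [h]

/-- Expectations of `[0,1]`-valued functions under `p` exceed those under `q` by at most `τ`. -/
def PMF.Close (τ : ℝ≥0∞) (p q : PMF α) : Prop :=
  ∀ φ : α → ℝ≥0∞, (∀ a, φ a ≤ 1) → p.expect φ ≤ q.expect φ + τ

theorem PMF.Close.refl (p : PMF α) : PMF.Close 0 p p := fun φ _ => by simp

theorem PMF.Close.bind {τ σ : ℝ≥0∞} {p p' : PMF α} {q q' : α → PMF β} (hp : PMF.Close τ p p')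
    (hq : ∀ a, PMF.Close σ (q a) (q' a)) : PMF.Close (τ + σ) (p.bind q) (p'.bind q') := by
  intro φ hφ
  rw [PMF.expect_bind, PMF.expect_bind]
  calc _ ≤ p.expect (fun a => (q' a).expect φ + σ) := PMF.expect_mono fun a _ => hq a φ hφ
    _ = p.expect (fun a => (q' a).expect φ) + σ := by rw [PMF.expect_add, PMF.expect_const]
    _ ≤ _ := by
      rw [← add_assoc]
      gcongr
      exact hp _ fun a => PMF.expect_le_of_le fun b _ => hφ b

theorem PMF.Close.map {τ : ℝ≥0∞} {p p' : PMF α} (hp : PMF.Close τ p p') (f : α → β) :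
    PMF.Close τ (p.map f) (p'.map f) := by
  intro φ hφ
  rw [PMF.expect_map, PMF.expect_map]
  exact hp _ fun a => hφ _

theorem PMF.Close.apply_le {τ : ℝ≥0∞} {p q : PMF α} (h : PMF.Close τ p q) (a : α) :
    p a ≤ q a + τ := by
  rw [p.apply_eq_expect, q.apply_eq_expect]
  exact h _ fun b => Set.indicator_le (fun _ _ => le_rfl) b |>.trans (by simp)

/-- The list of `l` independent draws from `p`. -/
noncomputable def PMF.draws (p : PMF α) : ℕ → PMF (List α)
  | 0 => PMF.pure []
  | l + 1 => p.bind fun a => (PMF.draws p l).map (a :: ·)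

theorem PMF.Close.draws {τ : ℝ≥0∞} {p q : PMF α} (h : PMF.Close τ p q) (l : ℕ) :
    PMF.Close (l * τ) (p.draws l) (q.draws l) := by
  induction l with
  | zero => simpa [PMF.draws] using PMF.Close.refl (PMF.pure ([] : List α))
  | succ l ih =>
    have := h.bind fun a => ih.map (a :: ·)
    rwa [show τ + l * τ = ((l + 1 : ℕ) : ℝ≥0∞) * τ by push_cast; ring] at this

theorem PMF.expect_draws_forall (p : PMF α) (B : Set α) (l : ℕ) :
    (p.draws l).expect (Set.indicator {T | ∀ a ∈ T, a ∈ B} 1) = p.expect (B.indicator 1) ^ l := by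
  induction l with
  | zero => simp [PMF.draws, PMF.expect_pure]
  | succ l ih =>
    rw [PMF.draws, PMF.expect_bind, pow_succ', mul_comm, ← ih, ← PMF.expect_mul_left]
    congr 1
    funext a
    rw [PMF.expect_map]
    by_cases h : a ∈ B
    · simp only [h, Set.indicator_of_mem, Pi.one_apply, mul_one]
      congr 1
      funext T
      have : (a :: T) ∈ {T : List α | ∀ b ∈ T, b ∈ B} ↔ T ∈ {T : List α | ∀ b ∈ T, b ∈ B} := by
        rw [Set.mem_ofPred_eq, Set.mem_ofPred_eq, List.forall_mem_cons]; exact and_iff_right h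
      by_cases hT : T ∈ {T : List α | ∀ b ∈ T, b ∈ B}
      · rw [Function.comp_apply, Set.indicator_of_mem (this.mpr hT), Set.indicator_of_mem hT]
        rfl
      · rw [Function.comp_apply, Set.indicator_of_notMem (fun h => hT (this.mp h)),
          Set.indicator_of_notMem hT]
    · simp only [h, not_false_eq_true, Set.indicator_of_notMem, mul_zero]
      refine le_antisymm (PMF.expect_le_of_le fun T _ => ?_) zero_le
      rw [Function.comp_apply, Set.indicator_of_notMem]
      exact fun hT => h (hT a List.mem_cons_self)

theorem PMF.mem_of_mem_support_draws {p : PMF α} {l : ℕ} {T : List α}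
    (hT : T ∈ (p.draws l).support) : ∀ a ∈ T, a ∈ p.support := by
  induction l generalizing T with
  | zero =>
    rw [PMF.draws, PMF.support_pure, Set.mem_singleton_iff] at hT
    simp [hT]
  | succ l ih =>
    rw [PMF.draws, PMF.mem_support_bind_iff] at hT
    obtain ⟨a, ha, hT⟩ := hT
    rw [PMF.mem_support_map_iff] at hT
    obtain ⟨T', hT', rfl⟩ := hT
    intro b hb
    rcases List.mem_cons.mp hb with rfl | hb
    · exact ha
    · exact ih hT' b hb

/-- The empirical distribution of a sample. -/
noncomputable def empiricalPMF {m : ℕ} [NeZero m] (S : Fin m → α) : PMF α :=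
  (PMF.uniformOfFintype (Fin m)).map S

theorem close_empiricalPMF {m : ℕ} [NeZero m] {S S' : Fin m → α} {i : Fin m}
    (h : ∀ j, j ≠ i → S j = S' j) :
    PMF.Close ((m : ℝ≥0∞)⁻¹) (empiricalPMF S) (empiricalPMF S') := by
  classical
  intro φ hφ
  simp only [empiricalPMF, PMF.expect_map, PMF.expect_uniformOfFintype, Function.comp_apply,
    Fintype.card_fin]
  conv_rhs => rw [← mul_one ((m : ℝ≥0∞)⁻¹), mul_assoc, one_mul, ← mul_add]
  gcongr
  rw [← Finset.add_sum_erase _ _ (Finset.mem_univ i)]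
  calc φ (S i) + ∑ j ∈ Finset.univ.erase i, φ (S j)
      ≤ 1 + ∑ j ∈ Finset.univ.erase i, φ (S' j) := by
        refine add_le_add (hφ _) (Finset.sum_le_sum fun j hj => ?_)
        rw [h j (Finset.ne_of_mem_erase hj)]
    _ ≤ _ := by
      rw [add_comm]
      gcongr
      exact Finset.erase_subset _ _

end Expectation

section StandardOptimal

variable {X : Type*} {K : ℕ}

open Classical in
/-- The depth of a deepest shattered tree, truncated at `d`. -/
noncomputable def rk (d : ℕ) (V : Set (X → Fin K)) : ℕ := Nat.findGreatest (fun t => LDeep t V) d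

theorem rk_le (d : ℕ) (V : Set (X → Fin K)) : rk d V ≤ d := by
  classical exact Nat.findGreatest_le _

theorem not_lDeep_rk_succ {d : ℕ} {V : Set (X → Fin K)} (hV : ¬ LDeep (d + 1) V) :
    ¬ LDeep (rk d V + 1) V := by
  classical
  rcases (rk_le d V).lt_or_eq with h | h
  · exact Nat.findGreatest_is_greatest (P := fun t => LDeep t V) (n := d) (Nat.lt_succ_self _) h
  · rwa [h]

theorem lDeep_rk {d : ℕ} {V : Set (X → Fin K)} (hV : V.Nonempty) : LDeep (rk d V) V := by
  classical
  exact Nat.findGreatest_spec (P := fun t => LDeep t V) (Nat.zero_le d) hV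

theorem rk_lt_of_not_lDeep {d t : ℕ} {W : Set (X → Fin K)} (hW : W.Nonempty)
    (h : ¬ LDeep t W) : rk d W < t := by
  by_contra hlt
  exact h ((lDeep_rk hW).of_le (not_lt.mp hlt))

theorem rk_mono {d : ℕ} {V W : Set (X → Fin K)} (h : V ⊆ W) : rk d V ≤ rk d W := by
  classical
  exact Nat.findGreatest_mono_left (fun t ht => LDeep.mono h ht) d

variable [NeZero K]

open Classical in
/-- The prediction of the standard optimal algorithm: a label that keeps the full depth. -/
noncomputable def soa (d : ℕ) (V : Set (X → Fin K)) (x : X) : Fin K :=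
  if h : ∃ k, LDeep (rk d V) (restrictAt V x k) then h.choose else 0

/-- The members of `V` with labels `c` at the points `a`. -/
def restrictTuple {r : ℕ} (V : Set (X → Fin K)) (a : Fin r → X) (c : Fin r → Fin K) :
    Set (X → Fin K) := {h | h ∈ V ∧ ∀ i, h (a i) = c i}

/-- `V` keeps its depth on some labelling of any `d + 1` points. -/
def IsIrreducibleClass (d : ℕ) (V : Set (X → Fin K)) : Prop :=
  ∀ a : Fin (d + 1) → X, ∃ c, LDeep (rk d V) (restrictTuple V a c)

theorem not_lDeep_restrictAt_of_soa_ne {d : ℕ} {V : Set (X → Fin K)} (hV : ¬ LDeep (d + 1) V)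
    {x : X} {k : Fin K} (h : soa d V x ≠ k) : ¬ LDeep (rk d V) (restrictAt V x k) := by
  intro hk
  have hex : ∃ k, LDeep (rk d V) (restrictAt V x k) := ⟨k, hk⟩
  refine h ?_
  rw [soa, dif_pos hex]
  exact eq_of_lDeep_restrictAt (not_lDeep_rk_succ hV) hex.choose_spec hk

theorem soa_mem_localClosure {d : ℕ} {V : Set (X → Fin K)} (hV : ¬ LDeep (d + 1) V)
    (hirr : IsIrreducibleClass d V) : soa d V ∈ localClosure (d + 1) V := by
  intro a
  obtain ⟨c, hc⟩ := hirr a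
  obtain ⟨h, hh⟩ := hc.nonempty
  refine ⟨h, hh.1, fun i => ?_⟩
  by_contra hne
  refine not_lDeep_restrictAt_of_soa_ne hV (fun h => hne h.symm) (hc.mono ?_)
  exact fun g hg => ⟨hg.1, by rw [hg.2, hh.2]⟩

open Classical in
/-- Cut `V` down until it is irreducible and its prediction agrees with the examples `T`:
labels on a tuple that witnesses reducibility are guessed, violated examples are enforced. -/
noncomputable def settle (d : ℕ) : ℕ → Set (X → Fin K) → List (X × Fin K) → PMF (Set (X → Fin K))
  | 0, _, _ => PMF.pure ∅
  | s + 1, V, T =>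
    if h : ∃ a : Fin (d + 1) → X, ∀ c, ¬ LDeep (rk d V) (restrictTuple V a c) then
      (PMF.uniformOfFintype (Fin (d + 1) → Fin K)).bind fun c =>
        settle d s (restrictTuple V h.choose c) T
    else if h' : ∃ z ∈ T, soa d V z.1 ≠ z.2 then
      settle d s (restrictAt V h'.choose.1 h'.choose.2) T
    else PMF.pure V

theorem settle_support {d s : ℕ} {T : List (X × Fin K)} : ∀ {V V' : Set (X → Fin K)},
    V' ∈ (settle d s V T).support →
      V' = ∅ ∨ (V' ⊆ V ∧ IsIrreducibleClass d V' ∧ ∀ z ∈ T, soa d V' z.1 = z.2) := by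
  induction s with
  | zero =>
    intro V V' h
    rw [settle, PMF.support_pure] at h
    exact Or.inl h
  | succ s ih =>
    intro V V' h
    rw [settle] at h
    split_ifs at h with h1 h2
    · rw [PMF.mem_support_bind_iff] at h
      obtain ⟨c, -, hc⟩ := h
      exact (ih hc).imp_right fun h => ⟨h.1.trans fun g hg => hg.1, h.2⟩
    · exact (ih h).imp_right fun h => ⟨h.1.trans (restrictAt_subset _ _ _), h.2⟩
    · rw [PMF.support_pure, Set.mem_singleton_iff] at h
      subst h
      push Not at h1 h2
      exact Or.inr ⟨subset_rfl, h1, h2⟩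

/-- The probability of guessing `d + 1` labels. -/
noncomputable def guessProb (d K : ℕ) : ℝ≥0∞ := (((K : ℝ≥0∞)) ^ (d + 1))⁻¹

theorem guessProb_le_one (d : ℕ) : guessProb d K ≤ 1 := by
  rw [guessProb, ENNReal.inv_le_one]
  exact one_le_pow₀ (by exact_mod_cast NeZero.one_le)

theorem guessProb_mul_le_expect_uniform (d : ℕ) (φ : (Fin (d + 1) → Fin K) → ℝ≥0∞)
    (c : Fin (d + 1) → Fin K) :
    guessProb d K * φ c ≤ (PMF.uniformOfFintype (Fin (d + 1) → Fin K)).expect φ := by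
  refine le_trans (le_of_eq ?_) (PMF.apply_mul_le_expect _ φ c)
  simp [guessProb]

theorem le_expect_settle {d s : ℕ} {T : List (X × Fin K)} {g : X → Fin K}
    (hT : ∀ z ∈ T, g z.1 = z.2) : ∀ {V : Set (X → Fin K)}, ¬ LDeep (d + 1) V → g ∈ V →
    rk d V < s →
    guessProb d K ^ s ≤ (settle d s V T).expect (Set.indicator {V' | g ∈ V' ∧ rk d V' ≤ rk d V} 1) := by
  induction s with
  | zero => intro V _ _ h; omega
  | succ s ih =>
    intro V hV hg hs
    have step : ∀ W ⊆ V, g ∈ W → ¬ LDeep (rk d V) W → guessProb d K ^ s ≤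
        (settle d s W T).expect (Set.indicator {V' | g ∈ V' ∧ rk d V' ≤ rk d V} 1) := by
      intro W hWV hgW hW
      refine (ih (fun h => hV (h.mono hWV)) hgW ?_).trans (PMF.expect_mono fun V' _ => ?_)
      · have := rk_lt_of_not_lDeep (d := d) ⟨g, hgW⟩ hW
        omega
      · refine Set.indicator_le_indicator_of_subset ?_ (fun _ => zero_le) _
        exact fun V' h => ⟨h.1, h.2.trans (rk_mono hWV)⟩
    rw [settle]
    split_ifs with h1 h2
    · rw [PMF.expect_bind, pow_succ']
      refine le_trans ?_ (guessProb_mul_le_expect_uniform d _ fun i => g (h1.choose i))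
      gcongr
      exact step _ (fun h hh => hh.1) ⟨hg, fun i => rfl⟩ (h1.choose_spec _)
    · rw [pow_succ']
      refine (mul_le_of_le_one_left zero_le (guessProb_le_one d)).trans ?_
      have h3 := h2.choose_spec
      refine step _ (restrictAt_subset _ _ _) ⟨hg, hT _ h3.1⟩ ?_
      exact not_lDeep_restrictAt_of_soa_ne hV h3.2
    · have hV' : V ∈ {V' | g ∈ V' ∧ rk d V' ≤ rk d V} := ⟨hg, le_rfl⟩
      rw [PMF.expect_pure, Set.indicator_of_mem hV']
      exact pow_le_one₀ zero_le (guessProb_le_one d)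

end StandardOptimal

section Tournament

variable {X : Type*} {K : ℕ} [NeZero K]

open Classical in
/-- Restrict the one of two classes whose prediction at `x` is not `y`. -/
noncomputable def resolve (d : ℕ) (V₁ V₂ : Set (X → Fin K)) (x : X) (y : Fin K) :
    Set (X → Fin K) :=
  if soa d V₁ x ≠ y then restrictAt V₁ x y else restrictAt V₂ x y

open Classical in
/-- Two independent classes from the previous round whose predictions differ are played against
each other at a point of disagreement, with a guessed label. -/
noncomputable def tournament (d : ℕ) (H : Set (X → Fin K)) (P : PMF (X × Fin K)) (l : ℕ) :
    ℕ → PMF (Set (X → Fin K))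
  | 0 => (P.draws l).bind fun T => settle d (d + 1) H T
  | k + 1 => (tournament d H P l k).bind fun V₁ => (tournament d H P l k).bind fun V₂ =>
      if h : ∃ x, soa d V₁ x ≠ soa d V₂ x then
        (PMF.uniformOfFintype (Fin K)).bind fun y => (P.draws l).bind fun T =>
          settle d (d + 1) (resolve d V₁ V₂ h.choose y) T
      else PMF.pure ∅

theorem tournament_support {d : ℕ} {H : Set (X → Fin K)} {P : PMF (X × Fin K)} {l k : ℕ} :
    ∀ {V : Set (X → Fin K)}, V ∈ (tournament d H P l k).support →
      V ⊆ H ∧ (V = ∅ ∨ IsIrreducibleClass d V) := by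
  have key : ∀ {W T V : Set (X → Fin K)} {T}, W ⊆ H → V ∈ (settle d (d + 1) W T).support →
      V ⊆ H ∧ (V = ∅ ∨ IsIrreducibleClass d V) := by
    intro W _ V T hW hV
    rcases settle_support hV with rfl | h
    · exact ⟨Set.empty_subset _, Or.inl rfl⟩
    · exact ⟨h.1.trans hW, Or.inr h.2.1⟩
  induction k with
  | zero =>
    intro V hV
    rw [tournament, PMF.mem_support_bind_iff] at hV
    obtain ⟨T, -, hV⟩ := hV
    exact key (T := ∅) subset_rfl hV
  | succ k ih =>
    intro V hV
    rw [tournament, PMF.mem_support_bind_iff] at hV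
    obtain ⟨V₁, h1, hV⟩ := hV
    rw [PMF.mem_support_bind_iff] at hV
    obtain ⟨V₂, h2, hV⟩ := hV
    split_ifs at hV with h
    · rw [PMF.mem_support_bind_iff] at hV
      obtain ⟨y, -, hV⟩ := hV
      rw [PMF.mem_support_bind_iff] at hV
      obtain ⟨T, -, hV⟩ := hV
      refine key (T := ∅) ?_ hV
      unfold resolve
      split_ifs
      · exact (restrictAt_subset _ _ _).trans (ih h1).1
      · exact (restrictAt_subset _ _ _).trans (ih h2).1
    · rw [PMF.support_pure, Set.mem_singleton_iff] at hV
      subst hV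
      exact ⟨Set.empty_subset _, Or.inl rfl⟩

theorem expect_draws_bind_settle_le (d s l : ℕ) (V : Set (X → Fin K)) (P : PMF (X × Fin K))
    (f : X → Fin K) :
    ((P.draws l).bind fun T => settle d s V T).expect
      (Set.indicator {W | W.Nonempty ∧ soa d W = f} 1) ≤
      P.expect (Set.indicator {z | f z.1 = z.2} 1) ^ l := by
  rw [PMF.expect_bind, ← PMF.expect_draws_forall]
  refine PMF.expect_mono fun T _ => ?_
  by_cases hT : T ∈ {T : List (X × Fin K) | ∀ a ∈ T, a ∈ {z : X × Fin K | f z.1 = z.2}}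
  · rw [Set.indicator_of_mem hT]
    exact PMF.expect_le_of_le fun W _ => Set.indicator_apply_le' (fun _ => le_rfl) fun _ => zero_le
  · rw [Set.indicator_of_notMem hT]
    refine PMF.expect_le_of_le fun W hW => ?_
    rw [Set.indicator_of_notMem]
    rintro ⟨hne, rfl⟩
    rcases settle_support ((PMF.mem_support_iff _ _).mpr hW) with h | h
    · exact hne.ne_empty h
    · exact hT fun z hz => h.2.2 z hz

theorem expect_tournament_le (d l k : ℕ) (H : Set (X → Fin K)) (P : PMF (X × Fin K))
    (f : X → Fin K) :
    (tournament d H P l k).expect (Set.indicator {W | W.Nonempty ∧ soa d W = f} 1) ≤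
      P.expect (Set.indicator {z | f z.1 = z.2} 1) ^ l := by
  cases k with
  | zero => exact expect_draws_bind_settle_le d (d + 1) l H P f
  | succ k =>
    rw [tournament, PMF.expect_bind]
    refine PMF.expect_le_of_le fun V₁ _ => ?_
    rw [PMF.expect_bind]
    refine PMF.expect_le_of_le fun V₂ _ => ?_
    split_ifs with h
    · rw [PMF.expect_bind]
      exact PMF.expect_le_of_le fun y _ => expect_draws_bind_settle_le _ _ _ _ _ _
    · rw [PMF.expect_pure, Set.indicator_of_notMem]
      · exact zero_le
      · exact fun h => h.1.ne_empty rfl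

theorem close_tournament {d l : ℕ} {H : Set (X → Fin K)} {P Q : PMF (X × Fin K)} {τ : ℝ≥0∞}
    (h : PMF.Close τ P Q) (k : ℕ) :
    PMF.Close ((2 ^ (k + 1) - 1 : ℕ) * (l * τ)) (tournament d H P l k) (tournament d H Q l k) := by
  induction k with
  | zero => simpa [tournament] using (h.draws l).bind fun T => PMF.Close.refl _
  | succ k ih =>
    have h1 : (2 ^ (k + 1 + 1) - 1 : ℕ) = (2 ^ (k + 1) - 1) + (2 ^ (k + 1) - 1) + 1 := by
      have : 0 < 2 ^ k := by positivity
      rw [pow_succ, pow_succ]; omega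
    have h2 : ((2 ^ (k + 1 + 1) - 1 : ℕ) : ℝ≥0∞) * (l * τ) = ((2 ^ (k + 1) - 1 : ℕ) * (l * τ)) +
        (((2 ^ (k + 1) - 1 : ℕ) * (l * τ)) + l * τ) := by
      rw [h1, Nat.cast_add, Nat.cast_add, Nat.cast_one]
      ring
    rw [tournament, tournament, h2]
    refine ih.bind fun V₁ => ih.bind fun V₂ => ?_
    split_ifs with hx
    · simpa using (PMF.Close.refl _).bind fun y => (h.draws l).bind fun T => PMF.Close.refl
        (settle d (d + 1) (resolve d V₁ V₂ hx.choose y) T)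
    · exact fun φ _ => le_self_add

/-- Lower bound for the probability that a tournament round succeeds. -/
noncomputable def roundProb (d K : ℕ) : ℕ → ℝ≥0∞
  | 0 => guessProb d K ^ (d + 1)
  | k + 1 => roundProb d K k * (roundProb d K k / 2 * ((K : ℝ≥0∞)⁻¹ * guessProb d K ^ (d + 1)))

omit [NeZero K] in
theorem roundProb_pos (d k : ℕ) : 0 < roundProb d K k := by
  have hg : 0 < guessProb d K := by
    rw [guessProb, ENNReal.inv_pos]
    exact ENNReal.pow_ne_top (ENNReal.natCast_ne_top K)
  induction k with
  | zero => exact ENNReal.pow_pos hg _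
  | succ k ih =>
    rw [roundProb]
    refine ENNReal.mul_pos ih.ne' (ENNReal.mul_pos ?_ (ENNReal.mul_pos ?_ ?_).ne').ne'
    · exact (ENNReal.div_pos ih.ne' (by simp)).ne'
    · exact ENNReal.inv_ne_zero.mpr (ENNReal.natCast_ne_top K)
    · exact (ENNReal.pow_pos hg _).ne'

theorem roundProb_le_one (d k : ℕ) : roundProb d K k ≤ 1 := by
  induction k with
  | zero => exact pow_le_one₀ zero_le (guessProb_le_one d)
  | succ k ih =>
    rw [roundProb]
    refine mul_le_one' ih (mul_le_one' (ENNReal.half_le_self.trans ih) (mul_le_one' ?_ ?_))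
    · rw [ENNReal.inv_le_one]
      exact_mod_cast NeZero.one_le
    · exact pow_le_one₀ zero_le (guessProb_le_one d)

theorem le_expect_draws_bind_settle {d l : ℕ} {V : Set (X → Fin K)} {P : PMF (X × Fin K)}
    {g : X → Fin K} (hP : ∀ z ∈ P.support, g z.1 = z.2) (hV : ¬ LDeep (d + 1) V) (hg : g ∈ V) :
    guessProb d K ^ (d + 1) ≤ ((P.draws l).bind fun T => settle d (d + 1) V T).expect
      (Set.indicator {V' | g ∈ V' ∧ rk d V' ≤ rk d V} 1) := by
  rw [PMF.expect_bind]
  refine PMF.le_expect_of_le fun T hT => le_expect_settle ?_ hV hg (Nat.lt_succ_of_le (rk_le d V))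
  exact fun z hz => hP z (PMF.mem_of_mem_support_draws ((PMF.mem_support_iff _ _).mpr hT) z hz)

theorem le_expect_tournament_succ {d l k : ℕ} {H : Set (X → Fin K)} {P : PMF (X × Fin K)}
    {g : X → Fin K} (hP : ∀ z ∈ P.support, g z.1 = z.2) (hH : ¬ LDeep (d + 1) H) {a : ℝ≥0∞}
    (ha1 : a ≠ ∞)
    (ha : a ≤ (tournament d H P l k).expect (Set.indicator {V | g ∈ V ∧ rk d V + k ≤ d} 1))
    (hf : ∀ f, (tournament d H P l k).expect
      (Set.indicator {V | V.Nonempty ∧ soa d V = f} 1) ≤ a / 2) :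
    a * (a / 2 * ((K : ℝ≥0∞)⁻¹ * guessProb d K ^ (d + 1))) ≤ (tournament d H P l (k + 1)).expect
      (Set.indicator {V | g ∈ V ∧ rk d V + (k + 1) ≤ d} 1) := by
  rw [tournament]
  refine PMF.mul_le_expect_bind ha fun V₁ h1 hV₁ => ?_
  have hdiff : a / 2 ≤ (tournament d H P l k).expect
      (Set.indicator {V | (g ∈ V ∧ rk d V + k ≤ d) ∧ soa d V₁ ≠ soa d V} 1) := by
    have h2 : a ≤ (tournament d H P l k).expect
        (Set.indicator {V | (g ∈ V ∧ rk d V + k ≤ d) ∧ soa d V₁ ≠ soa d V} 1) + a / 2 := by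
      refine ha.trans ?_
      refine le_trans ?_ (add_le_add_right (hf (soa d V₁)) _)
      rw [← PMF.expect_add]
      refine PMF.expect_mono fun V _ => ?_
      by_cases hV : V ∈ {V | g ∈ V ∧ rk d V + k ≤ d}
      · by_cases hs : soa d V₁ = soa d V
        · have : V ∈ {V | V.Nonempty ∧ soa d V = soa d V₁} := ⟨⟨g, hV.1⟩, hs.symm⟩
          rw [Set.indicator_of_mem hV, Set.indicator_of_mem this]
          exact le_add_self
        · have : V ∈ {V | (g ∈ V ∧ rk d V + k ≤ d) ∧ soa d V₁ ≠ soa d V} := ⟨hV, hs⟩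
          rw [Set.indicator_of_mem hV, Set.indicator_of_mem this]
          exact le_self_add
      · rw [Set.indicator_of_notMem hV]
        exact zero_le
    have h3 : a / 2 + a / 2 ≤ (tournament d H P l k).expect
        (Set.indicator {V | (g ∈ V ∧ rk d V + k ≤ d) ∧ soa d V₁ ≠ soa d V} 1) + a / 2 := by
      rwa [ENNReal.add_halves]
    exact (ENNReal.add_le_add_iff_right (ENNReal.div_ne_top ha1 (by simp))).mp h3
  refine PMF.mul_le_expect_bind hdiff fun V₂ h2 hV₂ => ?_
  have hx : ∃ x, soa d V₁ x ≠ soa d V₂ x := by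
    by_contra! h
    exact h2.2 (funext h)
  rw [dif_pos hx, PMF.expect_bind]
  have hV₁H := (tournament_support ((PMF.mem_support_iff _ _).mpr hV₁)).1
  have hV₂H := (tournament_support ((PMF.mem_support_iff _ _).mpr hV₂)).1
  have hx' := hx.choose_spec
  set x := hx.choose
  refine le_trans ?_ (PMF.apply_mul_le_expect _ _ (g x))
  rw [PMF.uniformOfFintype_apply, Fintype.card_fin]
  gcongr
  have key : ∃ V, (V = V₁ ∨ V = V₂) ∧ soa d V x ≠ g x ∧
      resolve d V₁ V₂ x (g x) = restrictAt V x (g x) := by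
    by_cases h : soa d V₁ x ≠ g x
    · exact ⟨V₁, Or.inl rfl, h, if_pos h⟩
    · refine ⟨V₂, Or.inr rfl, fun h' => hx' ?_, if_neg h⟩
      rw [h', not_not.mp h]
  obtain ⟨V, hV, hne, hres⟩ := key
  have hVH : V ⊆ H := by rcases hV with rfl | rfl <;> assumption
  have hVg : g ∈ V ∧ rk d V + k ≤ d := by
    rcases hV with rfl | rfl
    · exact h1
    · exact h2.1
  rw [hres]
  have hgr : g ∈ restrictAt V x (g x) := ⟨hVg.1, rfl⟩
  refine (le_expect_draws_bind_settle (l := l) hP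
    (fun h => hH (h.mono ((restrictAt_subset _ _ _).trans hVH))) hgr).trans ?_
  refine PMF.expect_mono fun V' _ => Set.indicator_le_indicator_of_subset ?_ (fun _ => zero_le) _
  rintro W ⟨hW1, hW2⟩
  have := rk_lt_of_not_lDeep (d := d) ⟨g, hgr⟩
    (not_lDeep_restrictAt_of_soa_ne (fun h => hH (h.mono hVH)) hne)
  exact ⟨hW1, by have := hVg.2; omega⟩

theorem exists_le_expect_tournament {d l : ℕ} {H : Set (X → Fin K)} {P : PMF (X × Fin K)}
    {g : X → Fin K} (hP : ∀ z ∈ P.support, g z.1 = z.2) (hH : ¬ LDeep (d + 1) H) (hg : g ∈ H) :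
    ∃ k ≤ d, ∃ f, roundProb d K k / 2 ≤
      (tournament d H P l k).expect (Set.indicator {V | V.Nonempty ∧ soa d V = f} 1) := by
  by_contra! hcon
  have key : ∀ k ≤ d + 1, roundProb d K k ≤
      (tournament d H P l k).expect (Set.indicator {V | g ∈ V ∧ rk d V + k ≤ d} 1) := by
    intro k
    induction k with
    | zero =>
      intro _
      refine (le_expect_draws_bind_settle (l := l) hP hH hg).trans ?_
      refine PMF.expect_mono fun V' _ => Set.indicator_le_indicator_of_subset ?_
        (fun _ => zero_le) _
      rintro W ⟨hW, -⟩
      exact ⟨hW, rk_le d W⟩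
    | succ k ih =>
      intro hk
      exact le_expect_tournament_succ hP hH
        (ne_top_of_le_ne_top ENNReal.one_ne_top (roundProb_le_one d k)) (ih (by omega))
        fun f => (hcon k (by omega) f).le
  have h := (roundProb_pos (K := K) d (d + 1)).trans_le (key (d + 1) le_rfl)
  refine h.ne' (le_antisymm (PMF.expect_le_of_le fun V _ => ?_) zero_le)
  rw [Set.indicator_of_notMem]
  rintro ⟨-, h⟩
  omega

end Tournament

section Mixture

variable {X : Type*} {K : ℕ} [NeZero K]

open Classical in
/-- The prediction of the class produced by a tournament with a random number of rounds. -/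
noncomputable def stableMixture (d : ℕ) (H : Set (X → Fin K)) (P : PMF (X × Fin K)) (l : ℕ) :
    PMF (Option (X → Fin K)) :=
  (PMF.uniformOfFintype (Fin (d + 1))).bind fun k =>
    (tournament d H P l k).map fun V => if V.Nonempty then some (soa d V) else none

theorem stableMixture_apply_some (d : ℕ) (H : Set (X → Fin K)) (P : PMF (X × Fin K)) (l : ℕ)
    (f : X → Fin K) : stableMixture d H P l (some f) =
      (PMF.uniformOfFintype (Fin (d + 1))).expect fun k => (tournament d H P l k).expect
        (Set.indicator {V | V.Nonempty ∧ soa d V = f} 1) := by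
  classical
  rw [PMF.apply_eq_expect, stableMixture, PMF.expect_bind]
  congr 1
  funext k
  rw [PMF.expect_map]
  congr 1
  funext V
  by_cases hV : V.Nonempty <;> by_cases hf : soa d V = f <;> simp [Set.indicator, hV, hf]

theorem mem_localClosure_of_stableMixture_ne_zero {d l : ℕ} {H : Set (X → Fin K)}
    {P : PMF (X × Fin K)} (hH : ¬ LDeep (d + 1) H) {f : X → Fin K}
    (hf : stableMixture d H P l (some f) ≠ 0) : f ∈ localClosure (d + 1) H := by
  by_contra hcon
  refine hf ?_
  rw [stableMixture_apply_some]
  refine le_antisymm (PMF.expect_le_of_le fun k _ => PMF.expect_le_of_le fun V hV => ?_) zero_le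
  rw [Set.indicator_of_notMem]
  rintro ⟨hne, rfl⟩
  obtain ⟨h1, h2⟩ := tournament_support ((PMF.mem_support_iff _ _).mpr hV)
  rcases h2 with h2 | h2
  · exact hne.ne_empty h2
  · exact hcon (localClosure_mono _ h1 (soa_mem_localClosure (fun h => hH (h.mono h1)) h2))

theorem stableMixture_apply_some_le (d : ℕ) (H : Set (X → Fin K)) (P : PMF (X × Fin K)) (l : ℕ)
    (f : X → Fin K) : stableMixture d H P l (some f) ≤
      P.expect (Set.indicator {z | f z.1 = z.2} 1) ^ l := by
  rw [stableMixture_apply_some]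
  exact PMF.expect_le_of_le fun k _ => expect_tournament_le _ _ _ _ _ _

theorem PMF.Close.mono {α : Type*} {τ σ : ℝ≥0∞} {p q : PMF α} (h : PMF.Close τ p q) (hτ : τ ≤ σ) :
    PMF.Close σ p q := fun φ hφ => (h φ hφ).trans (by gcongr)

theorem close_stableMixture {d l : ℕ} {H : Set (X → Fin K)} {P Q : PMF (X × Fin K)} {τ : ℝ≥0∞}
    (h : PMF.Close τ P Q) :
    PMF.Close (2 ^ (d + 1) * (l * τ)) (stableMixture d H P l) (stableMixture d H Q l) := by
  rw [← zero_add (2 ^ (d + 1) * (l * τ))]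
  refine (PMF.Close.refl _).bind fun k => ((close_tournament h k).map _).mono ?_
  gcongr
  have h1 : 2 ^ ((k : ℕ) + 1) ≤ 2 ^ (d + 1) := Nat.pow_le_pow_right (by omega) k.isLt
  exact_mod_cast (Nat.sub_le _ _).trans h1

/-- Lower bound for the frequency of the globally stable prediction. -/
noncomputable def stableProb (d K : ℕ) : ℝ≥0∞ := ((d + 1 : ℕ) : ℝ≥0∞)⁻¹ * (roundProb d K d / 2)

omit [NeZero K] in
theorem stableProb_pos (d : ℕ) : 0 < stableProb d K :=
  ENNReal.mul_pos (ENNReal.inv_ne_zero.mpr (ENNReal.natCast_ne_top _))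
    (ENNReal.div_pos (roundProb_pos d d).ne' (by simp)).ne'

theorem stableProb_le_one (d : ℕ) : stableProb d K ≤ 1 := by
  refine mul_le_one' ?_ (ENNReal.half_le_self.trans (roundProb_le_one d d))
  rw [ENNReal.inv_le_one]
  exact_mod_cast Nat.succ_le_succ (Nat.zero_le d)

theorem roundProb_antitone (d : ℕ) : Antitone (roundProb d K) := by
  refine antitone_nat_of_succ_le fun k => ?_
  rw [roundProb]
  refine mul_le_of_le_one_right zero_le ?_
  refine mul_le_one' (ENNReal.half_le_self.trans (roundProb_le_one d k)) (mul_le_one' ?_ ?_)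
  · rw [ENNReal.inv_le_one]
    exact_mod_cast NeZero.one_le
  · exact pow_le_one₀ zero_le (guessProb_le_one d)

theorem exists_stableProb_le {d : ℕ} (l : ℕ) {H : Set (X → Fin K)} {P : PMF (X × Fin K)}
    {g : X → Fin K} (hP : ∀ z ∈ P.support, g z.1 = z.2) (hH : ¬ LDeep (d + 1) H) (hg : g ∈ H) :
    ∃ f, stableProb d K ≤ stableMixture d H P l (some f) := by
  obtain ⟨k, hk, f, hf⟩ := exists_le_expect_tournament (l := l) hP hH hg
  refine ⟨f, ?_⟩
  rw [stableMixture_apply_some]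
  refine le_trans ?_ (PMF.apply_mul_le_expect _ _ (⟨k, Nat.lt_succ_of_le hk⟩ : Fin (d + 1)))
  rw [PMF.uniformOfFintype_apply, Fintype.card_fin, stableProb]
  gcongr
  refine le_trans ?_ hf
  gcongr
  exact roundProb_antitone d hk

end Mixture

section Histogram

variable {F : Type*}

/-- `p` and `q` are indistinguishable with multiplicative error `M` and additive error `δ`. -/
def PMF.Indist (M δ : ℝ≥0∞) (p q : PMF F) : Prop :=
  ∀ T : Set F, p.toOuterMeasure T ≤ M * q.toOuterMeasure T + δ

/-- The truncated exponential weight of a candidate. -/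
noncomputable def histWeight (lam θ : ℝ) (p : PMF (Option F)) (f : F) : ℝ≥0∞ :=
  ENNReal.ofReal (Real.exp (lam * max 0 ((p (some f)).toReal - θ)) - 1)

theorem histWeight_eq_zero {lam θ : ℝ} {p : PMF (Option F)} {f : F}
    (h : (p (some f)).toReal ≤ θ) : histWeight lam θ p f = 0 := by
  rw [histWeight, max_eq_left (by linarith)]
  simp

theorem tsum_indicator_gt_le {θ : ℝ} (hθ : 0 < θ) (p : PMF (Option F)) :
    ∑' f, Set.indicator {f | θ < (p (some f)).toReal} (1 : F → ℝ≥0∞) f ≤ ENNReal.ofReal θ⁻¹ := by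
  have h1 : ∀ f, Set.indicator {f | θ < (p (some f)).toReal} (1 : F → ℝ≥0∞) f ≤
      ENNReal.ofReal θ⁻¹ * p (some f) := by
    intro f
    refine Set.indicator_apply_le' (fun hf => ?_) fun _ => zero_le
    rw [← ENNReal.ofReal_toReal (p.apply_ne_top (some f)), ← ENNReal.ofReal_mul (by positivity),
      Pi.one_apply, ENNReal.one_le_ofReal, ← div_eq_inv_mul, one_le_div hθ]
    exact le_of_lt hf
  refine (ENNReal.tsum_le_tsum h1).trans ?_
  rw [ENNReal.tsum_mul_left]
  refine mul_le_of_le_one_right zero_le ?_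
  rw [← p.tsum_coe]
  exact ENNReal.tsum_comp_le_tsum_of_injective (Option.some_injective F) p

theorem histWeight_le {lam θ : ℝ} (hlam : 0 ≤ lam) {p q : PMF (Option F)} {f : F}
    (h : lam * (p (some f)).toReal ≤ lam * (q (some f)).toReal + 1) :
    histWeight lam θ p f ≤ 3 * histWeight lam θ q f +
      3 * Set.indicator {f | θ < (p (some f)).toReal} 1 f := by
  by_cases hf : θ < (p (some f)).toReal
  · have hmem : f ∈ {f | θ < (p (some f)).toReal} := hf
    rw [Set.indicator_of_mem hmem, histWeight, histWeight, Pi.one_apply, mul_one,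
      show (3 : ℝ≥0∞) = ENNReal.ofReal 3 by simp, ← ENNReal.ofReal_mul (by norm_num),
      ← ENNReal.ofReal_add _ (by norm_num)]
    · apply ENNReal.ofReal_le_ofReal
      rw [max_eq_right (by linarith)]
      set b := lam * max 0 ((q (some f)).toReal - θ) with hb
      have h1 : lam * ((p (some f)).toReal - θ) ≤ 1 + b := by
        have : lam * ((q (some f)).toReal - θ) ≤ b := by
          rw [hb]; gcongr; exact le_max_right _ _
        nlinarith
      have h2 : Real.exp (lam * ((p (some f)).toReal - θ)) ≤ Real.exp 1 * Real.exp b := by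
        rw [← Real.exp_add]
        exact Real.exp_le_exp.mpr h1
      have h3 := Real.exp_one_lt_d9
      nlinarith [Real.exp_pos b]
    · have : 0 ≤ lam * max 0 ((q (some f)).toReal - θ) := by positivity
      have := Real.one_le_exp this
      linarith
  · rw [histWeight_eq_zero (not_lt.mp hf)]
    exact zero_le

theorem tsum_histWeight_le {lam θ : ℝ} (hlam : 0 ≤ lam) (hθ : 0 < θ) (p : PMF (Option F)) :
    ∑' f, histWeight lam θ p f ≤ ENNReal.ofReal (Real.exp lam) * ENNReal.ofReal θ⁻¹ := by
  have h1 : ∀ f, histWeight lam θ p f ≤ ENNReal.ofReal (Real.exp lam) *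
      Set.indicator {f | θ < (p (some f)).toReal} (1 : F → ℝ≥0∞) f := by
    intro f
    by_cases hf : θ < (p (some f)).toReal
    · have hmem : f ∈ {f | θ < (p (some f)).toReal} := hf
      rw [Set.indicator_of_mem hmem, Pi.one_apply, mul_one]
      apply ENNReal.ofReal_le_ofReal
      have h2 : (p (some f)).toReal ≤ 1 :=
        ENNReal.toReal_le_of_le_ofReal zero_le_one (by simpa using p.coe_le_one (some f))
      have h3 : lam * max 0 ((p (some f)).toReal - θ) ≤ lam :=
        mul_le_of_le_one_right hlam (max_le zero_le_one (by linarith))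
      linarith [Real.exp_le_exp.mpr h3]
    · rw [histWeight_eq_zero (not_lt.mp hf)]
      exact zero_le
  refine (ENNReal.tsum_le_tsum h1).trans ?_
  rw [ENNReal.tsum_mul_left]
  gcongr
  exact tsum_indicator_gt_le hθ p

open Classical in
/-- The weights of the histogram mechanism; the default output `f₀` has extra weight `W`. -/
noncomputable def histTotal (lam θ : ℝ) (W : ℝ≥0∞) (f₀ : F) (p : PMF (Option F)) (f : F) : ℝ≥0∞ :=
  histWeight lam θ p f + if f = f₀ then W else 0

theorem tsum_indicator_histTotal_le {lam θ : ℝ} {W : ℝ≥0∞} {f₀ : F} (hlam : 0 ≤ lam)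
    (hθ : 0 < θ) {p q : PMF (Option F)}
    (h : ∀ f, lam * (p (some f)).toReal ≤ lam * (q (some f)).toReal + 1) (T : Set F) :
    ∑' f, T.indicator (histTotal lam θ W f₀ p) f ≤
      3 * ∑' f, T.indicator (histTotal lam θ W f₀ q) f + ENNReal.ofReal (3 * θ⁻¹) := by
  have h1 : ∀ f, T.indicator (histTotal lam θ W f₀ p) f ≤
      3 * T.indicator (histTotal lam θ W f₀ q) f +
      3 * Set.indicator {f | θ < (p (some f)).toReal} 1 f := by
    intro f
    by_cases hf : f ∈ T
    · rw [Set.indicator_of_mem hf, Set.indicator_of_mem hf, histTotal, histTotal, mul_add,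
        add_right_comm]
      gcongr
      · exact histWeight_le hlam (h f)
      · exact le_mul_of_one_le_left zero_le (by norm_num)
    · rw [Set.indicator_of_notMem hf]
      exact zero_le
  refine (ENNReal.tsum_le_tsum h1).trans ?_
  rw [ENNReal.tsum_add, ENNReal.tsum_mul_left, ENNReal.tsum_mul_left,
    ENNReal.ofReal_mul (by norm_num), ENNReal.ofReal_ofNat]
  gcongr
  exact tsum_indicator_gt_le hθ p

theorem le_tsum_histTotal (lam θ : ℝ) (W : ℝ≥0∞) (f₀ : F) (p : PMF (Option F)) :
    W ≤ ∑' f, histTotal lam θ W f₀ p f := by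
  refine le_trans ?_ (ENNReal.le_tsum f₀)
  simp [histTotal]

theorem tsum_histTotal_ne_top {lam θ : ℝ} (hlam : 0 ≤ lam) (hθ : 0 < θ) {W : ℝ≥0∞} (hW : W ≠ ∞)
    (f₀ : F) (p : PMF (Option F)) : ∑' f, histTotal lam θ W f₀ p f ≠ ∞ := by
  simp only [histTotal, ENNReal.tsum_add, tsum_ite_eq]
  refine ENNReal.add_ne_top.mpr ⟨ne_top_of_le_ne_top ?_ (tsum_histWeight_le hlam hθ p), hW⟩
  exact ENNReal.mul_ne_top ENNReal.ofReal_ne_top ENNReal.ofReal_ne_top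

/-- The stable histogram mechanism. -/
theorem exists_histogram_mechanism [Nonempty F] {lam θ δ β : ℝ} (hlam : 0 ≤ lam) (hθ : 0 < θ)
    (hθ1 : θ < 1) (hδ : 0 < δ) (hδ1 : δ < 1) (hβ : 0 < β) (hβ1 : β < 1)
    (hlarge : Real.log (4 / (θ * (β * δ))) ≤ lam * θ) :
    ∃ B : PMF (Option F) → PMF F,
      (∀ p q : PMF (Option F),
        (∀ f, lam * (p (some f)).toReal ≤ lam * (q (some f)).toReal + 1) →
        (∀ f, lam * (q (some f)).toReal ≤ lam * (p (some f)).toReal + 1) →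
        PMF.Indist 18 (ENNReal.ofReal δ) (B p) (B q)) ∧
      ∀ p : PMF (Option F), (∃ f, 2 * θ ≤ (p (some f)).toReal) →
        (B p).toOuterMeasure {f | (p (some f)).toReal ≤ θ} ≤ ENNReal.ofReal β := by
  classical
  let f₀ : F := Classical.arbitrary F
  have hWpos : 0 < 3 * θ⁻¹ * δ⁻¹ := by positivity
  let W : ℝ≥0∞ := ENNReal.ofReal (3 * θ⁻¹ * δ⁻¹)
  have hW0 : W ≠ 0 := (ENNReal.ofReal_pos.mpr hWpos).ne'
  have htop : ∀ p : PMF (Option F), ∑' f, histTotal lam θ W f₀ p f ≠ ∞ := fun p =>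
    tsum_histTotal_ne_top hlam hθ ENNReal.ofReal_ne_top f₀ p
  have hzero : ∀ p : PMF (Option F), ∑' f, histTotal lam θ W f₀ p f ≠ 0 := fun p h =>
    hW0 (le_antisymm (h ▸ le_tsum_histTotal lam θ W f₀ p) zero_le)
  have happ : ∀ (p : PMF (Option F)) (T : Set F),
      (PMF.normalize (histTotal lam θ W f₀ p) (hzero p) (htop p)).toOuterMeasure T =
      (∑' f, T.indicator (histTotal lam θ W f₀ p) f) * (∑' f, histTotal lam θ W f₀ p f)⁻¹ := by
    intro p T
    rw [PMF.toOuterMeasure_apply, ← ENNReal.tsum_mul_right]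
    refine tsum_congr fun f => ?_
    by_cases hf : f ∈ T <;> simp [hf, PMF.normalize_apply]
  refine ⟨fun p => PMF.normalize (histTotal lam θ W f₀ p) (hzero p) (htop p), ?_, ?_⟩
  · intro p q hpq hqp T
    rw [happ, happ]
    set a := ∑' f, histTotal lam θ W f₀ p f with ha
    set a' := ∑' f, histTotal lam θ W f₀ q f with ha'
    have hWa : W ≤ a := le_tsum_histTotal lam θ W f₀ p
    have h1 : a' ≤ 6 * a := by
      have := tsum_indicator_histTotal_le (W := W) (f₀ := f₀) hlam hθ hqp Set.univ
      simp only [Set.indicator_univ] at this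
      refine this.trans ?_
      have h2 : ENNReal.ofReal (3 * θ⁻¹) ≤ W := by
        apply ENNReal.ofReal_le_ofReal
        exact le_mul_of_one_le_right (by positivity) (one_le_inv_iff₀.mpr ⟨hδ, hδ1.le⟩)
      calc 3 * a + ENNReal.ofReal (3 * θ⁻¹) ≤ 3 * a + 3 * a := by
            gcongr
            exact h2.trans (hWa.trans (le_mul_of_one_le_left zero_le (by norm_num)))
        _ = 6 * a := by ring
    have h2 : a⁻¹ ≤ 6 * a'⁻¹ := by
      rw [← ENNReal.inv_le_inv] at h1
      rw [ENNReal.mul_inv (by simp) (by simp)] at h1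
      calc a⁻¹ = 6 * (6⁻¹ * a⁻¹) := by
            rw [← mul_assoc, ENNReal.mul_inv_cancel (by norm_num) (by norm_num), one_mul]
        _ ≤ 6 * a'⁻¹ := by gcongr
    calc (∑' f, T.indicator (histTotal lam θ W f₀ p) f) * a⁻¹
        ≤ (3 * ∑' f, T.indicator (histTotal lam θ W f₀ q) f + ENNReal.ofReal (3 * θ⁻¹)) * a⁻¹ := by
          gcongr
          exact tsum_indicator_histTotal_le hlam hθ hpq T
      _ = 3 * (∑' f, T.indicator (histTotal lam θ W f₀ q) f) * a⁻¹ +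
          ENNReal.ofReal (3 * θ⁻¹) * a⁻¹ := by rw [add_mul]
      _ ≤ 3 * (∑' f, T.indicator (histTotal lam θ W f₀ q) f) * (6 * a'⁻¹) +
          ENNReal.ofReal (3 * θ⁻¹) * W⁻¹ := by
          gcongr
      _ = _ := by
        congr 1
        · ring
        · rw [← ENNReal.ofReal_inv_of_pos hWpos, ← ENNReal.ofReal_mul (by positivity)]
          congr 1
          field_simp
  · rintro p ⟨f, hf⟩
    have hbad : ∑' f, Set.indicator {f | (p (some f)).toReal ≤ θ} (histTotal lam θ W f₀ p) f ≤ W := by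
      have h1 : ∀ f, Set.indicator {f | (p (some f)).toReal ≤ θ} (histTotal lam θ W f₀ p) f ≤
          if f = f₀ then W else 0 := by
        intro f
        refine Set.indicator_apply_le' (fun hf => ?_) fun _ => zero_le
        rw [histTotal, histWeight_eq_zero hf, zero_add]
      refine (ENNReal.tsum_le_tsum h1).trans ?_
      rw [tsum_ite_eq]
    have hgood : ENNReal.ofReal (Real.exp (lam * θ) - 1) ≤ ∑' f, histTotal lam θ W f₀ p f := by
      refine le_trans ?_ (ENNReal.le_tsum f)
      refine le_trans ?_ le_self_add
      apply ENNReal.ofReal_le_ofReal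
      gcongr
      exact le_max_of_le_right (by linarith)
    have hexp : 4 / (θ * (β * δ)) ≤ Real.exp (lam * θ) := by
      rw [← Real.log_le_iff_le_exp (by positivity)]
      exact hlarge
    have hsmall : θ * (β * δ) ≤ 1 := mul_le_one₀ hθ1.le (by positivity)
      (mul_le_one₀ hβ1.le hδ.le hδ1.le)
    have hexp' : 3 / (θ * (β * δ)) ≤ Real.exp (lam * θ) - 1 := by
      have h1 : 1 ≤ 1 / (θ * (β * δ)) := by rw [one_le_div (by positivity)]; exact hsmall
      have h2 : 4 / (θ * (β * δ)) = 3 / (θ * (β * δ)) + 1 / (θ * (β * δ)) := by ring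
      linarith
    have hpos : 0 < Real.exp (lam * θ) - 1 := lt_of_lt_of_le (by positivity) hexp'
    rw [happ]
    calc _ ≤ W * (ENNReal.ofReal (Real.exp (lam * θ) - 1))⁻¹ := by gcongr
      _ = ENNReal.ofReal (3 * θ⁻¹ * δ⁻¹ * (Real.exp (lam * θ) - 1)⁻¹) := by
        rw [← ENNReal.ofReal_inv_of_pos hpos, ← ENNReal.ofReal_mul (by positivity)]
      _ ≤ ENNReal.ofReal β := by
        apply ENNReal.ofReal_le_ofReal
        rw [← div_eq_mul_inv, div_le_iff₀ hpos]
        calc 3 * θ⁻¹ * δ⁻¹ = β * (3 / (θ * (β * δ))) := by field_simp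
          _ ≤ _ := by gcongr

end Histogram

section RealizableLearner

variable {X : Type*} {K : ℕ}

/-- The number of examples in `S` on which `f` errs. -/
def sampleErr {m : ℕ} (S : Fin m → X × Fin K) (f : X → Fin K) : ℕ :=
  (Finset.univ.filter fun j => f (S j).1 ≠ (S j).2).card

theorem sampleErr_le {m : ℕ} (S : Fin m → X × Fin K) (f : X → Fin K) : sampleErr S f ≤ m := by
  simpa [sampleErr] using Finset.card_filter_le (Finset.univ : Finset (Fin m)) _

theorem expect_empiricalPMF_agree {m : ℕ} [NeZero m] (S : Fin m → X × Fin K) (f : X → Fin K) :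
    (empiricalPMF S).expect (Set.indicator {z | f z.1 = z.2} 1) =
      ENNReal.ofReal (1 - sampleErr S f / m) := by
  have hm : (0 : ℝ) < m := by exact_mod_cast NeZero.pos m
  have h1 : ∑ j, (Set.indicator {z : X × Fin K | f z.1 = z.2} (1 : X × Fin K → ℝ≥0∞) ∘ S) j =
      ((m - sampleErr S f : ℕ) : ℝ≥0∞) := by
    have h2 : m - sampleErr S f = (Finset.univ.filter fun j => f (S j).1 = (S j).2).card := by
      have := Finset.card_filter_add_card_filter_not (s := (Finset.univ : Finset (Fin m)))
        (fun j => f (S j).1 = (S j).2)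
      rw [Finset.card_univ, Fintype.card_fin] at this
      simp only [sampleErr, ne_eq]
      omega
    rw [h2, Finset.card_filter, Nat.cast_sum]
    refine Finset.sum_congr rfl fun j _ => ?_
    by_cases h : f (S j).1 = (S j).2 <;> simp [Set.indicator, h]
  rw [empiricalPMF, PMF.expect_map, PMF.expect_uniformOfFintype, h1, Fintype.card_fin,
    ← ENNReal.ofReal_natCast, ← ENNReal.ofReal_natCast, ← ENNReal.ofReal_inv_of_pos hm,
    ← ENNReal.ofReal_mul (by positivity), Nat.cast_sub (sampleErr_le S f)]
  congr 1
  field_simp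

/-- Half of the frequency of the globally stable prediction, as a real number. -/
noncomputable def stableThreshold (d K : ℕ) : ℝ := (stableProb d K).toReal / 2

variable [NeZero K]

theorem stableThreshold_pos (d : ℕ) : 0 < stableThreshold d K :=
  half_pos (ENNReal.toReal_pos (stableProb_pos d).ne'
    (ne_top_of_le_ne_top ENNReal.one_ne_top (stableProb_le_one d)))

theorem stableThreshold_lt_one (d : ℕ) : stableThreshold d K < 1 := by
  have : (stableProb d K).toReal ≤ 1 :=
    ENNReal.toReal_le_of_le_ofReal zero_le_one (by simpa using stableProb_le_one d)
  rw [stableThreshold]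
  linarith

theorem exists_realizable_learner {d : ℕ} {H : Set (X → Fin K)} (hH : ¬ LDeep (d + 1) H)
    {m l : ℕ} [NeZero m] (hl : 0 < l) {δ β : ℝ} (hδ : 0 < δ) (hδ1 : δ < 1) (hβ : 0 < β)
    (hβ1 : β < 1) (hlarge : Real.log (4 / (stableThreshold d K * (β * δ))) ≤
      m / (2 ^ (d + 1) * l) * stableThreshold d K) :
    ∃ B : (Fin m → X × Fin K) → PMF (X → Fin K),
      (∀ (S S' : Fin m → X × Fin K) (i : Fin m), (∀ j, j ≠ i → S j = S' j) →
        PMF.Indist 18 (ENNReal.ofReal δ) (B S) (B S')) ∧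
      ∀ S : Fin m → X × Fin K, (∃ h ∈ H, ∀ j, h (S j).1 = (S j).2) →
        (B S).toOuterMeasure {f | ¬ (f ∈ localClosure (d + 1) H ∧
          stableThreshold d K ≤ (1 - sampleErr S f / m : ℝ) ^ l)} ≤ ENNReal.ofReal β := by
  have hm : (0 : ℝ) < m := by exact_mod_cast NeZero.pos m
  have hl' : (0 : ℝ) < l := by exact_mod_cast hl
  set θ := stableThreshold d K with hθdef
  set lam : ℝ := m / (2 ^ (d + 1) * l) with hlam
  obtain ⟨B, hB1, hB2⟩ := exists_histogram_mechanism (F := X → Fin K) (lam := lam) (θ := θ)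
    (by positivity) (stableThreshold_pos d) (stableThreshold_lt_one d) hδ hδ1 hβ hβ1 hlarge
  refine ⟨fun S => B (stableMixture d H (empiricalPMF S) l), fun S S' i hi => ?_, ?_⟩
  · have key : ∀ S S' : Fin m → X × Fin K, (∀ j, j ≠ i → S j = S' j) → ∀ f,
        lam * (stableMixture d H (empiricalPMF S) l (some f)).toReal ≤
        lam * (stableMixture d H (empiricalPMF S') l (some f)).toReal + 1 := by
      intro S S' hS f
      have h1 := (close_stableMixture (d := d) (H := H) (l := l)
        (close_empiricalPMF hS)).apply_le (some f)
      have hne : (2 ^ (d + 1) * ((l : ℝ≥0∞) * (m : ℝ≥0∞)⁻¹)) ≠ ∞ := by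
        refine ENNReal.mul_ne_top (by simp) (ENNReal.mul_ne_top (by simp) ?_)
        simp [NeZero.ne m]
      have h2 := ENNReal.toReal_mono (ENNReal.add_ne_top.mpr ⟨PMF.apply_ne_top _ _, hne⟩) h1
      rw [ENNReal.toReal_add (PMF.apply_ne_top _ _) hne] at h2
      simp only [ENNReal.toReal_mul, ENNReal.toReal_pow, ENNReal.toReal_ofNat,
        ENNReal.toReal_natCast, ENNReal.toReal_inv] at h2
      have h3 : lam * (2 ^ (d + 1) * (l * (m : ℝ)⁻¹)) = 1 := by
        rw [hlam]; field_simp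
      rw [← h3, ← mul_add]
      gcongr
    exact hB1 _ _ (key S S' hi) (key S' S fun j hj => (hi j hj).symm)
  · rintro S ⟨g, hg, hgS⟩
    obtain ⟨f, hf⟩ := exists_stableProb_le (d := d) l (P := empiricalPMF S) (g := g) (by
      intro z hz
      rw [empiricalPMF, PMF.mem_support_map_iff] at hz
      obtain ⟨j, -, rfl⟩ := hz
      exact hgS j) hH hg
    refine le_trans ?_ (hB2 (stableMixture d H (empiricalPMF S) l) ⟨f, ?_⟩)
    · apply measure_mono
      intro f' hf'
      by_contra hcon
      have hcon' : θ < (stableMixture d H (empiricalPMF S) l (some f')).toReal := not_le.mp hcon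
      refine hf' ⟨mem_localClosure_of_stableMixture_ne_zero hH (P := empiricalPMF S) (l := l) ?_, ?_⟩
      · intro h0
        rw [h0, ENNReal.toReal_zero] at hcon'
        exact absurd (stableThreshold_pos (K := K) d) (not_lt.mpr hcon'.le)
      · refine hcon'.le.trans ?_
        have h1 := stableMixture_apply_some_le d H (empiricalPMF S) l f'
        have h0 : 0 ≤ (1 - sampleErr S f' / m : ℝ) := by
          rw [sub_nonneg, div_le_one hm]
          exact_mod_cast sampleErr_le S f'
        rw [expect_empiricalPMF_agree, ← ENNReal.ofReal_pow h0] at h1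
        exact ENNReal.toReal_le_of_le_ofReal (by positivity) h1
    · rw [hθdef, stableThreshold, mul_div_cancel₀ _ two_ne_zero]
      exact ENNReal.toReal_mono (PMF.apply_ne_top _ _) hf

end RealizableLearner

section Relabel

variable {X : Type*} {K m : ℕ}

/-- The number of labels in `S` that disagree with the labelling `g`. -/
def labelErr (S : Fin m → X × Fin K) (g : Fin m → Fin K) : ℕ :=
  (Finset.univ.filter fun j => g j ≠ (S j).2).card

theorem labelErr_le_succ {S S' : Fin m → X × Fin K} {g g' : Fin m → Fin K} {i : Fin m}
    (hS : ∀ j, j ≠ i → S j = S' j) (hg : ∀ j, j ≠ i → g j = g' j) :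
    labelErr S' g' ≤ labelErr S g + 1 := by
  classical
  refine le_trans (Finset.card_le_card (t := insert i
    (Finset.univ.filter fun j => g j ≠ (S j).2)) ?_) (Finset.card_insert_le _ _)
  intro j hj
  by_cases hji : j = i
  · exact hji ▸ Finset.mem_insert_self _ _
  · refine Finset.mem_insert_of_mem ?_
    simpa [hS j hji, hg j hji] using hj

open Classical in
/-- The exponential mechanism weight of a labelling that is realized by `H` on the points of `S`. -/
noncomputable def labelWeight (H : Set (X → Fin K)) (S : Fin m → X × Fin K) (g : Fin m → Fin K) :
    ℝ≥0∞ :=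
  if g ∈ patterns H (fun j => (S j).1) then ENNReal.ofReal (Real.exp (-labelErr S g)) else 0

theorem sum_labelWeight_mul_le (H : Set (X → Fin K)) {S S' : Fin m → X × Fin K} {i : Fin m}
    (hS : ∀ j, j ≠ i → S j = S' j) {Ψ Ψ' : (Fin m → Fin K) → ℝ≥0∞}
    (hΨ : ∀ g ∈ patterns H (fun j => (S j).1), ∀ g' ∈ patterns H (fun j => (S' j).1),
      (∀ j, j ≠ i → g j = g' j) → Ψ g ≤ Ψ' g') :
    ∑ g, labelWeight H S g * Ψ g ≤ 3 * K * ∑ g, labelWeight H S' g * Ψ' g := by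
  classical
  have hex : ∀ g : Fin m → Fin K, ∃ g' : Fin m → Fin K, g ∈ patterns H (fun j => (S j).1) →
      g' ∈ patterns H (fun j => (S' j).1) ∧ ∀ j, j ≠ i → g j = g' j := by
    intro g
    by_cases hg : g ∈ patterns H (fun j => (S j).1)
    · obtain ⟨h, hh, rfl⟩ := hg
      exact ⟨fun j => h (S' j).1, fun _ => ⟨⟨h, hh, rfl⟩, fun j hj => by simp only [hS j hj]⟩⟩
    · exact ⟨g, fun h => absurd h hg⟩
  choose φ hφ using hex
  set P := Finset.univ.filter fun g => g ∈ patterns H (fun j => (S j).1) with hP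
  have h1 : ∑ g, labelWeight H S g * Ψ g = ∑ g ∈ P, labelWeight H S g * Ψ g := by
    refine (Finset.sum_subset (Finset.subset_univ P) fun g _ hg => ?_).symm
    have : g ∉ patterns H (fun j => (S j).1) := by simpa [hP] using hg
    simp [labelWeight, this]
  have h2 : ∀ g ∈ P, labelWeight H S g * Ψ g ≤ 3 * (labelWeight H S' (φ g) * Ψ' (φ g)) := by
    intro g hg
    have hg' : g ∈ patterns H (fun j => (S j).1) := by simpa [hP] using hg
    obtain ⟨h3, h4⟩ := hφ g hg'
    rw [← mul_assoc]
    refine mul_le_mul' ?_ (hΨ g hg' _ h3 h4)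
    rw [labelWeight, labelWeight, if_pos hg', if_pos h3, show (3 : ℝ≥0∞) = ENNReal.ofReal 3 by simp,
      ← ENNReal.ofReal_mul (by norm_num)]
    apply ENNReal.ofReal_le_ofReal
    have h5 : ((labelErr S' (φ g) : ℕ) : ℝ) ≤ labelErr S g + 1 := by
      exact_mod_cast labelErr_le_succ hS h4
    calc Real.exp (-labelErr S g) ≤ Real.exp (1 + -labelErr S' (φ g)) :=
          Real.exp_le_exp.mpr (by linarith)
      _ = Real.exp 1 * Real.exp (-labelErr S' (φ g)) := Real.exp_add _ _
      _ ≤ 3 * Real.exp (-labelErr S' (φ g)) := by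
        gcongr
        exact Real.exp_one_lt_d9.le.trans (by norm_num)
  have hinj : Set.InjOn (fun g => (φ g, g i)) (P : Set (Fin m → Fin K)) := by
    intro g hg g' hg' heq
    have hg1 : g ∈ patterns H (fun j => (S j).1) := by simpa [hP] using hg
    have hg2 : g' ∈ patterns H (fun j => (S j).1) := by simpa [hP] using hg'
    simp only [Prod.mk.injEq] at heq
    funext j
    by_cases hj : j = i
    · rw [hj]; exact heq.2
    · rw [(hφ g hg1).2 j hj, (hφ g' hg2).2 j hj, heq.1]
  calc ∑ g, labelWeight H S g * Ψ g ≤ ∑ g ∈ P, 3 * (labelWeight H S' (φ g) * Ψ' (φ g)) := by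
        rw [h1]; exact Finset.sum_le_sum h2
    _ = ∑ x ∈ P.image fun g => (φ g, g i), 3 * (labelWeight H S' x.1 * Ψ' x.1) := by
        rw [Finset.sum_image hinj]
    _ ≤ ∑ x : (Fin m → Fin K) × Fin K, 3 * (labelWeight H S' x.1 * Ψ' x.1) :=
        Finset.sum_le_sum_of_subset (Finset.subset_univ _)
    _ = _ := by
        rw [Fintype.sum_prod_type]
        simp only [Finset.sum_const, Finset.card_univ, Fintype.card_fin, nsmul_eq_mul]
        rw [← Finset.mul_sum, ← Finset.mul_sum]
        ring

theorem sum_labelWeight_ne_top (H : Set (X → Fin K)) (S : Fin m → X × Fin K) :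
    ∑ g, labelWeight H S g ≠ ∞ := by
  refine ENNReal.sum_ne_top.mpr fun g _ => ?_
  rw [labelWeight]
  split_ifs <;> simp

theorem le_sum_labelWeight {H : Set (X → Fin K)} (S : Fin m → X × Fin K) {h : X → Fin K}
    (hh : h ∈ H) : ENNReal.ofReal (Real.exp (-sampleErr S h)) ≤ ∑ g, labelWeight H S g := by
  refine le_trans (le_of_eq ?_) (Finset.single_le_sum (fun _ _ => zero_le)
    (Finset.mem_univ fun j => h (S j).1))
  rw [labelWeight, if_pos ⟨h, hh, rfl⟩]
  rfl

theorem sum_labelWeight_ne_zero {H : Set (X → Fin K)} (hH : H.Nonempty) (S : Fin m → X × Fin K) :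
    ∑ g, labelWeight H S g ≠ 0 := by
  obtain ⟨h, hh⟩ := hH
  exact ((ENNReal.ofReal_pos.mpr (Real.exp_pos _)).trans_le (le_sum_labelWeight S hh)).ne'

/-- The exponential mechanism over the labellings realized by `H` on the points of `S`. -/
noncomputable def relabel {H : Set (X → Fin K)} (hH : H.Nonempty) (S : Fin m → X × Fin K) :
    PMF (Fin m → Fin K) :=
  PMF.normalize (labelWeight H S) (by rw [tsum_fintype]; exact sum_labelWeight_ne_zero hH S)
    (by rw [tsum_fintype]; exact sum_labelWeight_ne_top H S)

theorem expect_relabel {H : Set (X → Fin K)} (hH : H.Nonempty) (S : Fin m → X × Fin K)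
    (φ : (Fin m → Fin K) → ℝ≥0∞) : (relabel hH S).expect φ =
      (∑ g, labelWeight H S g * φ g) * (∑ g, labelWeight H S g)⁻¹ := by
  rw [PMF.expect, tsum_fintype, Finset.sum_mul]
  refine Finset.sum_congr rfl fun g _ => ?_
  rw [relabel, PMF.normalize_apply, tsum_fintype]
  ring

theorem mem_patterns_of_relabel_ne_zero {H : Set (X → Fin K)} (hH : H.Nonempty)
    {S : Fin m → X × Fin K} {g : Fin m → Fin K} (hg : relabel hH S g ≠ 0) :
    g ∈ patterns H fun j => (S j).1 := by
  by_contra hcon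
  rw [relabel, PMF.normalize_apply, labelWeight, if_neg hcon, zero_mul] at hg
  exact hg rfl

/-- Relabelling by the exponential mechanism costs only a constant amount of privacy. -/
theorem indist_relabel_bind {H : Set (X → Fin K)} (hH : H.Nonempty) {F : Type*}
    {B : (Fin m → X × Fin K) → PMF F} {M δ : ℝ≥0∞}
    (hB : ∀ (S S' : Fin m → X × Fin K) (i : Fin m), (∀ j, j ≠ i → S j = S' j) →
      PMF.Indist M δ (B S) (B S'))
    {S S' : Fin m → X × Fin K} {i : Fin m} (hS : ∀ j, j ≠ i → S j = S' j) :
    PMF.Indist (9 * K ^ 2 * M) (9 * K ^ 2 * δ)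
      ((relabel hH S).bind fun g => B fun j => ((S j).1, g j))
      ((relabel hH S').bind fun g => B fun j => ((S' j).1, g j)) := by
  intro T
  have hS' : ∀ j, j ≠ i → S' j = S j := fun j hj => (hS j hj).symm
  simp only [PMF.toOuterMeasure_eq_expect, PMF.expect_bind]
  simp only [← PMF.toOuterMeasure_eq_expect]
  rw [expect_relabel]
  have h1 := sum_labelWeight_mul_le H hS
    (Ψ := fun g => (B fun j => ((S j).1, g j)).toOuterMeasure T)
    (Ψ' := fun g => M * (B fun j => ((S' j).1, g j)).toOuterMeasure T + δ)
    (fun g _ g' _ hg => hB _ _ i (fun j hj => by rw [hS j hj, hg j hj]) T)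
  have h2 := sum_labelWeight_mul_le H hS' (Ψ := fun _ => 1) (Ψ' := fun _ => 1)
    (fun _ _ _ _ _ => le_rfl)
  simp only [mul_one] at h2
  set a := ∑ g, labelWeight H S g with ha
  set a' := ∑ g, labelWeight H S' g with ha'
  have hK : (K : ℝ≥0∞) ≠ 0 := by
    rw [Ne, Nat.cast_eq_zero]
    rintro rfl
    rw [Nat.cast_zero, mul_zero, zero_mul] at h2
    exact sum_labelWeight_ne_zero hH S' (le_antisymm h2 zero_le)
  have h3 : a⁻¹ ≤ 3 * K * a'⁻¹ := by
    have h4 := ENNReal.inv_le_inv.mpr h2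
    have h5 : (3 * (K : ℝ≥0∞)) ≠ 0 := mul_ne_zero (by norm_num) hK
    have h6 : (3 * (K : ℝ≥0∞)) ≠ ∞ := ENNReal.mul_ne_top (by norm_num) (by simp)
    rw [ENNReal.mul_inv (Or.inl h5) (Or.inl h6)] at h4
    calc a⁻¹ = 3 * K * ((3 * (K : ℝ≥0∞))⁻¹ * a⁻¹) := by
          rw [← mul_assoc, ENNReal.mul_inv_cancel h5 h6, one_mul]
      _ ≤ _ := by gcongr
  calc (∑ g, labelWeight H S g * (B fun j => ((S j).1, g j)).toOuterMeasure T) * a⁻¹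
      ≤ (3 * K * ∑ g, labelWeight H S' g *
          (M * (B fun j => ((S' j).1, g j)).toOuterMeasure T + δ)) * (3 * K * a'⁻¹) :=
        mul_le_mul' h1 h3
    _ = 9 * K ^ 2 * (relabel hH S').expect fun g =>
          (M * (B fun j => ((S' j).1, g j)).toOuterMeasure T + δ) := by
        rw [expect_relabel]
        ring
    _ = _ := by
        rw [PMF.expect_add, PMF.expect_mul_left, PMF.expect_const]
        ring

/-- The utility of the exponential mechanism. -/
theorem expect_relabel_gt_le {H : Set (X → Fin K)} (hH : H.Nonempty) {d : ℕ}
    (hd : ¬ LDeep (d + 1) H) (S : Fin m → X × Fin K) (t : ℝ) :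
    (relabel hH S).expect (Set.indicator {g | ∃ h ∈ H, sampleErr S h + t < labelErr S g} 1) ≤
      ENNReal.ofReal ((1 + K * m) ^ d * Real.exp (-t)) := by
  classical
  obtain ⟨h₀, hh₀, he₀⟩ := Nat.sInf_mem (hH.image (sampleErr S))
  rw [expect_relabel]
  have h1 : ∀ g, labelWeight H S g *
      Set.indicator {g | ∃ h ∈ H, sampleErr S h + t < labelErr S g} 1 g ≤
      if g ∈ patterns H (fun j => (S j).1) then
        ENNReal.ofReal (Real.exp (-(sampleErr S h₀ + t))) else 0 := by
    intro g
    by_cases hg : g ∈ {g | ∃ h ∈ H, sampleErr S h + t < labelErr S g}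
    · rw [Set.indicator_of_mem hg, Pi.one_apply, mul_one, labelWeight]
      split_ifs
      · apply ENNReal.ofReal_le_ofReal
        obtain ⟨h, hh, hlt⟩ := hg
        have h2 : (sampleErr S h₀ : ℝ) ≤ sampleErr S h := by
          exact_mod_cast he₀ ▸ Nat.sInf_le (Set.mem_image_of_mem _ hh)
        exact Real.exp_le_exp.mpr (by linarith)
      · exact le_rfl
    · rw [Set.indicator_of_notMem hg, mul_zero]
      exact zero_le
  have h2 : ((Finset.univ.filter fun g => g ∈ patterns H (fun j => (S j).1)).card : ℝ) ≤
      (1 + K * m) ^ d := by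
    have := ncard_patterns_le hd fun j => (S j).1
    rw [Set.ncard_eq_toFinset_card'] at this
    refine le_trans ?_ (show (((1 + K * m) ^ d : ℕ) : ℝ) ≤ _ by push_cast; rfl)
    exact_mod_cast le_trans (le_of_eq (by congr 1; ext g; simp)) this
  calc _ ≤ (∑ g, if g ∈ patterns H (fun j => (S j).1) then
        ENNReal.ofReal (Real.exp (-(sampleErr S h₀ + t))) else 0) *
        (ENNReal.ofReal (Real.exp (-sampleErr S h₀)))⁻¹ :=
        mul_le_mul' (Finset.sum_le_sum fun g _ => h1 g)
          (ENNReal.inv_le_inv.mpr (le_sum_labelWeight S hh₀))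
    _ = ENNReal.ofReal ((Finset.univ.filter fun g => g ∈ patterns H (fun j => (S j).1)).card *
          Real.exp (-(sampleErr S h₀ + t)) * (Real.exp (-sampleErr S h₀))⁻¹) := by
        rw [← Finset.sum_filter, Finset.sum_const, nsmul_eq_mul,
          ← ENNReal.ofReal_inv_of_pos (Real.exp_pos _), ← ENNReal.ofReal_natCast,
          ← ENNReal.ofReal_mul (by positivity), ← ENNReal.ofReal_mul (by positivity)]
    _ ≤ _ := by
        apply ENNReal.ofReal_le_ofReal
        rw [mul_assoc, ← Real.exp_neg, ← Real.exp_add]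
        have : -((sampleErr S h₀ : ℝ) + t) + -(-sampleErr S h₀) = -t := by ring
        rw [this]
        gcongr

/-- An upper bound for the error of `f` from the errors of a labelling. -/
theorem sampleErr_le_add (S : Fin m → X × Fin K) (g : Fin m → Fin K) (f : X → Fin K) :
    sampleErr S f ≤ labelErr S g + sampleErr (fun j => ((S j).1, g j)) f := by
  classical
  refine le_trans (Finset.card_le_card ?_) (Finset.card_union_le _ _)
  intro j hj
  simp only [Finset.mem_filter, Finset.mem_univ, true_and, Finset.mem_union] at hj ⊢
  by_contra! h
  exact hj (h.2.trans h.1)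

/-- A differentially private empirical risk minimizer with constant privacy parameters. -/
theorem exists_agnostic_empirical_learner [NeZero K] {d : ℕ} {H : Set (X → Fin K)}
    (hH : ¬ LDeep (d + 1) H) (hne : H.Nonempty)
    [NeZero m] {l : ℕ} (hl : 0 < l) {δ β : ℝ} (hδ : 0 < δ) (hδ1 : δ < 1) (hβ : 0 < β)
    (hβ1 : β < 1) (hlarge : Real.log (4 / (stableThreshold d K * (β * δ))) ≤
      m / (2 ^ (d + 1) * l) * stableThreshold d K) :
    ∃ A : (Fin m → X × Fin K) → PMF (X → Fin K),
      (∀ (S S' : Fin m → X × Fin K) (i : Fin m), (∀ j, j ≠ i → S j = S' j) →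
        PMF.Indist (9 * K ^ 2 * 18) (9 * K ^ 2 * ENNReal.ofReal δ) (A S) (A S')) ∧
      ∀ (S : Fin m → X × Fin K) (t : ℝ),
        (A S).toOuterMeasure {f | ¬ (f ∈ localClosure (d + 1) H ∧ ∀ h ∈ H, (sampleErr S f : ℝ) ≤
          sampleErr S h + t + m * (Real.log (1 / stableThreshold d K) / l))} ≤
        ENNReal.ofReal ((1 + K * m) ^ d * Real.exp (-t)) + ENNReal.ofReal β := by
  obtain ⟨B, hB1, hB2⟩ := exists_realizable_learner hH hl hδ hδ1 hβ hβ1 hlarge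
  refine ⟨fun S => (relabel hne S).bind fun g => B fun j => ((S j).1, g j),
    fun S S' i hS => indist_relabel_bind hne hB1 hS, fun S t => ?_⟩
  rw [PMF.toOuterMeasure_eq_expect, PMF.expect_bind]
  refine le_trans ?_ (add_le_add_left (expect_relabel_gt_le hne hH S t) _)
  rw [← PMF.expect_const (relabel hne S) (ENNReal.ofReal β), ← PMF.expect_add]
  refine PMF.expect_mono fun g hg => ?_
  by_cases hgood : g ∈ {g | ∃ h ∈ H, sampleErr S h + t < labelErr S g}
  · rw [Set.indicator_of_mem hgood]
    refine le_trans (PMF.expect_le_of_le fun f _ => ?_) le_self_add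
    exact Set.indicator_apply_le' (fun _ => le_rfl) fun _ => zero_le
  · refine le_trans ?_ le_add_self
    rw [← PMF.toOuterMeasure_eq_expect]
    obtain ⟨h, hh, hhg⟩ := mem_patterns_of_relabel_ne_zero hne hg
    refine le_trans (measure_mono ?_) (hB2 (fun j => ((S j).1, g j))
      ⟨h, hh, fun j => by rw [← hhg]⟩)
    intro f hf hcon
    refine hf ⟨hcon.1, fun h' hh' => ?_⟩
    have h1 : (labelErr S g : ℝ) ≤ sampleErr S h' + t := by
      by_contra hlt
      exact hgood ⟨h', hh', not_le.mp hlt⟩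
    have h2 : (sampleErr S f : ℝ) ≤ labelErr S g + sampleErr (fun j => ((S j).1, g j)) f := by
      exact_mod_cast sampleErr_le_add S g f
    set e := sampleErr (fun j => ((S j).1, g j)) f with he
    have hm : (0 : ℝ) < m := by exact_mod_cast NeZero.pos m
    have hl' : (0 : ℝ) < l := by exact_mod_cast hl
    have hθ := stableThreshold_pos (K := K) d
    have h3 : stableThreshold d K ≤ Real.exp (-(e / m) * l) := by
      refine hcon.2.trans ?_
      rw [mul_comm, Real.exp_nat_mul]
      have h0 : 0 ≤ (1 - e / m : ℝ) := by
        rw [sub_nonneg, div_le_one hm]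
        exact_mod_cast sampleErr_le _ f
      exact pow_le_pow_left₀ h0 (Real.one_sub_le_exp_neg _) l
    rw [← Real.log_le_iff_le_exp hθ] at h3
    have h4 : (e : ℝ) ≤ m * (Real.log (1 / stableThreshold d K) / l) := by
      rw [one_div, Real.log_inv, ← mul_div_assoc, le_div_iff₀ hl']
      have h5 : (e / m : ℝ) * l * m = e * l := by field_simp
      nlinarith
    linarith

end Relabel

section Subsample

variable {Z F ι : Type*} {m b : ℕ}

/-- Run `A` on a random transversal of the blocks `e j`. -/
noncomputable def subsample [NeZero b] (e : Fin m × Fin b → ι) (A : (Fin m → Z) → PMF F)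
    (S : ι → Z) : PMF F :=
  (PMF.uniformOfFintype (Fin m → Fin b)).bind fun σ => A fun j => S (e (j, σ j))

theorem subsample_toOuterMeasure [NeZero b] (e : Fin m × Fin b → ι) (A : (Fin m → Z) → PMF F)
    (S : ι → Z) (T : Set F) : (subsample e A S).toOuterMeasure T = ((b : ℝ≥0∞) ^ m)⁻¹ *
      ∑ σ : Fin m → Fin b, (A fun j => S (e (j, σ j))).toOuterMeasure T := by
  rw [PMF.toOuterMeasure_eq_expect, subsample, PMF.expect_bind, PMF.expect_uniformOfFintype]
  simp [PMF.toOuterMeasure_eq_expect]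

theorem sum_filter_sum_update_le (j₀ : Fin m) (k₀ : Fin b) (φ : (Fin m → Fin b) → ℝ≥0∞) :
    ∑ σ ∈ Finset.univ.filter (fun σ : Fin m → Fin b => σ j₀ = k₀),
      ∑ k, φ (Function.update σ j₀ k) ≤ ∑ σ, φ σ := by
  rw [← Finset.sum_product' (f := fun (σ : Fin m → Fin b) (k : Fin b) =>
    φ (Function.update σ j₀ k))]
  rw [← Finset.sum_image (f := φ) (g := fun x : (Fin m → Fin b) × Fin b =>
    Function.update x.1 j₀ x.2)]
  · exact Finset.sum_le_sum_of_subset (Finset.subset_univ _)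
  · rintro ⟨σ, k⟩ h ⟨σ', k'⟩ h' heq
    simp only [Finset.coe_product, Finset.coe_filter, Finset.mem_univ, true_and, Finset.coe_univ,
      Set.mem_prod, Set.mem_ofPred_eq, Set.mem_univ, and_true] at h h'
    have h1 := congrFun heq j₀
    simp only [Function.update_self] at h1
    refine Prod.ext (funext fun j => ?_) h1
    by_cases hj : j = j₀
    · rw [hj]; exact h.trans h'.symm
    · simpa [hj] using congrFun heq j

/-- Privacy amplification by subsampling one element of each block. -/
theorem indist_subsample [NeZero b] {e : Fin m × Fin b → ι} (he : Function.Injective e)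
    {A : (Fin m → Z) → PMF F} {M δ : ℝ≥0∞}
    (hA : ∀ (S S' : Fin m → Z) (i : Fin m), (∀ j, j ≠ i → S j = S' j) →
      PMF.Indist M δ (A S) (A S'))
    {S S' : ι → Z} {i : ι} (hS : ∀ j, j ≠ i → S j = S' j) :
    PMF.Indist (1 + M / b) δ (subsample e A S) (subsample e A S') := by
  classical
  intro T
  by_cases hi : i ∈ Set.range e
  · obtain ⟨⟨j₀, k₀⟩, rfl⟩ := hi
    rw [subsample_toOuterMeasure, subsample_toOuterMeasure]
    set a : (Fin m → Fin b) → ℝ≥0∞ := fun σ => (A fun j => S (e (j, σ j))).toOuterMeasure T with ha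
    set a' : (Fin m → Fin b) → ℝ≥0∞ := fun σ => (A fun j => S' (e (j, σ j))).toOuterMeasure T
      with ha'
    have hb0 : (b : ℝ≥0∞) ≠ 0 := by simp [NeZero.ne b]
    have hbt : (b : ℝ≥0∞) ≠ ∞ := by simp
    have hbm0 : (b : ℝ≥0∞) ^ m ≠ 0 := pow_ne_zero _ hb0
    have hbmt : (b : ℝ≥0∞) ^ m ≠ ∞ := ENNReal.pow_ne_top hbt
    set Q := Finset.univ.filter (fun σ : Fin m → Fin b => σ j₀ = k₀) with hQ
    have h1 : ∑ σ, a σ ≤ ∑ σ, a' σ + ∑ σ ∈ Q, a σ := by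
      rw [← Finset.sum_filter_not_add_sum_filter Finset.univ (fun σ : Fin m → Fin b => σ j₀ = k₀) a]
      gcongr
      refine le_trans (Finset.sum_le_sum fun σ hσ => ?_)
        (Finset.sum_le_sum_of_subset (Finset.filter_subset (fun σ : Fin m → Fin b => ¬ σ j₀ = k₀) _))
      refine le_of_eq ?_
      have : (fun j => S (e (j, σ j))) = fun j => S' (e (j, σ j)) := by
        funext j
        refine hS _ fun h => ?_
        have := he h
        simp only [Prod.mk.injEq] at this
        exact (Finset.mem_filter.mp hσ).2 (this.1 ▸ this.2)
      rw [ha, ha']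
      simp only [this]
    have h2 : ∀ σ ∈ Q, ∀ k, a σ ≤ M * a' (Function.update σ j₀ k) + δ := by
      intro σ hσ k
      refine hA _ _ j₀ (fun j hj => ?_) T
      rw [Function.update_of_ne hj]
      refine hS _ fun h => hj ?_
      have := he h
      simp only [Prod.mk.injEq] at this
      exact this.1
    have h3 : b * ∑ σ ∈ Q, a σ ≤ M * ∑ σ, a' σ + δ * b ^ m := by
      calc b * ∑ σ ∈ Q, a σ = ∑ σ ∈ Q, ∑ _k : Fin b, a σ := by
            rw [Finset.mul_sum]
            refine Finset.sum_congr rfl fun σ _ => ?_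
            simp
        _ ≤ ∑ σ ∈ Q, ∑ k, (M * a' (Function.update σ j₀ k) + δ) :=
            Finset.sum_le_sum fun σ hσ => Finset.sum_le_sum fun k _ => h2 σ hσ k
        _ ≤ ∑ σ, (M * a' σ + δ) :=
            sum_filter_sum_update_le j₀ k₀ (fun σ => M * a' σ + δ)
        _ = _ := by
            rw [Finset.sum_add_distrib, ← Finset.mul_sum]
            simp [mul_comm]
    have h4 : ∑ σ ∈ Q, a σ ≤ (b : ℝ≥0∞)⁻¹ * (M * ∑ σ, a' σ + δ * b ^ m) := by
      rw [← ENNReal.div_eq_inv_mul, ENNReal.le_div_iff_mul_le (Or.inl hb0) (Or.inl hbt), mul_comm]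
      exact h3
    have hb1 : (b : ℝ≥0∞)⁻¹ ≤ 1 := by
      rw [ENNReal.inv_le_one]
      exact_mod_cast NeZero.one_le
    calc ((b : ℝ≥0∞) ^ m)⁻¹ * ∑ σ, a σ
        ≤ ((b : ℝ≥0∞) ^ m)⁻¹ * (∑ σ, a' σ + (b : ℝ≥0∞)⁻¹ * (M * ∑ σ, a' σ + δ * b ^ m)) := by
          gcongr
          exact h1.trans (by gcongr)
      _ = (1 + M / b) * (((b : ℝ≥0∞) ^ m)⁻¹ * ∑ σ, a' σ) +
          (b : ℝ≥0∞)⁻¹ * δ * (((b : ℝ≥0∞) ^ m)⁻¹ * b ^ m) := by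
          rw [ENNReal.div_eq_inv_mul]; ring
      _ ≤ _ := by
          rw [ENNReal.inv_mul_cancel hbm0 hbmt, mul_one]
          gcongr
          exact mul_le_of_le_one_left zero_le hb1
  · have : subsample e A S = subsample e A S' := by
      rw [subsample, subsample]
      congr 1
      funext σ
      congr 1
      funext j
      exact hS _ fun h => hi ⟨_, h⟩
    rw [this]
    exact le_add_right (le_mul_of_one_le_left zero_le le_self_add)

theorem exists_block_index {n : ℕ} (h : m * b ≤ n) :
    ∃ e : Fin m × Fin b → Fin n, Function.Injective e :=
  ⟨fun x => Fin.castLE h (finProdFinEquiv x),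
    (Fin.castLE_injective h).comp finProdFinEquiv.injective⟩

end Subsample

section Rademacher

/-- The sign encoded by a Boolean. -/
def boolSign (b : Bool) : ℝ := if b then 1 else -1

/-- The indicator value of a Boolean. -/
def boolVal (b : Bool) : ℝ := if b then 1 else 0

theorem sum_exp_signed_le {m : ℕ} (u : Fin m → ℝ) :
    ∑ σ : Fin m → Bool, Real.exp (∑ i, boolSign (σ i) * u i) ≤
      2 ^ m * Real.exp ((∑ i, u i ^ 2) / 2) := by
  have h1 : ∑ σ : Fin m → Bool, Real.exp (∑ i, boolSign (σ i) * u i) =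
      ∏ i, ∑ b : Bool, Real.exp (boolSign b * u i) := by
    rw [Finset.prod_univ_sum, Fintype.piFinset_univ]
    simp only [Real.exp_sum]
  rw [h1]
  have h2 : ∀ i ∈ Finset.univ, ∑ b : Bool, Real.exp (boolSign b * u i) ≤
      2 * Real.exp (u i ^ 2 / 2) := by
    intro i _
    have := Real.cosh_le_exp_half_sq (u i)
    rw [Real.cosh_eq] at this
    simp only [Fintype.sum_bool, boolSign]
    norm_num
    linarith
  refine (Finset.prod_le_prod (fun i _ => by positivity) h2).trans ?_
  rw [Finset.prod_mul_distrib, ← Real.exp_sum, ← Finset.sum_div]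
  simp

theorem card_signed_sum_gt_le {m : ℕ} (u : Fin m → ℝ) {v t : ℝ} (hv : 0 < v)
    (hu : ∑ i, u i ^ 2 ≤ v) (ht : 0 ≤ t) :
    ((Finset.univ.filter fun σ : Fin m → Bool => t < ∑ i, boolSign (σ i) * u i).card : ℝ) ≤
      2 ^ m * Real.exp (-(t ^ 2 / (2 * v))) := by
  set lam := t / v with hlam
  have hlam0 : 0 ≤ lam := by positivity
  have h1 := sum_exp_signed_le fun i => lam * u i
  have h2 : ∀ σ ∈ Finset.univ.filter fun σ : Fin m → Bool => t < ∑ i, boolSign (σ i) * u i,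
      Real.exp (lam * t) ≤ Real.exp (∑ i, boolSign (σ i) * (lam * u i)) := by
    intro σ hσ
    apply Real.exp_le_exp.mpr
    have : ∑ i, boolSign (σ i) * (lam * u i) = lam * ∑ i, boolSign (σ i) * u i := by
      rw [Finset.mul_sum]
      exact Finset.sum_congr rfl fun i _ => by ring
    rw [this]
    gcongr
    exact (Finset.mem_filter.mp hσ).2.le
  have h3 := (Finset.card_nsmul_le_sum _ _ _ h2).trans ((Finset.sum_le_sum_of_subset_of_nonneg
    (Finset.filter_subset _ _) fun σ _ _ => (Real.exp_pos _).le).trans h1)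
  rw [nsmul_eq_mul] at h3
  have h4 : (∑ i, (lam * u i) ^ 2) / 2 ≤ lam ^ 2 * v / 2 := by
    simp only [mul_pow, ← Finset.mul_sum]
    gcongr
  have h5 : 2 ^ m * Real.exp ((∑ i, (lam * u i) ^ 2) / 2) ≤ 2 ^ m * Real.exp (lam ^ 2 * v / 2) := by
    gcongr
  have h6 := h3.trans h5
  rw [← le_div_iff₀ (Real.exp_pos _)] at h6
  refine h6.trans (le_of_eq ?_)
  rw [mul_div_assoc, ← Real.exp_sub]
  congr 2
  rw [hlam]
  field_simp
  ring

theorem card_abs_signed_sum_gt_le {m : ℕ} (u : Fin m → ℝ) {v t : ℝ} (hv : 0 < v)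
    (hu : ∑ i, u i ^ 2 ≤ v) (ht : 0 ≤ t) :
    ((Finset.univ.filter fun σ : Fin m → Bool => t < |∑ i, boolSign (σ i) * u i|).card : ℝ) ≤
      2 ^ m * (2 * Real.exp (-(t ^ 2 / (2 * v)))) := by
  classical
  have h1 := card_signed_sum_gt_le u hv hu ht
  have h2 := card_signed_sum_gt_le (fun i => -u i) hv (by simpa using hu) ht
  have h3 : (Finset.univ.filter fun σ : Fin m → Bool => t < |∑ i, boolSign (σ i) * u i|) ⊆
      (Finset.univ.filter fun σ : Fin m → Bool => t < ∑ i, boolSign (σ i) * u i) ∪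
      (Finset.univ.filter fun σ : Fin m → Bool => t < ∑ i, boolSign (σ i) * -u i) := by
    intro σ hσ
    simpa [lt_abs] using hσ
  have h4 := (Nat.cast_le (α := ℝ)).mpr ((Finset.card_le_card h3).trans (Finset.card_union_le _ _))
  push_cast at h4
  linarith

/-- The signed sum of a Boolean vector. -/
def signedSum {m : ℕ} (σ a : Fin m → Bool) : ℝ := ∑ i, boolSign (σ i) * boolVal (a i)

theorem sum_sq_sub_boolVal {m : ℕ} (a b : Fin m → Bool) :
    ∑ i, (boolVal (a i) - boolVal (b i)) ^ 2 = hammingDist a b := by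
  rw [hammingDist, Finset.card_filter, Nat.cast_sum]
  refine Finset.sum_congr rfl fun i _ => ?_
  cases a i <;> cases b i <;> simp [boolVal]

end Rademacher

section Packing

variable {m : ℕ}

/-- A separated family of Boolean vectors stays distinct on some few coordinates. -/
theorem exists_separating_coordinates {A : Finset (Fin m → Bool)} {ρ : ℝ}
    (hρ1 : ρ ≤ 1) (hm : 0 < m)
    (hsep : ∀ a ∈ A, ∀ b ∈ A, a ≠ b → ρ * m < hammingDist a b) {s : ℕ}
    (hs : (A.card : ℝ) ^ 2 * (1 - ρ) ^ s < 1) :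
    ∃ w : Fin s → Fin m, Set.InjOn (fun (a : Fin m → Bool) j => a (w j)) A := by
  classical
  by_contra! hcon
  have hm' : (0 : ℝ) < m := by exact_mod_cast hm
  have hcover : (Finset.univ : Finset (Fin s → Fin m)) ⊆ A.offDiag.biUnion fun p =>
      Fintype.piFinset fun _ : Fin s => Finset.univ.filter fun i => p.1 i = p.2 i := by
    intro w _
    have := hcon w
    simp only [Set.InjOn, not_forall] at this
    obtain ⟨a, ha, b, hb, hab, hne⟩ := this
    refine Finset.mem_biUnion.mpr ⟨(a, b), Finset.mem_offDiag.mpr ⟨ha, hb, hne⟩, ?_⟩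
    simp only [Fintype.mem_piFinset, Finset.mem_filter, Finset.mem_univ, true_and]
    exact fun j => congrFun hab j
  have h1 := (Finset.card_le_card hcover).trans Finset.card_biUnion_le
  have h2 : ∀ p ∈ A.offDiag, (((Fintype.piFinset fun _ : Fin s =>
      Finset.univ.filter fun i => p.1 i = p.2 i).card : ℕ) : ℝ) ≤ ((1 - ρ) * m) ^ s := by
    intro p hp
    rw [Fintype.card_piFinset_const, Nat.cast_pow]
    obtain ⟨ha, hb, hne⟩ := Finset.mem_offDiag.mp hp
    have h3 := hsep _ ha _ hb hne
    have h4 := Finset.card_filter_add_card_filter_not (s := (Finset.univ : Finset (Fin m)))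
      (fun i => p.1 i = p.2 i)
    rw [Finset.card_univ, Fintype.card_fin] at h4
    have h5 : ((Finset.univ.filter fun i => p.1 i = p.2 i).card : ℝ) + hammingDist p.1 p.2 = m := by
      rw [hammingDist]
      exact_mod_cast h4
    gcongr
    linarith
  have h3 : ((m : ℝ)) ^ s ≤ (A.card : ℝ) ^ 2 * ((1 - ρ) * m) ^ s := by
    calc (m : ℝ) ^ s = ((Finset.univ : Finset (Fin s → Fin m)).card : ℝ) := by simp
      _ ≤ ∑ p ∈ A.offDiag, (((Fintype.piFinset fun _ : Fin s =>
          Finset.univ.filter fun i => p.1 i = p.2 i).card : ℕ) : ℝ) := by exact_mod_cast h1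
      _ ≤ A.offDiag.card * ((1 - ρ) * m) ^ s := by
          rw [← nsmul_eq_mul]
          exact Finset.sum_le_card_nsmul _ _ _ h2
      _ ≤ _ := by
          have h6 : (A.offDiag.card : ℝ) ≤ (A.card : ℝ) ^ 2 := by
            rw [Finset.offDiag_card, sq]
            exact_mod_cast Nat.sub_le _ _
          have h7 : 0 ≤ 1 - ρ := by linarith
          gcongr
  rw [mul_pow, ← mul_assoc] at h3
  have h4 : 0 < (m : ℝ) ^ s := by positivity
  nlinarith

/-- The growth function of `A` is bounded by `(1 + K s) ^ D`. -/
def HasGrowth (K D : ℕ) {ι : Type*} (A : Set (ι → Bool)) : Prop :=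
  ∀ (s : ℕ) (w : Fin s → ι), ((fun a j => a (w j)) '' A).ncard ≤ (1 + K * s) ^ D

/-- The constant in the packing bound. -/
noncomputable def packingConst (K D : ℕ) : ℝ := 2 * D * (Real.log (2 * D * (4 * K + 1)) + 2)

theorem packingConst_nonneg (K D : ℕ) : 0 ≤ packingConst K D := by
  rcases Nat.eq_zero_or_pos D with rfl | hD
  · simp [packingConst]
  · have h1 : (1 : ℝ) ≤ D := by exact_mod_cast hD
    have h2 : (0 : ℝ) ≤ K := by positivity
    have : 0 ≤ Real.log (2 * D * (4 * K + 1)) := Real.log_nonneg (by nlinarith)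
    rw [packingConst]
    positivity

theorem card_le_of_separated {K D : ℕ} (hD : 0 < D) {A : Finset (Fin m → Bool)} (hm : 0 < m)
    (hA : HasGrowth K D (A : Set (Fin m → Bool))) (j : ℕ)
    (hsep : ∀ a ∈ A, ∀ b ∈ A, a ≠ b → (4 : ℝ)⁻¹ ^ j * m < hammingDist a b) :
    (A.card : ℝ) ≤ Real.exp (packingConst K D * (j + 1)) := by
  classical
  rcases A.eq_empty_or_nonempty with rfl | hne
  · simp [(Real.exp_pos _).le]
  set ρ : ℝ := (4 : ℝ)⁻¹ ^ j with hρ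
  have hρ0 : 0 < ρ := by positivity
  have hρ1 : ρ ≤ 1 := pow_le_one₀ (by norm_num) (by norm_num)
  have hN : (1 : ℝ) ≤ A.card := by exact_mod_cast hne.card_pos
  set L := Real.log A.card with hL
  have hL0 : 0 ≤ L := Real.log_nonneg hN
  set s := ⌊2 * L / ρ⌋₊ + 1 with hs
  have hs1 : 2 * L / ρ < s := by
    rw [hs]; push_cast; exact Nat.lt_floor_add_one _
  have hs2 : (s : ℝ) ≤ 2 * L / ρ + 1 := by
    rw [hs]; push_cast; gcongr; exact Nat.floor_le (by positivity)
  have hsmall : (A.card : ℝ) ^ 2 * (1 - ρ) ^ s < 1 := by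
    have h1 : (1 - ρ) ^ s ≤ Real.exp (-ρ * s) := by
      rw [mul_comm, Real.exp_nat_mul]
      exact pow_le_pow_left₀ (by linarith) (Real.one_sub_le_exp_neg ρ) s
    have h2 : (A.card : ℝ) ^ 2 = Real.exp (2 * L) := by
      rw [two_mul, Real.exp_add, hL, Real.exp_log (by linarith), sq]
    calc (A.card : ℝ) ^ 2 * (1 - ρ) ^ s ≤ Real.exp (2 * L) * Real.exp (-ρ * s) := by
          rw [h2]; gcongr
      _ = Real.exp (2 * L - ρ * s) := by rw [← Real.exp_add]; ring_nf
      _ < 1 := by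
          rw [Real.exp_lt_one_iff]
          rw [div_lt_iff₀ hρ0] at hs1
          linarith
  obtain ⟨w, hw⟩ := exists_separating_coordinates hρ1 hm hsep hsmall
  have hcard : A.card ≤ (1 + K * s) ^ D := by
    have h1 := hA s w
    rwa [hw.ncard_image, Set.ncard_coe_finset] at h1
  have hD' : (1 : ℝ) ≤ D := by exact_mod_cast hD
  have hK0 : (0 : ℝ) ≤ K := by positivity
  have h1 : L ≤ D * Real.log (1 + K * s) := by
    rw [hL, ← Real.log_pow]
    exact Real.log_le_log (by linarith) (by exact_mod_cast hcard)
  have h2 : (1 + K * s : ℝ) ≤ (4 * K + 1) / ρ * (1 + L) := by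
    have h3 : 1 ≤ 1 / ρ := by rw [le_div_iff₀ hρ0]; linarith
    calc (1 + K * s : ℝ) ≤ 1 + K * (2 * L / ρ + 1) := by gcongr
      _ = 1 + K + 2 * K * L * (1 / ρ) := by ring
      _ ≤ (1 + K) * (1 / ρ) + 2 * K * L * (1 / ρ) := by
          gcongr
          exact le_mul_of_one_le_right (by positivity) h3
      _ = (1 + K + 2 * K * L) / ρ := by ring
      _ ≤ ((4 * K + 1) * (1 + L)) / ρ := by
          gcongr
          nlinarith [mul_nonneg hK0 hL0]
      _ = _ := by ring
  have h3 : Real.log (1 + L) ≤ L / (2 * D) + Real.log (2 * D) := by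
    have h4 : (1 + L) = (1 + L) / (2 * D) * (2 * D) := by field_simp
    rw [h4, Real.log_mul (by positivity) (by positivity)]
    gcongr
    refine (Real.log_le_sub_one_of_pos (by positivity)).trans ?_
    rw [add_div]
    have : 1 / (2 * D : ℝ) ≤ 1 := by rw [div_le_one (by positivity)]; linarith
    linarith
  have h4 : L ≤ D * (Real.log (4 * K + 1) + j * Real.log 4 + L / (2 * D) + Real.log (2 * D)) := by
    refine h1.trans ?_
    gcongr
    calc Real.log (1 + K * s) ≤ Real.log ((4 * K + 1) / ρ * (1 + L)) :=
          Real.log_le_log (by positivity) h2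
      _ = Real.log (4 * K + 1) + j * Real.log 4 + Real.log (1 + L) := by
          rw [Real.log_mul (by positivity) (by positivity), Real.log_div (by positivity)
            (by positivity), hρ, Real.log_pow, Real.log_inv]
          ring
      _ ≤ _ := by linarith
  have h5 : Real.log 4 ≤ 2 := by
    have : (4 : ℝ) = 2 ^ 2 := by norm_num
    rw [this, Real.log_pow]
    have := Real.log_two_lt_d9
    push_cast
    linarith
  have h6 : (D : ℝ) * (L / (2 * D)) = L / 2 := by field_simp
  have h7 : L ≤ 2 * D * (Real.log (2 * D * (4 * K + 1)) + j * Real.log 4) := by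
    rw [Real.log_mul (by positivity) (by positivity)]
    nlinarith
  rw [← Real.log_le_iff_le_exp (by linarith)]
  refine h7.trans ?_
  rw [packingConst, mul_assoc _ _ ((j : ℝ) + 1)]
  gcongr
  have h8 : 0 ≤ Real.log (2 * D * (4 * K + 1)) := Real.log_nonneg (by nlinarith)
  have h9 : (0 : ℝ) ≤ j := by positivity
  nlinarith [mul_nonneg h9 h8]

/-- A maximal separated subfamily. -/
theorem exists_maximal_separated (A : Finset (Fin m → Bool)) {r : ℝ} (hr : 0 ≤ r) :
    ∃ N ⊆ A, (∀ a ∈ N, ∀ b ∈ N, a ≠ b → r < hammingDist a b) ∧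
      ∀ a ∈ A, ∃ b ∈ N, (hammingDist b a : ℝ) ≤ r := by
  classical
  obtain ⟨N, hN, hmax⟩ := Finset.exists_max_image
    (A.powerset.filter fun N => ∀ a ∈ N, ∀ b ∈ N, a ≠ b → r < hammingDist a b) Finset.card
    ⟨∅, by simp⟩
  obtain ⟨hNA, hsep⟩ := Finset.mem_filter.mp hN
  rw [Finset.mem_powerset] at hNA
  refine ⟨N, hNA, hsep, fun a ha => ?_⟩
  by_contra! hcon
  have haN : a ∉ N := fun h => by
    have := hcon a h
    rw [hammingDist_self] at this
    simp only [Nat.cast_zero] at this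
    linarith
  have := hmax (insert a N) (by
    refine Finset.mem_filter.mpr ⟨Finset.mem_powerset.mpr (Finset.insert_subset ha hNA), ?_⟩
    intro b hb c hc hbc
    rcases Finset.mem_insert.mp hb with rfl | hb' <;> rcases Finset.mem_insert.mp hc with rfl | hc'
    · exact absurd rfl hbc
    · rw [hammingDist_comm]; exact hcon c hc'
    · exact hcon b hb'
    · exact hsep b hb' c hc' hbc)
  rw [Finset.card_insert_of_notMem haN] at this
  omega

theorem HasGrowth.mono {K D : ℕ} {A B : Set (Fin m → Bool)} (h : A ⊆ B) (hB : HasGrowth K D B) :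
    HasGrowth K D A := fun s w =>
  (Set.ncard_le_ncard (Set.image_mono h) (Set.toFinite _)).trans (hB s w)

end Packing

section Chaining

variable {m : ℕ}

theorem sum_range_succ_mul_half_pow (n : ℕ) :
    ∑ i ∈ Finset.range n, ((i : ℝ) + 1) * (1 / 2) ^ i = 4 - (2 * n + 4) * (1 / 2) ^ n := by
  induction n with
  | zero => norm_num
  | succ n ih =>
    rw [Finset.sum_range_succ, ih]
    push_cast
    ring

theorem signedSum_sub (σ a b : Fin m → Bool) : signedSum σ a - signedSum σ b =
    ∑ i, boolSign (σ i) * (boolVal (a i) - boolVal (b i)) := by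
  rw [signedSum, signedSum, ← Finset.sum_sub_distrib]
  exact Finset.sum_congr rfl fun i _ => by ring

theorem sum_sq_boolVal_le (a : Fin m → Bool) : ∑ i, boolVal (a i) ^ 2 ≤ m := by
  have : ∀ i ∈ Finset.univ, boolVal (a i) ^ 2 ≤ 1 := by
    intro i _
    cases a i <;> simp [boolVal]
  simpa using Finset.sum_le_card_nsmul _ _ _ this

/-- The event that some link of the chain at scale `j` has a large signed sum. -/
noncomputable def badLink (N : ℕ → Finset (Fin m → Bool)) (τ : ℝ) (j : ℕ) :
    Finset (Fin m → Bool) :=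
  open Classical in
  ((N j ×ˢ N (j + 1)).filter fun p => (hammingDist p.1 p.2 : ℝ) ≤ (4 : ℝ)⁻¹ ^ j * m).biUnion fun p =>
    Finset.univ.filter fun σ => ((j : ℝ) + 1) * (1 / 2) ^ j * (τ * m / 8) <
      |∑ i, boolSign (σ i) * (boolVal (p.2 i) - boolVal (p.1 i))|

theorem card_badLink_le {K D : ℕ} (hm : 0 < m) {N : ℕ → Finset (Fin m → Bool)}
    (hN : ∀ j, ((N j).card : ℝ) ≤ Real.exp (packingConst K D * (j + 1)))
    {τ : ℝ} (hτ : 0 < τ) (j : ℕ) :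
    ((badLink N τ j).card : ℝ) ≤
      2 ^ m * (2 * Real.exp (3 * packingConst K D - τ ^ 2 * m / 128) ^ (j + 1)) := by
  classical
  have hm' : (0 : ℝ) < m := by exact_mod_cast hm
  have hE := packingConst_nonneg K D
  set E := packingConst K D with hEdef
  set y := τ ^ 2 * m / 128 with hy
  have hy0 : 0 ≤ y := by positivity
  have h1 : ∀ p ∈ ((N j ×ˢ N (j + 1)).filter fun p =>
      (hammingDist p.1 p.2 : ℝ) ≤ (4 : ℝ)⁻¹ ^ j * m),
      ((Finset.univ.filter fun σ : Fin m → Bool => ((j : ℝ) + 1) * (1 / 2) ^ j * (τ * m / 8) <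
      |∑ i, boolSign (σ i) * (boolVal (p.2 i) - boolVal (p.1 i))|).card : ℝ) ≤
      2 ^ m * (2 * Real.exp (-(((j : ℝ) + 1) ^ 2 * y))) := by
    intro p hp
    refine (card_abs_signed_sum_gt_le _ (v := (4 : ℝ)⁻¹ ^ j * m) (by positivity) ?_
      (by positivity)).trans (le_of_eq ?_)
    · rw [sum_sq_sub_boolVal, hammingDist_comm]
      exact (Finset.mem_filter.mp hp).2
    · congr 4
      have h4 : ((1 : ℝ) / 2) ^ j * (1 / 2) ^ j = (4 : ℝ)⁻¹ ^ j := by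
        rw [← mul_pow]; norm_num
      rw [div_eq_iff (by positivity)]
      calc (((j : ℝ) + 1) * (1 / 2) ^ j * (τ * m / 8)) ^ 2
          = ((j : ℝ) + 1) ^ 2 * ((1 / 2) ^ j * (1 / 2) ^ j) * (τ * m / 8) ^ 2 := by ring
        _ = _ := by rw [h4, hy]; ring
  have h2 : ((badLink N τ j).card : ℝ) ≤ ∑ p ∈ ((N j ×ˢ N (j + 1)).filter fun p =>
      (hammingDist p.1 p.2 : ℝ) ≤ (4 : ℝ)⁻¹ ^ j * m),
      ((Finset.univ.filter fun σ : Fin m → Bool => ((j : ℝ) + 1) * (1 / 2) ^ j * (τ * m / 8) <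
      |∑ i, boolSign (σ i) * (boolVal (p.2 i) - boolVal (p.1 i))|).card : ℝ) := by
    have := (Nat.cast_le (α := ℝ)).mpr (Finset.card_biUnion_le (s := (N j ×ˢ N (j + 1)).filter
      fun p => (hammingDist p.1 p.2 : ℝ) ≤ (4 : ℝ)⁻¹ ^ j * m) (t := fun p =>
      Finset.univ.filter fun σ : Fin m → Bool => ((j : ℝ) + 1) * (1 / 2) ^ j * (τ * m / 8) <
      |∑ i, boolSign (σ i) * (boolVal (p.2 i) - boolVal (p.1 i))|))
    rw [Nat.cast_sum] at this
    exact this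
  have h3 : (((N j ×ˢ N (j + 1)).filter fun p =>
      (hammingDist p.1 p.2 : ℝ) ≤ (4 : ℝ)⁻¹ ^ j * m).card : ℝ) ≤ Real.exp (E * (2 * j + 3)) := by
    calc _ ≤ (((N j ×ˢ N (j + 1)).card : ℕ) : ℝ) := by
          exact_mod_cast Finset.card_filter_le _ _
      _ = (N j).card * (N (j + 1)).card := by rw [Finset.card_product]; push_cast; rfl
      _ ≤ Real.exp (E * (j + 1)) * Real.exp (E * ((j + 1 : ℕ) + 1)) := by
          gcongr
          · exact hN j
          · exact hN (j + 1)
      _ = _ := by rw [← Real.exp_add]; push_cast; ring_nf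
  refine h2.trans ((Finset.sum_le_card_nsmul _ _ _ h1).trans ?_)
  rw [nsmul_eq_mul]
  calc _ ≤ Real.exp (E * (2 * j + 3)) * (2 ^ m * (2 * Real.exp (-(((j : ℝ) + 1) ^ 2 * y)))) := by
        gcongr
    _ = 2 ^ m * (2 * Real.exp (E * (2 * j + 3) - ((j : ℝ) + 1) ^ 2 * y)) := by
        rw [sub_eq_add_neg, Real.exp_add]; ring
    _ ≤ 2 ^ m * (2 * Real.exp (((j + 1 : ℕ) : ℝ) * (3 * E - y))) := by
        gcongr
        push_cast
        have hj : (0 : ℝ) ≤ j := by positivity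
        nlinarith [mul_nonneg hj hE, mul_nonneg hj hy0, mul_nonneg (mul_nonneg hj hj) hy0]
    _ = _ := by rw [Real.exp_nat_mul]

/-- Chaining bound for the supremum of signed sums over a class with polynomial growth. -/
theorem card_exists_signedSum_gt_le {K D : ℕ} (hD : 0 < D) (hm : 0 < m)
    {A : Finset (Fin m → Bool)} (hA : HasGrowth K D (A : Set (Fin m → Bool))) {τ : ℝ} (hτ : 0 < τ)
    (hlarge : 3 * packingConst K D + 1 ≤ τ ^ 2 * m / 128) :
    ((Finset.univ.filter fun σ : Fin m → Bool => ∃ a ∈ A, τ * m < |signedSum σ a|).card : ℝ) ≤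
      2 ^ m * (6 * Real.exp (3 * packingConst K D - τ ^ 2 * m / 128)) := by
  classical
  have hm' : (0 : ℝ) < m := by exact_mod_cast hm
  choose N hNA hNsep hNdense using fun j : ℕ =>
    exists_maximal_separated A (r := (4 : ℝ)⁻¹ ^ j * m) (by positivity)
  have hN : ∀ j, ((N j).card : ℝ) ≤ Real.exp (packingConst K D * (j + 1)) := fun j =>
    card_le_of_separated hD hm (hA.mono (by exact_mod_cast hNA j)) j (hNsep j)
  have hE := packingConst_nonneg K D
  set E := packingConst K D with hEdef
  set y := τ ^ 2 * m / 128 with hy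
  set z := Real.exp (3 * E - y) with hz
  have hz0 : 0 < z := Real.exp_pos _
  have hz1 : z ≤ 1 / 2 := by
    have h1 : z ≤ Real.exp (-1) := Real.exp_le_exp.mpr (by linarith)
    have h2 := Real.exp_neg_one_lt_d9
    linarith
  obtain ⟨J, hJ⟩ : ∃ J : ℕ, (4 : ℝ)⁻¹ ^ J * m < 1 := by
    obtain ⟨J, hJ⟩ := exists_pow_lt_of_lt_one (show (0 : ℝ) < 1 / m by positivity)
      (show (4 : ℝ)⁻¹ < 1 by norm_num)
    exact ⟨J, by rwa [lt_div_iff₀ hm'] at hJ⟩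
  set B₀ : Finset (Fin m → Bool) := (N 0).biUnion fun a =>
    Finset.univ.filter fun σ => τ * m / 2 < |signedSum σ a| with hB₀
  have hB₀card : (B₀.card : ℝ) ≤ 2 ^ m * (2 * z) := by
    have h1 : ∀ a ∈ N 0, ((Finset.univ.filter fun σ : Fin m → Bool =>
        τ * m / 2 < |signedSum σ a|).card : ℝ) ≤ 2 ^ m * (2 * Real.exp (-(16 * y))) := by
      intro a _
      refine (card_abs_signed_sum_gt_le _ hm' (sum_sq_boolVal_le a)
        (by positivity)).trans (le_of_eq ?_)
      congr 4
      rw [hy]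
      field_simp
      ring
    have h2 := (Nat.cast_le (α := ℝ)).mpr (Finset.card_biUnion_le (s := N 0) (t := fun a =>
      Finset.univ.filter fun σ : Fin m → Bool => τ * m / 2 < |signedSum σ a|))
    rw [Nat.cast_sum] at h2
    refine h2.trans ((Finset.sum_le_card_nsmul _ _ _ h1).trans ?_)
    rw [nsmul_eq_mul]
    have h3 := hN 0
    rw [Nat.cast_zero, zero_add, mul_one] at h3
    calc _ ≤ Real.exp E * (2 ^ m * (2 * Real.exp (-(16 * y)))) := by gcongr
      _ = 2 ^ m * (2 * Real.exp (E - 16 * y)) := by rw [sub_eq_add_neg, Real.exp_add]; ring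
      _ ≤ _ := by
        rw [hz]
        gcongr
        · linarith
        · linarith [show 0 ≤ y by positivity]
  have hsub : (Finset.univ.filter fun σ : Fin m → Bool => ∃ a ∈ A, τ * m < |signedSum σ a|) ⊆
      B₀ ∪ (Finset.range J).biUnion (badLink N τ) := by
    intro σ hσ
    by_contra hcon
    rw [Finset.mem_union, not_or] at hcon
    obtain ⟨hc0, hcj⟩ := hcon
    have key : ∀ j ≤ J, ∀ q ∈ N j, |signedSum σ q| ≤
        τ * m / 2 + ∑ i ∈ Finset.range j, ((i : ℝ) + 1) * (1 / 2) ^ i * (τ * m / 8) := by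
      intro j
      induction j with
      | zero =>
        intro _ q hq
        by_contra hlt
        refine hc0 (Finset.mem_biUnion.mpr ⟨q, hq, Finset.mem_filter.mpr ⟨Finset.mem_univ _, ?_⟩⟩)
        simpa using hlt
      | succ j ih =>
        intro hj q hq
        obtain ⟨p, hp, hpq⟩ := hNdense j q (hNA (j + 1) hq)
        have h1 := ih (by omega) p hp
        have h2 : |signedSum σ q - signedSum σ p| ≤ ((j : ℝ) + 1) * (1 / 2) ^ j * (τ * m / 8) := by
          rw [signedSum_sub]
          by_contra hlt
          refine hcj (Finset.mem_biUnion.mpr ⟨j, Finset.mem_range.mpr (by omega), ?_⟩)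
          rw [badLink]
          refine Finset.mem_biUnion.mpr ⟨(p, q), Finset.mem_filter.mpr
            ⟨Finset.mem_product.mpr ⟨hp, hq⟩, hpq⟩, Finset.mem_filter.mpr ⟨Finset.mem_univ _, ?_⟩⟩
          exact not_le.mp hlt
        rw [Finset.sum_range_succ]
        have h3 := abs_add_le (signedSum σ q - signedSum σ p) (signedSum σ p)
        rw [sub_add_cancel] at h3
        linarith
    obtain ⟨a, ha, hlt⟩ := (Finset.mem_filter.mp hσ).2
    obtain ⟨p, hp, hpa⟩ := hNdense J a ha
    have hpa' : p = a := by
      have : (hammingDist p a : ℝ) < 1 := hpa.trans_lt hJ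
      exact hammingDist_eq_zero.mp (Nat.lt_one_iff.mp (by exact_mod_cast this))
    have h1 := key J le_rfl p hp
    rw [hpa', ← Finset.sum_mul, sum_range_succ_mul_half_pow] at h1
    have h2 : 0 ≤ (2 * J + 4) * (1 / 2 : ℝ) ^ J * (τ * m / 8) := by positivity
    linarith
  have hlinks : ∑ j ∈ Finset.range J, ((badLink N τ j).card : ℝ) ≤ 2 ^ m * (4 * z) := by
    calc _ ≤ ∑ j ∈ Finset.range J, (2 ^ m * (2 * z)) * (1 / 2) ^ j := by
          refine Finset.sum_le_sum fun j _ => (card_badLink_le hm hN hτ j).trans ?_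
          rw [pow_succ', ← hEdef, ← hy, ← hz, ← mul_assoc, ← mul_assoc, mul_assoc _ 2 z]
          gcongr
      _ = (2 ^ m * (2 * z)) * ∑ j ∈ Finset.range J, (1 / 2) ^ j := by rw [Finset.mul_sum]
      _ ≤ (2 ^ m * (2 * z)) * 2 := by gcongr; exact sum_geometric_two_le J
      _ = _ := by ring
  have h1 := (Nat.cast_le (α := ℝ)).mpr ((Finset.card_le_card hsub).trans
    ((Finset.card_union_le _ _).trans (add_le_add_right Finset.card_biUnion_le _)))
  rw [Nat.cast_add, Nat.cast_sum] at h1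
  linarith

end Chaining

section UniformConvergence

variable {W : Type*} {m : ℕ}

/-- The number of sample points that satisfy `a`. -/
def sampleSum (S : Fin m → W) (a : W → Bool) : ℝ := ∑ j, boolVal (a (S j))

theorem HasGrowth.comp {K D : ℕ} {𝒜 : Set (W → Bool)} (h : HasGrowth K D 𝒜) (S : Fin m → W) :
    HasGrowth K D ((fun a j => a (S j)) '' 𝒜) := by
  intro s w
  rw [Set.image_image]
  exact h s fun j => S (w j)

theorem card_exists_signed_sampleSum_gt_le {K D : ℕ} (hD : 0 < D) (hm : 0 < m)
    {𝒜 : Set (W → Bool)} (h𝒜 : HasGrowth K D 𝒜) {τ : ℝ} (hτ : 0 < τ)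
    (hlarge : 3 * packingConst K D + 1 ≤ τ ^ 2 * m / 128) (S : Fin m → W) :
    open Classical in
    ((Finset.univ.filter fun σ : Fin m → Bool =>
      ∃ a ∈ 𝒜, τ * m < |signedSum σ fun j => a (S j)|).card : ℝ) ≤
      2 ^ m * (6 * Real.exp (3 * packingConst K D - τ ^ 2 * m / 128)) := by
  classical
  have hfin : ((fun (a : W → Bool) j => a (S j)) '' 𝒜).Finite := Set.toFinite _
  have := card_exists_signedSum_gt_le hD hm (A := hfin.toFinset)
    (by rw [hfin.coe_toFinset]; exact h𝒜.comp S) hτ hlarge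
  refine le_trans ?_ this
  gcongr with σ
  rintro ⟨a, ha, hlt⟩
  exact ⟨_, hfin.mem_toFinset.mpr ⟨a, ha, rfl⟩, hlt⟩

/-- Exchange the two entries of a pair unless the Boolean is true. -/
def condSwap (b : Bool) (q : W × W) : W × W := if b then q else q.swap

theorem sum_condSwap (σ : Fin m → Bool) (Q : Fin m → W × W) (a : W → Bool) :
    ∑ j, (boolVal (a (condSwap (σ j) (Q j)).1) - boolVal (a (condSwap (σ j) (Q j)).2)) =
    signedSum σ (fun j => a (Q j).1) - signedSum σ (fun j => a (Q j).2) := by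
  rw [signedSum_sub]
  refine Finset.sum_congr rfl fun j _ => ?_
  cases σ j <;> simp [condSwap, boolSign]

theorem measurePreserving_condSwap [MeasurableSpace W] (P : Measure W) [SFinite P] (b : Bool) :
    MeasurePreserving (condSwap b) (P.prod P) (P.prod P) := by
  cases b
  · exact Measure.measurePreserving_swap
  · exact MeasurePreserving.id _

variable [MeasurableSpace W] [DiscreteMeasurableSpace W] [Countable W]
  (P : Measure W) [IsProbabilityMeasure P]

/-- The symmetrization bound on paired samples. -/
theorem measure_exists_paired_gt_le {K D : ℕ} (hD : 0 < D) (hm : 0 < m)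
    {𝒜 : Set (W → Bool)} (h𝒜 : HasGrowth K D 𝒜) {τ : ℝ} (hτ : 0 < τ)
    (hlarge : 3 * packingConst K D + 1 ≤ τ ^ 2 * m / 128) :
    (Measure.pi fun _ : Fin m => P.prod P) {Q | ∃ a ∈ 𝒜, 2 * (τ * m) <
      |∑ j, (boolVal (a (Q j).1) - boolVal (a (Q j).2))|} ≤
      ENNReal.ofReal (12 * Real.exp (3 * packingConst K D - τ ^ 2 * m / 128)) := by
  classical
  set ν := Measure.pi fun _ : Fin m => P.prod P with hν
  set B : Set (Fin m → W × W) := {Q | ∃ a ∈ 𝒜, 2 * (τ * m) <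
      |∑ j, (boolVal (a (Q j).1) - boolVal (a (Q j).2))|} with hB
  set c := 12 * Real.exp (3 * packingConst K D - τ ^ 2 * m / 128) with hc
  let Bσ : (Fin m → Bool) → Set (Fin m → W × W) := fun σ => {Q | ∃ a ∈ 𝒜, 2 * (τ * m) <
      |signedSum σ (fun j => a (Q j).1) - signedSum σ (fun j => a (Q j).2)|}
  have h1 : ∀ σ : Fin m → Bool, ν B = ν (Bσ σ) := by
    intro σ
    have hp : MeasurePreserving (fun (Q : Fin m → W × W) j => condSwap (σ j) (Q j)) ν ν :=
      measurePreserving_pi _ _ fun j => measurePreserving_condSwap P (σ j)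
    rw [← hp.measure_preimage (MeasurableSet.of_discrete).nullMeasurableSet]
    congr 1
    ext Q
    simp only [hB, Bσ, Set.mem_preimage, Set.mem_ofPred_eq, sum_condSwap]
  have h2 : ∀ Q : Fin m → W × W, ∑ σ, (Bσ σ).indicator (1 : (Fin m → W × W) → ℝ≥0∞) Q ≤
      ENNReal.ofReal (2 ^ m * c) := by
    intro Q
    have h3 : ∑ σ, (Bσ σ).indicator (1 : (Fin m → W × W) → ℝ≥0∞) Q =
        ((Finset.univ.filter fun σ => Q ∈ Bσ σ).card : ℝ≥0∞) := by
      rw [Finset.card_filter, Nat.cast_sum]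
      refine Finset.sum_congr rfl fun σ _ => ?_
      by_cases h : Q ∈ Bσ σ <;> simp [h]
    have h4 : (Finset.univ.filter fun σ => Q ∈ Bσ σ) ⊆
        (Finset.univ.filter fun σ : Fin m → Bool =>
          ∃ a ∈ 𝒜, τ * m < |signedSum σ fun j => a (Q j).1|) ∪
        (Finset.univ.filter fun σ : Fin m → Bool =>
          ∃ a ∈ 𝒜, τ * m < |signedSum σ fun j => a (Q j).2|) := by
      intro σ hσ
      obtain ⟨a, ha, hlt⟩ := (Finset.mem_filter.mp hσ).2
      by_contra hcon
      simp only [Finset.mem_union, Finset.mem_filter, Finset.mem_univ, true_and, not_or,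
        not_exists, not_and, not_lt] at hcon
      have h5 := hcon.1 a ha
      have h6 := hcon.2 a ha
      have h7 := abs_sub (signedSum σ fun j => a (Q j).1) (signedSum σ fun j => a (Q j).2)
      linarith
    have h5 := (Nat.cast_le (α := ℝ)).mpr
      ((Finset.card_le_card h4).trans (Finset.card_union_le _ _))
    push_cast at h5
    have h6 := card_exists_signed_sampleSum_gt_le hD hm h𝒜 hτ hlarge fun j => (Q j).1
    have h7 := card_exists_signed_sampleSum_gt_le hD hm h𝒜 hτ hlarge fun j => (Q j).2
    rw [h3, ← ENNReal.ofReal_natCast]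
    apply ENNReal.ofReal_le_ofReal
    rw [hc]
    linarith
  have h3 : (2 : ℝ≥0∞) ^ m * ν B ≤ (2 : ℝ≥0∞) ^ m * ENNReal.ofReal c := by
    calc (2 : ℝ≥0∞) ^ m * ν B = ∑ σ : Fin m → Bool, ν (Bσ σ) := by
          rw [Finset.sum_congr rfl fun σ _ => (h1 σ).symm]
          simp
      _ = ∑ σ : Fin m → Bool, ∫⁻ Q, (Bσ σ).indicator 1 Q ∂ν := by
          refine Finset.sum_congr rfl fun σ _ => ?_
          rw [lintegral_indicator_one MeasurableSet.of_discrete]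
      _ = ∫⁻ Q, ∑ σ : Fin m → Bool, (Bσ σ).indicator 1 Q ∂ν := by
          rw [lintegral_finsetSum]
          exact fun σ _ => Measurable.of_discrete
      _ ≤ ∫⁻ _, ENNReal.ofReal (2 ^ m * c) ∂ν := lintegral_mono h2
      _ = _ := by
          rw [lintegral_const, measure_univ, mul_one, ENNReal.ofReal_mul (by positivity),
            ENNReal.ofReal_pow (by norm_num), ENNReal.ofReal_ofNat]
  exact (ENNReal.mul_le_mul_iff_right (pow_ne_zero _ (by norm_num))
    (ENNReal.pow_ne_top (by norm_num))).mp h3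

/-- Chebyshev's inequality for an empirical frequency. -/
theorem half_le_measure_sampleSum (a : W → Bool) {α : ℝ} (hα : 0 < α) (hm : 0 < m)
    (hlarge : 2 ≤ α ^ 2 * m) :
    2⁻¹ ≤ (Measure.pi fun _ : Fin m => P)
      {S | |sampleSum S a - m * ∫ w, boolVal (a w) ∂P| ≤ m * α / 2} := by
  set μ := Measure.pi fun _ : Fin m => P with hμ
  have hm' : (0 : ℝ) < m := by exact_mod_cast hm
  have hIcc : ∀ w, boolVal (a w) ∈ Set.Icc (0 : ℝ) 1 := by
    intro w
    cases a w <;> simp [boolVal]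
  have hL2 : MemLp (fun w => boolVal (a w)) 2 P :=
    memLp_of_bounded (ae_of_all _ hIcc) Measurable.of_discrete.aestronglyMeasurable 2
  have hvar : ProbabilityTheory.variance (fun w => boolVal (a w)) P ≤ 1 / 4 := by
    have := ProbabilityTheory.variance_le_sq_of_bounded (μ := P) (ae_of_all _ hIcc)
      Measurable.of_discrete.aemeasurable
    norm_num at this ⊢
    exact this
  have hsum : (fun S : Fin m → W => sampleSum S a) = ∑ j, fun S : Fin m → W => boolVal (a (S j)) := by
    funext S
    simp [sampleSum]
  have hvar' : ProbabilityTheory.variance (fun S : Fin m → W => sampleSum S a) μ ≤ m / 4 := by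
    rw [hsum, ProbabilityTheory.variance_sum_pi (μ := fun _ : Fin m => P)
      (X := fun _ w => boolVal (a w)) fun _ => hL2]
    simp only [Finset.sum_const, Finset.card_univ, Fintype.card_fin, nsmul_eq_mul]
    linarith [mul_le_mul_of_nonneg_left hvar hm'.le]
  have hL2j : ∀ j : Fin m, MemLp (fun S : Fin m → W => boolVal (a (S j))) 2 μ := fun j =>
    hL2.comp_measurePreserving (measurePreserving_eval (fun _ : Fin m => P) j)
  have hL2' : MemLp (fun S : Fin m → W => sampleSum S a) 2 μ := by
    rw [hsum]
    exact memLp_finsetSum' _ fun j _ => hL2j j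
  have hmean : ∫ S, sampleSum S a ∂μ = m * ∫ w, boolVal (a w) ∂P := by
    simp only [sampleSum]
    rw [integral_finsetSum _ fun j _ => (hL2j j).integrable (by norm_num)]
    have : ∀ j : Fin m, ∫ S, boolVal (a (S j)) ∂μ = ∫ w, boolVal (a w) ∂P := by
      intro j
      rw [← (measurePreserving_eval (fun _ : Fin m => P) j).map_eq, integral_map
        Measurable.of_discrete.aemeasurable Measurable.of_discrete.aestronglyMeasurable]
    simp [this]
  have h1 := ProbabilityTheory.meas_ge_le_variance_div_sq hL2' (c := m * α / 2) (by positivity)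
  rw [hmean] at h1
  have h2 : μ {S | m * α / 2 ≤ |sampleSum S a - m * ∫ w, boolVal (a w) ∂P|} ≤ 2⁻¹ := by
    refine h1.trans ?_
    rw [show (2⁻¹ : ℝ≥0∞) = ENNReal.ofReal 2⁻¹ by
      rw [ENNReal.ofReal_inv_of_pos (by norm_num), ENNReal.ofReal_ofNat]]
    apply ENNReal.ofReal_le_ofReal
    rw [div_le_iff₀ (by positivity)]
    refine hvar'.trans ?_
    nlinarith
  have h3 : 1 ≤ μ {S | |sampleSum S a - m * ∫ w, boolVal (a w) ∂P| ≤ m * α / 2} +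
      μ {S | m * α / 2 ≤ |sampleSum S a - m * ∫ w, boolVal (a w) ∂P|} := by
    rw [← measure_univ (μ := μ)]
    refine (measure_mono fun S _ => ?_).trans (measure_union_le _ _)
    exact le_total |sampleSum S a - m * ∫ w, boolVal (a w) ∂P| (m * α / 2)
  have h4 : (2⁻¹ : ℝ≥0∞) + 2⁻¹ ≤
      μ {S | |sampleSum S a - m * ∫ w, boolVal (a w) ∂P| ≤ m * α / 2} + 2⁻¹ := by
    rw [ENNReal.inv_two_add_inv_two]
    exact h3.trans (by gcongr)
  exact (ENNReal.add_le_add_iff_right (by simp)).mp h4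

/-- Uniform convergence of empirical frequencies over a class with polynomial growth. -/
theorem measure_exists_sampleSum_gt_le {K D : ℕ} (hD : 0 < D) (hm : 0 < m)
    {𝒜 : Set (W → Bool)} (h𝒜 : HasGrowth K D 𝒜) {α : ℝ} (hα : 0 < α)
    (hlarge : 3 * packingConst K D + 1 ≤ (α / 4) ^ 2 * m / 128) :
    (Measure.pi fun _ : Fin m => P)
      {S | ∃ a ∈ 𝒜, m * α < |sampleSum S a - m * ∫ w, boolVal (a w) ∂P|} ≤
      ENNReal.ofReal (24 * Real.exp (3 * packingConst K D - (α / 4) ^ 2 * m / 128)) := by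
  set μ := Measure.pi fun _ : Fin m => P with hμ
  set B := {S : Fin m → W | ∃ a ∈ 𝒜, m * α < |sampleSum S a - m * ∫ w, boolVal (a w) ∂P|} with hB
  set B₂ : Set ((Fin m → W) × (Fin m → W)) :=
    {p | ∃ a ∈ 𝒜, 2 * (α / 4 * m) < |sampleSum p.1 a - sampleSum p.2 a|} with hB₂
  have hlarge' : 2 ≤ α ^ 2 * m := by
    have := packingConst_nonneg K D
    have h2 : (α / 4) ^ 2 * m / 128 = α ^ 2 * m / 2048 := by ring
    rw [h2] at hlarge
    linarith
  have h1 : ∀ S ∈ B, 2⁻¹ ≤ μ (Prod.mk S ⁻¹' B₂) := by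
    rintro S ⟨a, ha, hlt⟩
    refine (half_le_measure_sampleSum P a hα hm hlarge').trans (measure_mono ?_)
    intro S' hS'
    refine ⟨a, ha, ?_⟩
    have hS'' : |sampleSum S' a - m * ∫ w, boolVal (a w) ∂P| ≤ m * α / 2 := hS'
    have h3 := abs_add_le (sampleSum S a - sampleSum S' a)
      (sampleSum S' a - m * ∫ w, boolVal (a w) ∂P)
    rw [sub_add_sub_cancel] at h3
    show 2 * (α / 4 * m) < |sampleSum S a - sampleSum S' a|
    linarith
  have h2 : 2⁻¹ * μ B ≤ (μ.prod μ) B₂ := by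
    rw [Measure.prod_apply MeasurableSet.of_discrete]
    calc 2⁻¹ * μ B = ∫⁻ S, B.indicator (fun _ => 2⁻¹) S ∂μ := by
          rw [lintegral_indicator_const MeasurableSet.of_discrete]
      _ ≤ _ := lintegral_mono fun S => Set.indicator_le (fun S hS => h1 S hS) S
  have h3 : (μ.prod μ) B₂ ≤
      ENNReal.ofReal (12 * Real.exp (3 * packingConst K D - (α / 4) ^ 2 * m / 128)) := by
    rw [← (measurePreserving_arrowProdEquivProdArrow W W (Fin m) (fun _ => P)
      (fun _ => P)).measure_preimage MeasurableSet.of_discrete.nullMeasurableSet]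
    refine le_trans (measure_mono ?_)
      (measure_exists_paired_gt_le P hD hm h𝒜 (τ := α / 4) (by positivity) hlarge)
    rintro Q ⟨a, ha, hlt⟩
    refine ⟨a, ha, ?_⟩
    rw [Finset.sum_sub_distrib]
    exact hlt
  calc μ B = 2 * (2⁻¹ * μ B) := by
        rw [← mul_assoc, ENNReal.mul_inv_cancel (by norm_num) (by norm_num), one_mul]
    _ ≤ 2 * ENNReal.ofReal (12 * Real.exp (3 * packingConst K D - (α / 4) ^ 2 * m / 128)) := by
        gcongr
        exact h2.trans h3
    _ = _ := by
        rw [show (2 : ℝ≥0∞) = ENNReal.ofReal 2 by simp, ← ENNReal.ofReal_mul (by norm_num)]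
        ring_nf

/-- A subsample of an i.i.d. sample along an injection is i.i.d. -/
theorem measurePreserving_comp_injective {Z : Type*} [MeasurableSpace Z] (P : Measure Z)
    [IsProbabilityMeasure P] {n : ℕ} {e : Fin m → Fin n} (he : Function.Injective e) :
    MeasurePreserving (fun (S : Fin n → Z) j => S (e j)) (Measure.pi fun _ => P)
      (Measure.pi fun _ => P) := by
  refine ⟨by fun_prop, ?_⟩
  have h1 : ProbabilityTheory.iIndepFun (fun (i : Fin n) (S : Fin n → Z) => S i)
      (Measure.pi fun _ : Fin n => P) :=
    ProbabilityTheory.iIndepFun_pi (X := fun _ z => z) fun _ => aemeasurable_id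
  have h2 := h1.precomp he
  rw [ProbabilityTheory.iIndepFun_iff_map_fun_eq_pi_map (fun j =>
    (measurable_pi_apply (e j)).aemeasurable)] at h2
  refine h2.trans ?_
  congr 1
  funext j
  exact (measurePreserving_eval (fun _ : Fin n => P) (e j)).map_eq

end UniformConvergence

section SampleSize

theorem log_one_add_le_two_mul_sqrt {x : ℝ} (hx : 0 ≤ x) : Real.log (1 + x) ≤ 2 * Real.sqrt x := by
  have h0 := Real.sqrt_nonneg x
  have h1 : 1 + x ≤ (1 + Real.sqrt x) ^ 2 := by
    nlinarith [Real.sq_sqrt hx]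
  calc Real.log (1 + x) ≤ Real.log ((1 + Real.sqrt x) ^ 2) := Real.log_le_log (by linarith) h1
    _ = 2 * Real.log (1 + Real.sqrt x) := by rw [Real.log_pow]; norm_num
    _ ≤ 2 * Real.sqrt x := by
      have := Real.log_le_sub_one_of_pos (show 0 < 1 + Real.sqrt x by linarith)
      linarith

theorem half_le_log_one_div {β δ : ℝ} (hβ : β ∈ Set.Ioo (0 : ℝ) (1 / 2))
    (hδ : δ ∈ Set.Ioo (0 : ℝ) 1) : 1 / 2 ≤ Real.log (1 / (β * δ)) := by
  have h1 : (2 : ℝ) ≤ 1 / (β * δ) := by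
    rw [le_div_iff₀ (mul_pos hβ.1 hδ.1)]
    nlinarith [hβ.1, hβ.2, hδ.1, hδ.2]
  have h2 := Real.log_le_log (by norm_num) h1
  have h3 := Real.log_two_gt_d9
  linarith

theorem log_one_div_le_log_one_div_mul {β δ : ℝ} (hβ : β ∈ Set.Ioo (0 : ℝ) (1 / 2))
    (hδ : δ ∈ Set.Ioo (0 : ℝ) 1) : Real.log (1 / β) ≤ Real.log (1 / (β * δ)) := by
  apply Real.log_le_log (by have := hβ.1; positivity)
  apply one_div_le_one_div_of_le (mul_pos hβ.1 hδ.1)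
  nlinarith [hβ.1, hδ.2]

theorem one_add_pow_mul_exp_le {d K m : ℕ} {α β : ℝ} (hα : 0 < α) (hβ : 0 < β)
    (h2 : 256 * d ^ 2 * K ≤ m * α ^ 2) (h3 : Real.log (4 / β) ≤ m * α / 8) :
    (1 + K * m : ℝ) ^ d * Real.exp (-(m * α / 4)) ≤ β / 4 := by
  have h1 : Real.log (1 + K * m) ≤ 2 * Real.sqrt (K * m) :=
    log_one_add_le_two_mul_sqrt (by positivity)
  have h4 : 16 * d * Real.sqrt (K * m) ≤ m * α := by
    rw [← pow_le_pow_iff_left₀ (by positivity) (by positivity) two_ne_zero, mul_pow,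
      Real.sq_sqrt (by positivity)]
    calc (16 * (d : ℝ)) ^ 2 * (K * m) = (256 * d ^ 2 * K) * m := by ring
      _ ≤ m * α ^ 2 * m := by gcongr
      _ = (m * α) ^ 2 := by ring
  have h5 : (d : ℝ) * Real.log (1 + K * m) ≤ d * (2 * Real.sqrt (K * m)) := by gcongr
  have h6 : (1 + K * m : ℝ) ^ d = Real.exp (d * Real.log (1 + K * m)) := by
    rw [Real.exp_nat_mul, Real.exp_log (by positivity)]
  rw [h6, ← Real.exp_add]
  calc Real.exp (d * Real.log (1 + K * m) + -(m * α / 4)) ≤ Real.exp (-Real.log (4 / β)) := by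
        apply Real.exp_le_exp.mpr
        linarith
    _ = β / 4 := by
        rw [← Real.log_inv, Real.exp_log (by positivity), inv_div]

theorem exp_neg_five_le : Real.exp (-5) ≤ 1 / 48 := by
  rw [Real.exp_neg, one_div]
  apply inv_anti₀ (by norm_num)
  have h3 : (2.7 : ℝ) ≤ Real.exp 1 := by linarith [Real.exp_one_gt_d9]
  calc (48 : ℝ) ≤ 2.7 ^ 5 := by norm_num
    _ ≤ Real.exp 1 ^ 5 := by gcongr
    _ = Real.exp 5 := by rw [← Real.exp_nat_mul]; norm_num

theorem exists_block_length {R α T θ N Y : ℝ} (hR : 0 < R) (hα : 0 < α) (hα1 : α ≤ 1)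
    (hT : 0 < T) (hθ : 0 < θ) (hN : 0 ≤ N) (hY : Y * (T * (4 * R + 1)) / θ ≤ N * α) :
    ∃ l : ℕ, 0 < l ∧ N * (R / l) ≤ N * α / 4 ∧ Y ≤ N / (T * l) * θ := by
  have h1 : 4 * R / α ≤ ⌈4 * R / α⌉₊ := Nat.le_ceil _
  have h2 : (0 : ℝ) < ⌈4 * R / α⌉₊ := lt_of_lt_of_le (by positivity) h1
  have h3 : (⌈4 * R / α⌉₊ : ℝ) ≤ (4 * R + 1) / α := by
    refine (Nat.ceil_lt_add_one (by positivity)).le.trans ?_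
    rw [add_div]
    gcongr
    rw [le_div_iff₀ hα]
    linarith
  refine ⟨⌈4 * R / α⌉₊, by exact_mod_cast h2, ?_, ?_⟩
  · have h4 : R / ⌈4 * R / α⌉₊ ≤ α / 4 := by
      rw [div_le_iff₀ h2]
      rw [div_le_iff₀ hα] at h1
      linarith
    calc N * (R / ⌈4 * R / α⌉₊) ≤ N * (α / 4) := by gcongr
      _ = N * α / 4 := by ring
  · generalize (⌈4 * R / α⌉₊ : ℝ) = l at h2 h3
    rw [div_le_iff₀ hθ] at hY
    calc Y ≤ N * α * θ / (T * (4 * R + 1)) := by rwa [le_div_iff₀ (by positivity)]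
      _ = N / (T * ((4 * R + 1) / α)) * θ := by
          rw [← mul_div_assoc, div_div_eq_mul_div]
          ring
      _ ≤ N / (T * l) * θ := by gcongr

/-- The numerical conditions on the sample size all follow from `m ≥ C log (1 / (βδ)) / α²`. -/
theorem exists_sample_size_const (d K : ℕ) (hK : 0 < K) {θ E : ℝ} (hθ : 0 < θ) (hθ1 : θ < 1)
    (hE : 0 ≤ E) : ∃ C : ℝ, 0 < C ∧ ∀ α β δ : ℝ, α ∈ Set.Ioo (0 : ℝ) (1 / 2) →
      β ∈ Set.Ioo (0 : ℝ) (1 / 2) → δ ∈ Set.Ioo (0 : ℝ) 1 → ∀ m : ℕ,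
      C * (Real.log (1 / (β * δ)) / α ^ 2) ≤ m →
      0 < m ∧ 3 * E + 1 ≤ (α / 4 / 4) ^ 2 * m / 128 ∧
      24 * Real.exp (3 * E - (α / 4 / 4) ^ 2 * m / 128) ≤ β / 2 ∧
      (1 + K * m : ℝ) ^ d * Real.exp (-(m * α / 4)) ≤ β / 4 ∧
      ∃ l : ℕ, 0 < l ∧ m * (Real.log (1 / θ) / l) ≤ m * α / 4 ∧
        Real.log (4 / (θ * (β / 4 * (δ / (9 * K ^ 2))))) ≤ m / (2 ^ (d + 1) * l) * θ := by
  have hK' : (1 : ℝ) ≤ K := by exact_mod_cast hK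
  set R := Real.log (1 / θ) with hR
  have hR0 : 0 < R := Real.log_pos (by rw [lt_div_iff₀ hθ]; linarith)
  set Q := Real.log (144 * K ^ 2 / θ) with hQ
  have hQ0 : 0 ≤ Q := Real.log_nonneg (by
    rw [le_div_iff₀ hθ]; nlinarith)
  set C₁ := 32768 * (2 * (3 * E + 5) + 1) with hC₁
  set C₂ : ℝ := 512 * d ^ 2 * K with hC₂
  set C₃ := (2 * Q + 1) * (2 ^ (d + 1) * (4 * R + 1)) / θ with hC₃
  have hC₁0 : 0 < C₁ := by positivity
  have hC₂0 : 0 ≤ C₂ := by positivity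
  have hC₃0 : 0 < C₃ := by positivity
  refine ⟨C₁ + C₂ + C₃, by positivity, ?_⟩
  intro α β δ hα hβ hδ m hm
  have hα0 := hα.1
  have hα1 : α ≤ 1 := by linarith [hα.2]
  have hβ0 := hβ.1
  have hδ0 := hδ.1
  have hL := half_le_log_one_div hβ hδ
  have hLβ := log_one_div_le_log_one_div_mul hβ hδ
  set L := Real.log (1 / (β * δ)) with hLdef
  rw [← mul_div_assoc, div_le_iff₀ (by positivity)] at hm
  have hm1 : C₁ * L ≤ m * α ^ 2 := by nlinarith
  have hm2 : C₂ * L ≤ m * α ^ 2 := by nlinarith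
  have hm3 : C₃ * L ≤ m * α ^ 2 := by nlinarith
  have hm0 : 0 < (m : ℝ) := by
    have h1 : 0 < C₁ * L := by nlinarith
    by_contra h
    have h2 : (m : ℝ) * α ^ 2 ≤ 0 := mul_nonpos_of_nonpos_of_nonneg (not_lt.mp h) (by positivity)
    linarith
  have hmα : m * α ^ 2 ≤ m * α := by
    rw [sq]
    gcongr
    exact mul_le_of_le_one_left hα0.le hα1
  have h16 : (α / 4 / 4) ^ 2 * m / 128 = m * α ^ 2 / 32768 := by ring
  have hkey : 3 * E + 5 + L ≤ m * α ^ 2 / 32768 := by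
    rw [le_div_iff₀ (by norm_num)]
    refine le_trans ?_ hm1
    rw [hC₁]
    nlinarith
  have hlog1 : Real.log (1 / β) = -Real.log β := by rw [one_div, Real.log_inv]
  refine ⟨by exact_mod_cast hm0, by rw [h16]; linarith, ?_, ?_, ?_⟩
  · rw [h16]
    have h1 : Real.exp (3 * E - m * α ^ 2 / 32768) ≤ Real.exp (-5) * β := by
      rw [← Real.exp_log hβ0, ← Real.exp_add]
      apply Real.exp_le_exp.mpr
      linarith
    have h2 : Real.exp (-5) * β ≤ 1 / 48 * β := by
      gcongr
      exact exp_neg_five_le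
    linarith
  · refine one_add_pow_mul_exp_le hα0 hβ0 ?_ ?_
    · have h3 : C₂ * (1 / 2) ≤ C₂ * L := by gcongr
      rw [hC₂] at h3 hm2
      linarith
    · have h4 : Real.log 4 ≤ 2 := by
        rw [show (4 : ℝ) = 2 ^ 2 by norm_num, Real.log_pow]
        have := Real.log_two_lt_d9
        push_cast; linarith
      rw [Real.log_div (by norm_num) hβ0.ne']
      have : m * α ^ 2 / 32768 ≤ m * α / 8 := by linarith [mul_pos hm0 hα0]
      linarith
  · refine exists_block_length hR0 hα0 hα1 (by positivity) hθ hm0.le (le_trans ?_ (hm3.trans hmα))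
    have h3 : Real.log (4 / (θ * (β / 4 * (δ / (9 * K ^ 2))))) = Q + L := by
      rw [hQ, hLdef, ← Real.log_mul (by positivity) (by positivity)]
      congr 1
      field_simp
      ring
    have h4 : Q + L ≤ (2 * Q + 1) * L := by nlinarith
    rw [h3, hC₃]
    calc (Q + L) * (2 ^ (d + 1) * (4 * R + 1)) / θ
        ≤ ((2 * Q + 1) * L) * (2 ^ (d + 1) * (4 * R + 1)) / θ := by gcongr
      _ = _ := by ring

end SampleSize

section CountableLearner

universe u v

theorem PMF.toOuterMeasure_univ {α : Type*} (p : PMF α) : p.toOuterMeasure Set.univ = 1 := by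
  rw [PMF.toOuterMeasure_apply, Set.indicator_univ, p.tsum_coe]

theorem PMF.one_sub_le_of_compl_le {α : Type*} {p : PMF α} {s : Set α} {c : ℝ} (hc : 0 ≤ c)
    (h : p.toOuterMeasure sᶜ ≤ ENNReal.ofReal c) :
    ENNReal.ofReal (1 - c) ≤ p.toOuterMeasure s := by
  rw [ENNReal.ofReal_sub _ hc, ENNReal.ofReal_one, tsub_le_iff_right]
  calc 1 = p.toOuterMeasure (s ∪ sᶜ) := by rw [Set.union_compl_self, p.toOuterMeasure_univ]
    _ ≤ p.toOuterMeasure s + p.toOuterMeasure sᶜ := measure_union_le _ _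
    _ ≤ _ := by gcongr

/-- The error indicator of a hypothesis on labelled points. -/
def errBool {X W : Type*} {K : ℕ} (ι : W → X × Fin K) (f : X → Fin K) (w : W) : Bool :=
  decide (f (ι w).1 ≠ (ι w).2)

theorem sampleSum_errBool {X W : Type*} {K m : ℕ} (ι : W → X × Fin K) (f : X → Fin K)
    (S : Fin m → W) : sampleSum S (errBool ι f) = sampleErr (fun j => ι (S j)) f := by
  rw [sampleSum, sampleErr, Finset.card_filter, Nat.cast_sum]
  refine Finset.sum_congr rfl fun j _ => ?_
  by_cases h : f (ι (S j)).1 = (ι (S j)).2 <;> simp [errBool, boolVal, h]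

theorem integral_errBool {X W : Type*} {K : ℕ} [MeasurableSpace W] [DiscreteMeasurableSpace W]
    (P : Measure W) [IsProbabilityMeasure P] (ι : W → X × Fin K) (f : X → Fin K) :
    P {w | f (ι w).1 ≠ (ι w).2} = ENNReal.ofReal (∫ w, boolVal (errBool ι f w) ∂P) := by
  have h1 : (fun w => boolVal (errBool ι f w)) =
      Set.indicator {w | f (ι w).1 ≠ (ι w).2} (fun _ => (1 : ℝ)) := by
    funext w
    by_cases h : f (ι w).1 = (ι w).2 <;> simp [errBool, boolVal, Set.indicator, h]
  rw [h1, integral_indicator_const _ MeasurableSet.of_discrete, smul_eq_mul, mul_one,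
    ofReal_measureReal]

theorem hasGrowth_errBool {X W : Type*} {K d : ℕ} {F : Set (X → Fin K)} (hF : ¬ LDeep (d + 1) F)
    (ι : W → X × Fin K) : HasGrowth K (d + 1) (errBool ι '' F) := by
  intro s w
  have h1 : (fun (a : W → Bool) j => a (w j)) '' (errBool ι '' F) =
      (fun (p : Fin s → Fin K) j => decide (p j ≠ (ι (w j)).2)) ''
        patterns F (fun j => (ι (w j)).1) := by
    rw [patterns, Set.image_image, Set.image_image]
    rfl
  rw [h1]
  refine (Set.ncard_image_le (Set.toFinite _)).trans ((ncard_patterns_le hF _).trans ?_)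
  exact Nat.pow_le_pow_right (by omega) (by omega)

/-- The hypotheses whose loss exceeds the losses of all members of `H` by at most `α`. -/
def nearOptimal {X W : Type*} {K : ℕ} [MeasurableSpace W] (P : Measure W) (ι : W → X × Fin K)
    (H : Set (X → Fin K)) (α : ℝ) : Set (X → Fin K) :=
  {f | ∀ h ∈ H, P {w | f (ι w).1 ≠ (ι w).2} ≤ P {w | h (ι w).1 ≠ (ι w).2} + ENNReal.ofReal α}

theorem exists_constant_privacy_learner (d K : ℕ) [NeZero K] : ∃ C : ℝ, 0 < C ∧
    ∀ (X : Type u) (H : Set (X → Fin K)), ¬ LDeep (d + 1) H → H.Nonempty →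
      ∀ α β δ : ℝ, α ∈ Set.Ioo (0 : ℝ) (1 / 2) → β ∈ Set.Ioo (0 : ℝ) (1 / 2) →
        δ ∈ Set.Ioo (0 : ℝ) 1 → ∀ m : ℕ, C * (Real.log (1 / (β * δ)) / α ^ 2) ≤ m →
        ∃ A : (Fin m → X × Fin K) → PMF (X → Fin K),
          (∀ (S S' : Fin m → X × Fin K) (i : Fin m), (∀ j, j ≠ i → S j = S' j) →
            PMF.Indist (9 * K ^ 2 * 18) (ENNReal.ofReal δ) (A S) (A S')) ∧
          ∀ (W : Type v) [MeasurableSpace W] [DiscreteMeasurableSpace W] [Countable W]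
            (P : Measure W) [IsProbabilityMeasure P] (ι : W → X × Fin K),
            ENNReal.ofReal (1 - β) ≤ ∫⁻ S, (A fun j => ι (S j)).toOuterMeasure
              (nearOptimal P ι H α) ∂(Measure.pi fun _ : Fin m => P) := by
  have hKpos : 0 < K := NeZero.pos K
  have hK : (1 : ℝ) ≤ K := by exact_mod_cast hKpos
  obtain ⟨C, hC, hsize⟩ := exists_sample_size_const d K hKpos (stableThreshold_pos (K := K) d)
    (stableThreshold_lt_one d) (packingConst_nonneg K (d + 1))
  refine ⟨C, hC, fun X H hH hne α β δ hα hβ hδ m hm => ?_⟩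
  obtain ⟨hm0, huc, hucβ, hexp, l, hl, hlα, hlarge⟩ := hsize α β δ hα hβ hδ m hm
  have : NeZero m := ⟨hm0.ne'⟩
  have hα0 := hα.1
  have hβ0 := hβ.1
  have hδ0 := hδ.1
  have hδ' : δ / (9 * K ^ 2) < 1 := by
    rw [div_lt_one (by positivity)]
    nlinarith [hδ.2]
  obtain ⟨A, hA1, hA2⟩ := exists_agnostic_empirical_learner hH hne hl
    (δ := δ / (9 * K ^ 2)) (β := β / 4) (by positivity) hδ' (by positivity)
    (by linarith [hβ.2]) hlarge
  refine ⟨A, fun S S' i hS => ?_, ?_⟩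
  · have h1 : 9 * (K : ℝ≥0∞) ^ 2 * ENNReal.ofReal (δ / (9 * K ^ 2)) = ENNReal.ofReal δ := by
      rw [show 9 * (K : ℝ≥0∞) ^ 2 = ENNReal.ofReal (9 * K ^ 2) by
        rw [ENNReal.ofReal_mul (by norm_num), ENNReal.ofReal_pow (by positivity),
          ENNReal.ofReal_natCast, ENNReal.ofReal_ofNat], ← ENNReal.ofReal_mul (by positivity)]
      congr 1
      field_simp
    rw [← h1]
    exact hA1 S S' i hS
  · intro W _ _ _ P _ ι
    set F := localClosure (d + 1) H with hF
    have hFd : ¬ LDeep (d + 1) F := fun h => hH h.of_localClosure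
    set μ := Measure.pi fun _ : Fin m => P with hμ
    set B := {S : Fin m → W | ∃ a ∈ errBool ι '' F,
      m * (α / 4) < |sampleSum S a - m * ∫ w, boolVal (a w) ∂P|} with hB
    have hμB : μ B ≤ ENNReal.ofReal (β / 2) :=
      (measure_exists_sampleSum_gt_le P (Nat.succ_pos d) hm0 (hasGrowth_errBool hFd ι)
        (α := α / 4) (by positivity) huc).trans (ENNReal.ofReal_le_ofReal hucβ)
    have hμBc : ENNReal.ofReal (1 - β / 2) ≤ μ Bᶜ := by
      rw [prob_compl_eq_one_sub MeasurableSet.of_discrete, ENNReal.ofReal_sub _ (by positivity),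
        ENNReal.ofReal_one]
      exact tsub_le_tsub_left hμB 1
    have hmR : (0 : ℝ) < m := by exact_mod_cast hm0
    have hgood : ∀ S ∈ Bᶜ, ENNReal.ofReal (1 - β / 2) ≤
        (A fun j => ι (S j)).toOuterMeasure (nearOptimal P ι H α) := by
      intro S hS
      have hdev : ∀ f ∈ F, |(sampleErr (fun j => ι (S j)) f : ℝ) -
          m * ∫ w, boolVal (errBool ι f w) ∂P| ≤ m * (α / 4) := by
        intro f hf
        rw [← sampleSum_errBool]
        by_contra hcon
        exact hS ⟨_, ⟨f, hf, rfl⟩, not_le.mp hcon⟩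
      apply PMF.one_sub_le_of_compl_le (by positivity)
      refine le_trans (measure_mono ?_) ((hA2 (fun j => ι (S j)) (m * α / 4)).trans ?_)
      · intro f hf hcon
        refine hf fun h hh => ?_
        rw [integral_errBool, integral_errBool, ← ENNReal.ofReal_add
          (integral_nonneg fun w => by unfold boolVal; split_ifs <;> norm_num) hα0.le]
        apply ENNReal.ofReal_le_ofReal
        have h1 := abs_le.mp (hdev f hcon.1)
        have h2 := abs_le.mp (hdev h (subset_localClosure _ _ hh))
        have h3 := hcon.2 h hh
        refine le_of_mul_le_mul_left ?_ hmR
        linarith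
      · rw [← ENNReal.ofReal_add (by positivity) (by positivity)]
        apply ENNReal.ofReal_le_ofReal
        linarith
    calc ENNReal.ofReal (1 - β) ≤ ENNReal.ofReal (1 - β / 2) * ENNReal.ofReal (1 - β / 2) := by
          rw [← ENNReal.ofReal_mul (by linarith [hβ.2])]
          apply ENNReal.ofReal_le_ofReal
          nlinarith
      _ ≤ ENNReal.ofReal (1 - β / 2) * μ Bᶜ := by gcongr
      _ = ∫⁻ S, Bᶜ.indicator (fun _ => ENNReal.ofReal (1 - β / 2)) S ∂μ := by
          rw [lintegral_indicator_const MeasurableSet.of_discrete]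
      _ ≤ _ := lintegral_mono fun S => Set.indicator_le (fun S hS => hgood S hS) S

/-- The agnostic private learner, for distributions on a countable discrete space. -/
theorem exists_private_learner (d K : ℕ) [NeZero K] : ∃ C : ℝ, 0 < C ∧
    ∀ (X : Type u) (H : Set (X → Fin K)), ¬ LDeep (d + 1) H → H.Nonempty →
      ∀ ε δ α β : ℝ, ε ∈ Set.Ioo (0 : ℝ) 1 → δ ∈ Set.Ioo (0 : ℝ) 1 →
        α ∈ Set.Ioo (0 : ℝ) (1 / 2) → β ∈ Set.Ioo (0 : ℝ) (1 / 2) →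
        ∀ n : ℕ, C * (Real.log (1 / (β * δ)) / (α ^ 2 * ε)) ≤ n →
        ∃ A : Learner X K n,
          (∀ (S S' : Fin n → X × Fin K) (i : Fin n), (∀ j, j ≠ i → S j = S' j) →
            PMF.Indist (ENNReal.ofReal (Real.exp ε)) (ENNReal.ofReal δ) (A S) (A S')) ∧
          ∀ (W : Type v) [MeasurableSpace W] [DiscreteMeasurableSpace W] [Countable W]
            (P : Measure W) [IsProbabilityMeasure P] (ι : W → X × Fin K),
            ENNReal.ofReal (1 - β) ≤ ∫⁻ S, (A fun j => ι (S j)).toOuterMeasure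
              (nearOptimal P ι H α) ∂(Measure.pi fun _ : Fin n => P) := by
  obtain ⟨C, hC, hlearn⟩ := exists_constant_privacy_learner.{u, v} d K
  have hK : (1 : ℝ) ≤ K := by exact_mod_cast (NeZero.pos K : 0 < K)
  set M : ℝ := 9 * K ^ 2 * 18 with hM
  have hM0 : 0 < M := by positivity
  refine ⟨(M + 1) * (C + 2), by positivity, ?_⟩
  intro X H hH hne ε δ α β hε hδ hα hβ n hn
  have hε0 := hε.1
  have hα0 := hα.1
  have hL := half_le_log_one_div hβ hδ
  set L := Real.log (1 / (β * δ)) with hLdef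
  set b := ⌈M / ε⌉₊ with hb
  have hb1 : M / ε ≤ b := Nat.le_ceil _
  have hb0 : (0 : ℝ) < b := lt_of_lt_of_le (by positivity) hb1
  have : NeZero b := ⟨by rintro h; rw [h] at hb0; simp at hb0⟩
  have hb2 : (b : ℝ) ≤ (M + 1) / ε := by
    refine (Nat.ceil_lt_add_one (by positivity)).le.trans ?_
    rw [add_div]
    gcongr
    rw [le_div_iff₀ hε0]
    linarith [hε.2]
  set m := n / b with hm
  have hmb : m * b ≤ n := Nat.div_mul_le_self n b
  have hmC : C * (L / α ^ 2) ≤ m := by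
    have h1 : (n : ℝ) < (m + 1) * b := by
      exact_mod_cast Nat.lt_mul_of_div_lt (Nat.lt_succ_self (n / b)) (NeZero.pos b)
    have h2 : (C + 2) * (L / α ^ 2) * b ≤ n := by
      refine le_trans ?_ hn
      calc (C + 2) * (L / α ^ 2) * b ≤ (C + 2) * (L / α ^ 2) * ((M + 1) / ε) := by gcongr
        _ = (M + 1) * (C + 2) * (L / (α ^ 2 * ε)) := by
            rw [← div_div]; ring
    have h3 : (C + 2) * (L / α ^ 2) < m + 1 := by
      by_contra hcon
      have := mul_le_mul_of_nonneg_right (not_lt.mp hcon) hb0.le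
      linarith
    have h4 : 1 / 2 ≤ L / α ^ 2 := by
      rw [le_div_iff₀ (by positivity)]
      nlinarith [hα.2]
    linarith
  obtain ⟨A, hA1, hA2⟩ := hlearn X H hH hne α β δ hα hβ hδ m hmC
  obtain ⟨e, he⟩ := exists_block_index hmb
  refine ⟨subsample e A, fun S S' i hS T => ?_, ?_⟩
  · refine (indist_subsample he hA1 hS T).trans ?_
    gcongr
    calc 1 + 9 * (K : ℝ≥0∞) ^ 2 * 18 / b = ENNReal.ofReal (1 + M / b) := by
          rw [ENNReal.ofReal_add (by norm_num) (by positivity), ENNReal.ofReal_one,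
            ENNReal.ofReal_div_of_pos hb0, ENNReal.ofReal_natCast, hM,
            ENNReal.ofReal_mul (by positivity), ENNReal.ofReal_mul (by norm_num),
            ENNReal.ofReal_pow (by positivity), ENNReal.ofReal_natCast, ENNReal.ofReal_ofNat,
            ENNReal.ofReal_ofNat]
      _ ≤ ENNReal.ofReal (Real.exp ε) := by
          apply ENNReal.ofReal_le_ofReal
          have h1 : M / b ≤ ε := by
            rw [div_le_iff₀ hb0]
            rw [div_le_iff₀ hε0] at hb1
            linarith
          linarith [Real.add_one_le_exp ε]
  · intro W _ _ _ P _ ι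
    have h1 : ∀ σ : Fin m → Fin b, ENNReal.ofReal (1 - β) ≤
        ∫⁻ S, (A fun j => ι (S (e (j, σ j)))).toOuterMeasure (nearOptimal P ι H α)
          ∂(Measure.pi fun _ : Fin n => P) := by
      intro σ
      have hinj : Function.Injective fun j => e (j, σ j) := fun j j' h => by
        have := he h
        simp only [Prod.mk.injEq] at this
        exact this.1
      have h2 := (measurePreserving_comp_injective P hinj).lintegral_comp
        (f := fun S => (A fun j => ι (S j)).toOuterMeasure (nearOptimal P ι H α))
        Measurable.of_discrete
      rw [h2]
      exact hA2 W P ι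
    simp only [subsample_toOuterMeasure]
    rw [lintegral_const_mul _ Measurable.of_discrete, lintegral_finsetSum _
      fun σ _ => Measurable.of_discrete]
    have h2 : ((b : ℝ≥0∞) ^ m) * ENNReal.ofReal (1 - β) ≤ ∑ σ : Fin m → Fin b,
        ∫⁻ S, (A fun j => ι (S (e (j, σ j)))).toOuterMeasure (nearOptimal P ι H α)
          ∂(Measure.pi fun _ : Fin n => P) := by
      refine le_trans (le_of_eq ?_) (Finset.sum_le_sum fun σ _ => h1 σ)
      simp
    have hb3 : (b : ℝ≥0∞) ^ m ≠ 0 := pow_ne_zero _ (by simp [NeZero.ne b])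
    have hb4 : (b : ℝ≥0∞) ^ m ≠ ∞ := ENNReal.pow_ne_top (by simp)
    calc ENNReal.ofReal (1 - β) = ((b : ℝ≥0∞) ^ m)⁻¹ * (((b : ℝ≥0∞) ^ m) * ENNReal.ofReal (1 - β)) := by
          rw [← mul_assoc, ENNReal.inv_mul_cancel hb3 hb4, one_mul]
      _ ≤ _ := by gcongr

end CountableLearner

section DoobSeparable

universe u

variable {X : Type u} {K : ℕ}

/-- Points are equivalent when no member of `H` separates them. -/
def typeSetoid (H : Set (X → Fin K)) : Setoid X where
  r x y := ∀ h ∈ H, h x = h y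
  iseqv := ⟨fun _ _ _ => rfl, fun h g hg => (h g hg).symm, fun h₁ h₂ g hg => (h₁ g hg).trans (h₂ g hg)⟩

/-- A representative of the class of points that `H` does not separate from `x`. -/
noncomputable def canonPoint (H : Set (X → Fin K)) (x : X) : X :=
  (Quotient.mk (typeSetoid H) x).out

theorem apply_canonPoint {H : Set (X → Fin K)} {h : X → Fin K} (hh : h ∈ H) (x : X) :
    h (canonPoint H x) = h x :=
  (Quotient.exact (s := typeSetoid H) (Quotient.out_eq (Quotient.mk (typeSetoid H) x))) h hh

theorem canonPoint_eq {H : Set (X → Fin K)} {x y : X} (h : ∀ g ∈ H, g x = g y) :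
    canonPoint H x = canonPoint H y := by
  rw [canonPoint, canonPoint, Quotient.sound (s := typeSetoid H) h]

/-- Up to a null set, a separable class of finite depth sees only countably many kinds of
points, in a measurable way. -/
theorem exists_countable_factor [MeasurableSpace X] {H : Set (X → Fin K)}
    (hmeas : ∀ h ∈ H, Measurable h) {d : ℕ} (hH : ¬ LDeep d H) (μ : Measure X)
    [IsProbabilityMeasure μ] (hsep : DoobSeparable H μ) :
    ∃ (R : Type u) (_ : MeasurableSpace R) (_ : DiscreteMeasurableSpace R) (_ : Countable R)
      (θ : X → R) (ρ : R → X), Measurable θ ∧ ∀ᵐ x ∂μ, ρ (θ x) = canonPoint H x := by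
  classical
  obtain ⟨H₀, hH₀, hcount, N, hN, hlim⟩ := hsep
  have : Countable H₀ := hcount
  set N' := toMeasurable μ N with hN'
  have hN'0 : μ N' = 0 := by rw [hN', measure_toMeasurable, hN]
  have hN'm : MeasurableSet N' := measurableSet_toMeasurable μ N
  have hagree : ∀ x ∉ N', ∀ y ∉ N', (∀ h ∈ H₀, h x = h y) → ∀ h ∈ H, h x = h y := by
    intro x hx y hy hxy h hh
    obtain ⟨g, hg, hconv⟩ := hlim h hh
    obtain ⟨j, hj1, hj2⟩ := ((hconv x fun h => hx (subset_toMeasurable μ N h)).and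
      (hconv y fun h => hy (subset_toMeasurable μ N h))).exists
    rw [← hj1, ← hj2, hxy _ (hg j)]
  have htypes : (Set.range fun (x : X) (h : H₀) => (h : X → Fin K) x).Countable :=
    countable_range_of_not_lDeep (fun h : H₀ => (h : X → Fin K)) (d := d)
      fun h => hH (h.mono (by rintro _ ⟨g, rfl⟩; exact hH₀ g.2))
  set R := canonPoint H '' N'ᶜ with hR
  have hRc : R.Countable := by
    refine Set.MapsTo.countable_of_injOn (f := fun (x : X) (h : H₀) => (h : X → Fin K) x)
      (fun x _ => Set.mem_range_self x) ?_ htypes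
    rintro _ ⟨x, hx, rfl⟩ _ ⟨y, hy, rfl⟩ hxy
    refine canonPoint_eq (hagree x hx y hy fun h hh => ?_)
    have := congrFun hxy ⟨h, hh⟩
    simpa [apply_canonPoint (hH₀ hh)] using this
  obtain ⟨x₀, hx₀⟩ : (N'ᶜ).Nonempty := by
    by_contra hcon
    rw [Set.not_nonempty_iff_eq_empty, Set.compl_empty_iff] at hcon
    rw [hcon, measure_univ] at hN'0
    exact one_ne_zero hN'0
  let θ : X → R := fun x => if hx : x ∈ N' then ⟨canonPoint H x₀, x₀, hx₀, rfl⟩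
    else ⟨canonPoint H x, x, hx, rfl⟩
  have hRcount : Countable R := hRc
  refine ⟨R, ⊤, @DiscreteMeasurableSpace.mk R ⊤ fun _ => trivial, hRcount, θ, fun r => r, ?_, ?_⟩
  · intro s _
    rw [← Set.biUnion_preimage_singleton]
    refine MeasurableSet.biUnion s.to_countable fun r _ => ?_
    obtain ⟨_, y, hy, rfl⟩ := r
    have hset : θ ⁻¹' {⟨canonPoint H y, y, hy, rfl⟩} =
        (N'ᶜ ∩ ⋂ h ∈ H₀, {x | h x = h y}) ∪
        (N' ∩ {_x | canonPoint H x₀ = canonPoint H y}) := by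
      ext x
      by_cases hx : x ∈ N'
      · simp [θ, hx, Subtype.ext_iff]
      · simp only [θ, hx, Set.mem_preimage, Set.mem_singleton_iff, dif_neg, not_false_eq_true,
          Set.mem_union, Set.mem_inter_iff, Set.mem_compl_iff, true_and,
          false_and, or_false, Set.mem_iInter, Set.mem_ofPred_eq]
        constructor
        · intro h g hg
          rw [← apply_canonPoint (hH₀ hg) x, ← apply_canonPoint (hH₀ hg) y]
          exact congrArg g (congrArg Subtype.val h)
        · exact fun h => Subtype.ext (canonPoint_eq (hagree x hx y hy h))
    rw [hset]
    refine (hN'm.compl.inter (MeasurableSet.biInter hcount fun h hh => ?_)).union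
      (hN'm.inter (MeasurableSet.const _))
    exact hmeas h (hH₀ hh) (measurableSet_singleton (h y))
  · filter_upwards [measure_eq_zero_iff_ae_notMem.mp hN'0] with x hx
    simp [θ, hx]

theorem popLoss_comp_canonPoint [MeasurableSpace X] {H : Set (X → Fin K)} {h : X → Fin K}
    (hh : h ∈ H) (D : Measure (X × Fin K)) : popLoss D (h ∘ canonPoint H) = popLoss D h := by
  rw [popLoss, popLoss]
  simp only [Function.comp_apply, apply_canonPoint hh]

/-- Run a learner on representatives, and evaluate its output on representatives. -/
noncomputable def canonLearner {n : ℕ} (H : Set (X → Fin K)) (A : Learner X K n) :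
    Learner X K n :=
  fun S => (A fun j => (canonPoint H (S j).1, (S j).2)).map fun f => f ∘ canonPoint H

theorem isDP_canonLearner {n : ℕ} {H : Set (X → Fin K)} {A : Learner X K n} {ε δ : ℝ}
    (hA : ∀ (S S' : Fin n → X × Fin K) (i : Fin n), (∀ j, j ≠ i → S j = S' j) →
      PMF.Indist (ENNReal.ofReal (Real.exp ε)) (ENNReal.ofReal δ) (A S) (A S')) :
    IsDP ε δ (canonLearner H A) := by
  rintro S S' ⟨i, -, hi⟩ T
  rw [canonLearner, canonLearner, PMF.toOuterMeasure_map_apply, PMF.toOuterMeasure_map_apply]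
  refine hA _ _ i (fun j hj => ?_) _
  have : S j = S' j := by
    by_contra h
    exact hj (hi j h)
  simp only [this]

theorem le_outputProb_canonLearner [MeasurableSpace X] {n d : ℕ} {H : Set (X → Fin K)}
    (hmeas : ∀ h ∈ H, Measurable h) (hH : ¬ LDeep d H) {A : Learner X K n} {α c : ℝ}
    (hA : ∀ (W : Type u) [MeasurableSpace W] [DiscreteMeasurableSpace W] [Countable W]
      (P : Measure W) [IsProbabilityMeasure P] (ι : W → X × Fin K),
      ENNReal.ofReal c ≤ ∫⁻ S, (A fun j => ι (S j)).toOuterMeasure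
        (nearOptimal P ι H α) ∂(Measure.pi fun _ : Fin n => P))
    (D : Measure (X × Fin K)) [IsProbabilityMeasure D] (hsep : DoobSeparable H (D.map Prod.fst)) :
    ENNReal.ofReal c ≤ outputProb D (canonLearner H A)
      {f | popLoss D f ≤ (⨅ h ∈ H, popLoss D h) + ENNReal.ofReal α} := by
  have : IsProbabilityMeasure (D.map Prod.fst) :=
    Measure.isProbabilityMeasure_map measurable_fst.aemeasurable
  obtain ⟨R, _, _, _, θ, ρ, hθ, hρ⟩ := exists_countable_factor hmeas hH _ hsep
  let θ' : X × Fin K → R × Fin K := fun z => (θ z.1, z.2)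
  let ι : R × Fin K → X × Fin K := fun w => (ρ w.1, w.2)
  have hθ' : Measurable θ' := (hθ.comp measurable_fst).prodMk measurable_snd
  have hι : ∀ᵐ z ∂D, ι (θ' z) = (canonPoint H z.1, z.2) := by
    filter_upwards [ae_of_ae_map measurable_fst.aemeasurable hρ] with z hz
    simp only [ι, θ', hz]
  set P := D.map θ' with hP
  have : IsProbabilityMeasure P := Measure.isProbabilityMeasure_map hθ'.aemeasurable
  have hloss : ∀ f : X → Fin K,
      popLoss D (f ∘ canonPoint H) = P {w | f (ι w).1 ≠ (ι w).2} := by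
    intro f
    rw [hP, Measure.map_apply hθ' MeasurableSet.of_discrete, popLoss]
    apply measure_congr
    filter_upwards [hι] with z hz
    apply propext
    show f (canonPoint H z.1) ≠ z.2 ↔ f (ι (θ' z)).1 ≠ (ι (θ' z)).2
    rw [hz]
  have hopt : ∀ f ∈ nearOptimal P ι H α,
      popLoss D (f ∘ canonPoint H) ≤ (⨅ h ∈ H, popLoss D h) + ENNReal.ofReal α := by
    intro f hf
    rw [← tsub_le_iff_right]
    refine le_iInf₂ fun h hh => ?_
    rw [tsub_le_iff_right, ← popLoss_comp_canonPoint hh, hloss, hloss]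
    exact hf h hh
  have hsample : ∀ᵐ S ∂(Measure.pi fun _ : Fin n => D), ∀ j,
      ι (θ' (S j)) = (canonPoint H (S j).1, (S j).2) :=
    ae_all_iff.mpr fun j =>
      (measurePreserving_eval (fun _ : Fin n => D) j).quasiMeasurePreserving.ae hι
  have hmp : MeasurePreserving (fun (S : Fin n → X × Fin K) j => θ' (S j))
      (Measure.pi fun _ => D) (Measure.pi fun _ => P) :=
    measurePreserving_pi _ _ fun _ => ⟨hθ', rfl⟩
  refine (hA (R × Fin K) P ι).trans ?_
  rw [← hmp.lintegral_comp (f := fun S => (A fun j => ι (S j)).toOuterMeasure (nearOptimal P ι H α))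
    Measurable.of_discrete, outputProb]
  refine lintegral_mono_ae ?_
  filter_upwards [hsample] with S hS
  rw [canonLearner, PMF.toOuterMeasure_map_apply]
  simp only [hS]
  exact measure_mono fun f hf => hopt f hf

end DoobSeparable

theorem mainTheorem9 (K : ℕ) (hK : 2 ≤ K) (d : ℕ) :
    ∃ C : ℝ, 0 < C ∧
      ∀ (X : Type*) [MeasurableSpace X] (H : Set (X → Fin K)),
        (∀ h ∈ H, Measurable h) → Ldim H = (d : ℕ∞) →
        ∀ ε δ α β : ℝ, ε ∈ Set.Ioo (0 : ℝ) 1 → δ ∈ Set.Ioo (0 : ℝ) 1 →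
          α ∈ Set.Ioo (0 : ℝ) (1 / 2) → β ∈ Set.Ioo (0 : ℝ) (1 / 2) →
          ∀ n : ℕ, C * (Real.log (1 / (β * δ)) / (α ^ 2 * ε)) ≤ (n : ℝ) →
            ∃ A : Learner X K n, IsDP ε δ A ∧
              ∀ D : Measure (X × Fin K), IsProbabilityMeasure D →
                DoobSeparable H (D.map Prod.fst) →
                ENNReal.ofReal (1 - β) ≤
                  outputProb D A
                    {f | popLoss D f ≤ (⨅ h ∈ H, popLoss D h) + ENNReal.ofReal α} := by
  have : NeZero K := ⟨by omega⟩
  obtain ⟨C, hC, hlearn⟩ := exists_private_learner d K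
  refine ⟨C, hC, ?_⟩
  intro X _ H hmeas hdim ε δ α β hε hδ hα hβ n hn
  have hH := not_lDeep_of_Ldim_eq hdim
  rcases H.eq_empty_or_nonempty with rfl | hne
  · refine ⟨fun _ => PMF.pure fun _ => 0, fun S S' _ T => ?_, fun D _ _ => ?_⟩
    · refine le_add_right (le_mul_of_one_le_left zero_le ?_)
      rw [ENNReal.one_le_ofReal]
      exact Real.one_le_exp hε.1.le
    · simp only [Set.mem_empty_iff_false, iInf_false, iInf_top, top_add, le_top, outputProb]
      rw [show {_f : X → Fin K | True} = Set.univ from Set.eq_univ_of_forall fun _ => trivial]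
      simp only [PMF.toOuterMeasure_univ, lintegral_one, measure_univ]
      rw [← ENNReal.ofReal_one]
      exact ENNReal.ofReal_le_ofReal (by linarith [hβ.1])
  · obtain ⟨A, hA1, hA2⟩ := hlearn X H hH hne ε δ α β hε hδ hα hβ n hn
    exact ⟨canonLearner H A, isDP_canonLearner hA1, fun D _ hsep =>
      le_outputProb_canonLearner hmeas hH hA2 D hsep⟩
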